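/- Let $p$ be a prime, let $\Gamma$ be a topological group isomorphic to $\mathbb Z_p$ and let $\gamma$ be a topological generator of $\Gamma$. Write $\Lambda=\Lambda(\Gamma)=\varprojlim_U\mathbb Z_p[\Gamma/U]$ for the Iwasawa algebra, $Q(\Gamma)$ for its quotient field, $T=\gamma-1$, and $x\mapsto x(0)$ for the augmentation $\Lambda\to\mathbb Z_p$. Every $F\in Q(\Gamma)^\times$ is uniquely $F=T^{r}G$ with $r=r(F)\in\mathbb Z$ and $G=x/s$, $x,s\in\Lambda$, $x(0)\neq 0\neq s(0)$; put $F^*(0):=G(0)=x(0)/s(0)\in\mathbb Q_p^\times$. For a commutative local ring $R$ let $\mathbf d_R$ be the determinant functor on bounded complexes of finitely generated projective $R$-modules, with values in the Picard category of virtual objects: $\mathbf d_R(C)=(C^+,C^-)$ with $C^\pm$ the sum of the terms of even, resp. odd, degree, and a morphism $\mathbf 1_R\to\mathbf d_R(C)$ is a class $u\cdot[\varphi]$ with $u\in R^\times=K_1(R)$ and $\varphi:C^-\xrightarrow{\sim}C^+$, where $[\varphi]=\det(\psi^{-1}\varphi)[\psi]$. If $C$ is acyclic with contraction $s$, its canonical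 morphism $\mathbf 1_R\to\mathbf d_R(C)$ is $[d+s]$. For a quasi-isomorphism $f:C\to C'$ and $a:\mathbf 1_R\to\mathbf d_R(C)$, $\mathbf d_R(f)\circ a$ is the morphism $a'$ for which $a'\cdot a^{-1}$ is the canonical morphism of the acyclic complex $\mathrm{cone}(f)$ under $\mathbf d_R(\mathrm{cone}(f))=\mathbf d_R(C')\mathbf d_R(C)^{-1}$. Let $A$ be a bounded complex of finitely generated projective $\Lambda$-modules. The Bockstein morphisms $\mathfrak B: H^i(\mathbb Z_p\otimes_\Lambda A)\to H^{i+1}(\mathbb Z_p\otimes_\Lambda A)$ send the class of $1\otimes x$ to the class of $1\otimes y$ whenever $dx+Ty=0$ (and $dy=0$). $A$ is semisimple if the complex $(H^\bullet(\mathbb Z_p\otimes_\Lambda A),\mathfrak B)$ has $\mathbb Z_p$-torsion cohomology in all degrees; $\Sigma_{\rm ss}$ is the class of such complexes, and for $A\in\Sigma_{\rm ss}$ $$r_\Gamma(A)=\sum_{i\in\mathbb Z}(-1)^{i+1}\dim_{\mathbb Q_p}\bigl(H^i(A)^\Gamma\otimes_{\mathbb Z_p}\mathbb Q_p\bigr).$$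 Let $K_1(\Lambda,\Sigma_{\rm ss})$ be the abelian group with generators $[A,a]$ ($A\in\Sigma_{\rm ss}$, $a:\mathbf 1_\Lambda\to\mathbf d_\Lambda(A)$) and the relations $[0,\mathrm{id}]=1$; $[C',\mathbf d(f)\circ a]=[C,a]$ for quasi-isomorphisms $f:C\to C'$; $[C,a'\cdot a'']=[C',a'][C'',a'']$ for short exact sequences $0\to C'\to C\to C''\to0$ in $\Sigma_{\rm ss}$; $[C[1],a^{-1}]=[C,a]^{-1}$. For $A\in\Sigma_{\rm ss}$ the complex $Q(\Gamma)\otimes_\Lambda A$ is acyclic, and $\mathrm{ch}_\Gamma:K_1(\Lambda,\Sigma_{\rm ss})\to K_1(Q(\Gamma))=Q(\Gamma)^\times$ is the homomorphism sending $[A,a]$ to the composite $\mathbf 1\xrightarrow{a}\mathbf d(Q(\Gamma)\otimes_\Lambda A)\to\mathbf 1$, the second arrow being given by acyclicity. The homomorphism $(-)^*(\rho_{\rm triv}):K_1(\Lambda,\Sigma_{\rm ss})\to\mathbb Q_p^\times$ sends $[A,a]$ to $(-1)^{r_\Gamma(A)}$ times the composite $$\mathbf 1\xrightarrow{a}\mathbf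 d(\mathbb Q_p\otimes_\Lambda A)\cong\mathbf d(H^\bullet(\mathbb Q_p\otimes_\Lambda A),0)=\mathbf d(H^\bullet(\mathbb Q_p\otimes_\Lambda A),\mathfrak B)\cong\mathbf 1,$$ where the first isomorphism is induced by a morphism of complexes $H^\bullet\to \mathbb Q_p\otimes_\Lambda A$ that is the identity on cohomology and the last one by the acyclicity of $(H^\bullet,\mathfrak B)$. Then these homomorphisms are well defined, and (i) for every $A\in\Sigma_{\rm ss}$ and every $a:\mathbf 1_\Lambda\to\mathbf d_\Lambda(A)$ one has $r(\mathrm{ch}_\Gamma([A,a]))=r_\Gamma(A)$; (ii) $\mathrm{ch}_\Gamma(\xi)^*(0)=\xi^*(\rho_{\rm triv})$ for every $\xi\in K_1(\Lambda,\Sigma_{\rm ss})$; in particular $[A,a]^*(\rho_{\rm triv})=\mathrm{ch}_\Gamma([A,a])^*(0)$. -/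

import Mathlib

open CategoryTheory DirectSum
open scoped TensorProduct ChangeOfRings

noncomputable section

namespace IwasawaLeadingTerm

/-! ### Determinants of bounded complexes of finitely generated projective modules

Throughout this part `R` is a commutative ring. The determinant formalism is used only for local
rings `R` (an Iwasawa algebra, `Q(Γ)`, `ℚ_p`), where finitely generated projective modules are free
and `K₁(R) = Rˣ` by the determinant. In the Picard category `C_R` (virtual objects, built from
pairs of modules) the determinant of a graded module `X` is the pair `(X⁺, X⁻)` of its even and odd
parts, and
`Mor(1_R, (X⁺, X⁻)) = K₁(R) ×^{Aut(X⁺)} Isom(X⁻, X⁺)`. -/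

section Determinants

variable {R : Type} [CommRing R]

/-- The sum of the components of even degree. -/
abbrev evenPart (X : ℤ → ModuleCat.{0} R) : Type :=
  ⨁ i : {i : ℤ // Even i}, X i

/-- The sum of the components of odd degree. -/
abbrev oddPart (X : ℤ → ModuleCat.{0} R) : Type :=
  ⨁ i : {i : ℤ // Odd i}, X i

/-- A representative `(u, φ)` of a morphism `1_R → d_R(X)`. -/
structure PreTriv (X : ℤ → ModuleCat.{0} R) where
  unit : Rˣ
  iso : oddPart X ≃ₗ[R] evenPart X

/-- `(u, φ)` and `(v, ψ)` define the same morphism iff `v = u * det(ψ⁻¹ ∘ φ)`. -/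
instance PreTriv.setoid (X : ℤ → ModuleCat.{0} R) : Setoid (PreTriv X) where
  r a b := b.unit = a.unit * LinearEquiv.det (a.iso.trans b.iso.symm)
  iseqv := by
    refine ⟨fun a => ?_, fun {a b} h => ?_, fun {a b c} h h' => ?_⟩
    · have : a.iso.trans a.iso.symm = 1 := by ext1 x; simp
      rw [this, map_one, mul_one]
    · have : (b.iso.trans a.iso.symm) * (a.iso.trans b.iso.symm) = 1 := by
        ext1 x; simp [LinearEquiv.mul_apply]
      have h2 := congrArg LinearEquiv.det this
      rw [map_mul, map_one] at h2
      rw [h, mul_assoc, mul_comm (LinearEquiv.det (a.iso.trans _)), h2, mul_one]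
    · have : (b.iso.trans c.iso.symm) * (a.iso.trans b.iso.symm) = a.iso.trans c.iso.symm := by
        ext1 x; simp [LinearEquiv.mul_apply]
      rw [h', h, ← this, map_mul, mul_assoc, mul_comm (LinearEquiv.det (a.iso.trans _))]

/-- Morphisms `1_R → d_R(X)` ("trivializations" of `X`). -/
def Triv (X : ℤ → ModuleCat.{0} R) : Type := Quotient (PreTriv.setoid X)

/-- The morphism represented by `(u, φ)`. -/
def Triv.mk {X : ℤ → ModuleCat.{0} R} (u : Rˣ) (φ : oddPart X ≃ₗ[R] evenPart X) : Triv X :=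
  Quotient.mk _ ⟨u, φ⟩

/-- The action of `Rˣ = K₁(R) = Aut(1_R)` on `Mor(1_R, d_R(X))`. -/
instance (X : ℤ → ModuleCat.{0} R) : SMul Rˣ (Triv X) where
  smul v := Quotient.map (fun a => ⟨v * a.unit, a.iso⟩) (by
    intro a b h
    have h : b.unit = a.unit * LinearEquiv.det (a.iso.trans b.iso.symm) := h
    change v * b.unit = v * a.unit * LinearEquiv.det (a.iso.trans b.iso.symm)
    rw [h, mul_assoc])

/-- The terms of the shift `X[1]`. -/
abbrev shiftTerms (X : ℤ → ModuleCat.{0} R) : ℤ → ModuleCat.{0} R := fun i => X (i + 1)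

/-- Even and odd degrees correspond under `i ↦ i - 1`. -/
def evenEquivOdd : {i : ℤ // Even i} ≃ {i : ℤ // Odd i} where
  toFun i := ⟨i - 1, i.2.sub_odd odd_one⟩
  invFun i := ⟨i + 1, i.2.add_odd odd_one⟩
  left_inv i := by simp
  right_inv i := by simp

/-- Odd and even degrees correspond under `i ↦ i - 1`. -/
def oddEquivEven : {i : ℤ // Odd i} ≃ {i : ℤ // Even i} where
  toFun i := ⟨i - 1, i.2.sub_odd odd_one⟩
  invFun i := ⟨i + 1, i.2.add_odd odd_one⟩
  left_inv i := by simp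
  right_inv i := by simp

/-- `X⁺ = (X[1])⁻`. -/
def evenShift (X : ℤ → ModuleCat.{0} R) : evenPart X ≃ₗ[R] oddPart (shiftTerms X) :=
  DirectSum.lequivCongrLeft R (M := fun i : {i : ℤ // Even i} => X i) evenEquivOdd

/-- `X⁻ = (X[1])⁺`. -/
def oddShift (X : ℤ → ModuleCat.{0} R) : oddPart X ≃ₗ[R] evenPart (shiftTerms X) :=
  DirectSum.lequivCongrLeft R (M := fun i : {i : ℤ // Odd i} => X i) oddEquivEven

/-- For `a : 1 → d(X)`, the morphism `a⁻¹ : 1 → d(X)⁻¹ = d(X[1])` with `a · a⁻¹ = id`.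
The identification `d(X) d(X)⁻¹ = 1` is given by the interchange `X⁻ ⊕ X⁺ → X⁺ ⊕ X⁻`, and
`φ ⊕ (-φ⁻¹)` differs from the interchange by an automorphism of determinant one; this is the
reason for the sign. -/
def Triv.inv {X : ℤ → ModuleCat.{0} R} : Triv X → Triv (shiftTerms X) :=
  Quotient.map
    (fun a => ⟨a.unit⁻¹,
      (((evenShift X).symm.trans a.iso.symm).trans (LinearEquiv.neg R)).trans (oddShift X)⟩) (by
    intro a b h
    have h : b.unit = a.unit * LinearEquiv.det (a.iso.trans b.iso.symm) := h
    change b.unit⁻¹ = a.unit⁻¹ * LinearEquiv.det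
      (((((evenShift X).symm.trans a.iso.symm).trans (LinearEquiv.neg R)).trans (oddShift X)).trans
      ((((evenShift X).symm.trans b.iso.symm).trans (LinearEquiv.neg R)).trans (oddShift X)).symm)
    have key : ((((evenShift X).symm.trans a.iso.symm).trans (LinearEquiv.neg R)).trans
        (oddShift X)).trans
        ((((evenShift X).symm.trans b.iso.symm).trans (LinearEquiv.neg R)).trans (oddShift X)).symm
        = ((b.iso.trans (evenShift X)).symm.trans (a.iso.trans b.iso.symm)⁻¹).trans
          (b.iso.trans (evenShift X)) := by
      ext1 x
      have hinv : (a.iso.trans b.iso.symm)⁻¹ = b.iso.trans a.iso.symm := by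
        rw [inv_eq_iff_mul_eq_one]
        ext1 y; simp [LinearEquiv.mul_apply]
      rw [hinv]
      simp
    rw [key, LinearEquiv.det_conj, map_inv, h, mul_inv])

/-- The map induced on even parts by a family of maps. -/
def evenMap {X Y : ℤ → ModuleCat.{0} R} (f : ∀ i, X i ⟶ Y i) : evenPart X →ₗ[R] evenPart Y :=
  DirectSum.lmap fun i : {i : ℤ // Even i} => (f i).hom

/-- The map induced on odd parts by a family of maps. -/
def oddMap {X Y : ℤ → ModuleCat.{0} R} (f : ∀ i, X i ⟶ Y i) : oddPart X →ₗ[R] oddPart Y :=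
  DirectSum.lmap fun i : {i : ℤ // Odd i} => (f i).hom

/-- For a degreewise short exact sequence `0 → X' → X → X'' → 0` with maps `f`, `g`: the morphism
`a` is the product `a' · a''` under the identification `d(X) = d(X') d(X'')`. -/
def IsProduct {X' X X'' : ℤ → ModuleCat.{0} R} (f : ∀ i, X' i ⟶ X i) (g : ∀ i, X i ⟶ X'' i)
    (a' : Triv X') (a : Triv X) (a'' : Triv X'') : Prop :=
  ∃ (u' u'' : Rˣ) (φ' : oddPart X' ≃ₗ[R] evenPart X') (φ : oddPart X ≃ₗ[R] evenPart X)
    (φ'' : oddPart X'' ≃ₗ[R] evenPart X''),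
    a' = Triv.mk u' φ' ∧ a'' = Triv.mk u'' φ'' ∧ a = Triv.mk (u' * u'') φ ∧
    (∀ x, φ (oddMap f x) = evenMap f (φ' x)) ∧ (∀ x, evenMap g (φ x) = φ'' (oddMap g x))

/-- Objects of `C^p(R)`: bounded complexes of finitely generated projective modules. -/
structure IsStrictlyPerfect (C : CochainComplex (ModuleCat.{0} R) ℤ) : Prop where
  finite : ∀ i, Module.Finite R (C.X i)
  projective : ∀ i, Module.Projective R (C.X i)
  bounded : ∃ m n : ℤ, ∀ i, i < m ∨ n < i → Subsingleton (C.X i)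

/-- For a contraction `s` of `C`, the map `d + s : C⁻ → C⁺`. -/
def dPlusS {C : CochainComplex (ModuleCat.{0} R) ℤ} (s : Homotopy (𝟙 C) 0) :
    oddPart C.X →ₗ[R] evenPart C.X :=
  DirectSum.toModule R _ _ fun j : {i : ℤ // Odd i} =>
    DirectSum.lof R {i : ℤ // Even i} (fun i => C.X i) ⟨j + 1, j.2.add_odd odd_one⟩ ∘ₗ
        (C.d j (j + 1)).hom +
      DirectSum.lof R {i : ℤ // Even i} (fun i => C.X i) ⟨j - 1, j.2.sub_odd odd_one⟩ ∘ₗ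
        (s.hom j (j - 1)).hom

/-- `b` is the canonical morphism `1 → d(C)` attached to the acyclic complex `C` of `C^p(R)`. It is
the class of `d + s` for any contraction `s`; on `P → P` in degrees `0, 1` with an invertible
differential `φ` it is the class of `φ⁻¹`, in degrees `-1, 0` that of `φ`. -/
def IsAcyclicTriv (C : CochainComplex (ModuleCat.{0} R) ℤ) (b : Triv C.X) : Prop :=
  ∃ (s : Homotopy (𝟙 C) 0) (ψ : oddPart C.X ≃ₗ[R] evenPart C.X),
    (ψ : oddPart C.X →ₗ[R] evenPart C.X) = dPlusS s ∧ b = Triv.mk 1 ψ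

/-- `a' = d(f) ∘ a` for a quasi-isomorphism `f : C → C'`, that is, `a' · a⁻¹` is the canonical
morphism of the acyclic complex `cone(f)`, under `d(cone(f)) = d(C') d(C[1]) = d(C') d(C)⁻¹`. -/
def IsDetComp {C C' : CochainComplex (ModuleCat.{0} R) ℤ} (f : C ⟶ C')
    (a : Triv C.X) (a' : Triv C'.X) : Prop :=
  ∃ b : Triv (CochainComplex.mappingCone f).X,
    IsAcyclicTriv (CochainComplex.mappingCone f) b ∧
    IsProduct (X'' := shiftTerms C.X) (fun i => (CochainComplex.mappingCone.inr f).f i)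
      (fun i => (CochainComplex.mappingCone.fst f).1.v i (i + 1) rfl) a' b a.inv

/-! ### The localized `K₁`-group -/

/-- The generators `[C, a]` of `K₁(R, Σ)`. -/
structure K1Gen (Sig : CochainComplex (ModuleCat.{0} R) ℤ → Prop) where
  C : CochainComplex (ModuleCat.{0} R) ℤ
  mem : Sig C
  a : Triv C.X

/-- The relations between the generators, written as elements to be set equal to one. -/
inductive K1Rel (Sig : CochainComplex (ModuleCat.{0} R) ℤ → Prop) : FreeGroup (K1Gen Sig) → Prop
  | zero (Z : CochainComplex (ModuleCat.{0} R) ℤ) (hZ : Limits.IsZero Z) (h : Sig Z)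
      (φ : oddPart Z.X ≃ₗ[R] evenPart Z.X) :
      K1Rel Sig (FreeGroup.of ⟨Z, h, Triv.mk 1 φ⟩)
  | quasiIso (C C' : CochainComplex (ModuleCat.{0} R) ℤ) (h : Sig C) (h' : Sig C')
      (f : C ⟶ C') (hf : QuasiIso f) (a : Triv C.X) (a' : Triv C'.X) (haa' : IsDetComp f a a') :
      K1Rel Sig (FreeGroup.of ⟨C', h', a'⟩ * (FreeGroup.of ⟨C, h, a⟩)⁻¹)
  | exact (S : ShortComplex (CochainComplex (ModuleCat.{0} R) ℤ)) (hS : S.ShortExact)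
      (h₁ : Sig S.X₁) (h₂ : Sig S.X₂) (h₃ : Sig S.X₃)
      (a₁ : Triv S.X₁.X) (a₂ : Triv S.X₂.X) (a₃ : Triv S.X₃.X)
      (ha : IsProduct (fun i => S.f.f i) (fun i => S.g.f i) a₁ a₂ a₃) :
      K1Rel Sig (FreeGroup.of ⟨S.X₂, h₂, a₂⟩ *
        (FreeGroup.of ⟨S.X₁, h₁, a₁⟩ * FreeGroup.of ⟨S.X₃, h₃, a₃⟩)⁻¹)
  | shift (C : CochainComplex (ModuleCat.{0} R) ℤ) (h : Sig C)
      (h' : Sig ((shiftFunctor (CochainComplex (ModuleCat.{0} R) ℤ) (1 : ℤ)).obj C))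
      (a : Triv C.X) :
      K1Rel Sig (FreeGroup.of ⟨_, h', a.inv⟩ * FreeGroup.of ⟨C, h, a⟩)

/-- The localized group `K₁(R, Σ)`. -/
abbrev K1 (Sig : CochainComplex (ModuleCat.{0} R) ℤ → Prop) : Type 1 :=
  Abelianization (PresentedGroup {w | K1Rel Sig w})

/-- The element `[C, a]` of `K₁(R, Σ)`. -/
def K1.mk {Sig : CochainComplex (ModuleCat.{0} R) ℤ → Prop}
    (C : CochainComplex (ModuleCat.{0} R) ℤ) (hC : Sig C) (a : Triv C.X) : K1 Sig :=
  Abelianization.of (PresentedGroup.of ⟨C, hC, a⟩)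

/-! ### Base change -/

variable {S : Type} [CommRing S] (f : R →+* S)

instance extendScalars_additive : (ModuleCat.extendScalars.{0} f).Additive where
  map_add {M N g h} := by
    apply ModuleCat.ExtendScalars.hom_ext
    intro m
    let _ := f.toAlgebra
    exact TensorProduct.tmul_add (1 : S) (g.hom m) (h.hom m)

/-- The complex `S ⊗_R C`. -/
def baseChange (C : CochainComplex (ModuleCat.{0} R) ℤ) : CochainComplex (ModuleCat.{0} S) ℤ :=
  ((ModuleCat.extendScalars f).mapHomologicalComplex _).obj C

/-- The map `x ↦ 1 ⊗ x` from `C^i` to `S ⊗_R C^i`. -/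
def toBaseChange (C : CochainComplex (ModuleCat.{0} R) ℤ) (i : ℤ) :
    C.X i →+ (baseChange f C).X i where
  toFun x := ((1 : S) ⊗ₜ[R,f] x : (ModuleCat.extendScalars f).obj (C.X i))
  map_zero' := TensorProduct.tmul_zero _ _
  map_add' x y := TensorProduct.tmul_add _ x y

/-- `a'` is the morphism `1_S → d_S(S ⊗_R C)` induced by `a : 1_R → d_R(C)`. -/
def IsBaseChangeTriv (C : CochainComplex (ModuleCat.{0} R) ℤ) (a : Triv C.X)
    (a' : Triv (baseChange f C).X) : Prop :=
  ∃ (u : Rˣ) (φ : oddPart C.X ≃ₗ[R] evenPart C.X)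
    (φ' : oddPart (baseChange f C).X ≃ₗ[S] evenPart (baseChange f C).X),
    a = Triv.mk u φ ∧ a' = Triv.mk (Units.map (f : R →* S) u) φ' ∧
    ∀ x : oddPart C.X,
      φ' (DirectSum.map (fun i : {i : ℤ // Odd i} => toBaseChange f C i) x) =
        DirectSum.map (fun i : {i : ℤ // Even i} => toBaseChange f C i) (φ x)

/-! ### Cohomology and the Bockstein morphisms -/

/-- The cochain `c` is a cocycle whose class is `h`. -/
def Represents (C : CochainComplex (ModuleCat.{0} R) ℤ) (i : ℤ) (c : C.X i) (h : C.homology i) :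
    Prop :=
  ∃ z : C.cycles i, (C.iCycles i).hom z = c ∧ (C.homologyπ i).hom z = h

/-- The Bockstein morphisms of the pair `(A, T)` on the cohomology of `S ⊗_R A`, where `f : R → S`
is reduction modulo `T`, possibly followed by a flat base change. A cocycle of
`cone(T : A → A)` in degree `i` is a pair `(x, y)` in `A^i ⊕ A^{i+1}` with `dx + Ty = 0`, `dy = 0`;
it maps to the cocycle `1 ⊗ x` of `S ⊗_R A`, and `θ : cone(T) → cone(T)[1]` maps it to `(y, 0)`. -/
structure Bockstein (T : R) (A : CochainComplex (ModuleCat.{0} R) ℤ) where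
  map : ∀ i, (baseChange f A).homology i ⟶ (baseChange f A).homology (i + 1)
  map_comp_map : ∀ i, map i ≫ map (i + 1) = 0
  spec : ∀ (i : ℤ) (x : A.X i) (y : A.X (i + 1)),
    (A.d i (i + 1)).hom x + T • y = 0 → (A.d (i + 1) (i + 1 + 1)).hom y = 0 →
    ∀ h h', Represents (baseChange f A) i (toBaseChange f A i x) h →
      Represents (baseChange f A) (i + 1) (toBaseChange f A (i + 1) y) h' → (map i).hom h = h'

/-- The complex of cohomology modules with zero differentials. -/
def cohomologyComplex (C : CochainComplex (ModuleCat.{0} R) ℤ) :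
    CochainComplex (ModuleCat.{0} R) ℤ :=
  CochainComplex.of (fun i => C.homology i) (fun _ => 0) (fun _ => by simp)

variable {f} in
/-- The complex of cohomology modules with the Bockstein morphisms as differentials. -/
def Bockstein.complex {T : R} {A : CochainComplex (ModuleCat.{0} R) ℤ} (B : Bockstein f T A) :
    CochainComplex (ModuleCat.{0} S) ℤ :=
  CochainComplex.of (fun i => (baseChange f A).homology i) B.map B.map_comp_map

end Determinants

/-! ### The Iwasawa algebra -/

section Iwasawa

variable (p : ℕ) [Fact p.Prime] (Γ : Type) [CommGroup Γ] [TopologicalSpace Γ]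
  [IsTopologicalGroup Γ]

/-- The projective limit of the group rings `ℤ_p[Γ/U]` over the open subgroups `U` of `Γ`, as the
algebra of compatible families. -/
def iwasawaSubalgebra :
    Subalgebra ℤ_[p] (∀ U : OpenSubgroup Γ, MonoidAlgebra ℤ_[p] (Γ ⧸ (U : Subgroup Γ))) where
  carrier := {x | ∀ (U V : OpenSubgroup Γ) (h : (U : Subgroup Γ) ≤ V),
    MonoidAlgebra.mapDomainAlgHom ℤ_[p] ℤ_[p]
      (QuotientGroup.map (U : Subgroup Γ) (V : Subgroup Γ) (MonoidHom.id Γ) h) (x U) = x V}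
  mul_mem' {x y} hx hy U V h := by rw [Pi.mul_apply, map_mul, hx U V h, hy U V h, Pi.mul_apply]
  add_mem' {x y} hx hy U V h := by rw [Pi.add_apply, map_add, hx U V h, hy U V h, Pi.add_apply]
  algebraMap_mem' r U V h := by
    rw [Pi.algebraMap_apply, AlgHom.commutes, Pi.algebraMap_apply]

/-- The Iwasawa algebra `Λ(Γ) = ℤ_p[[Γ]]`. -/
abbrev IwasawaAlgebra : Type := iwasawaSubalgebra p Γ

/-- The total quotient ring `Q(Γ)` of `Λ(Γ)`. -/
abbrev QΓ : Type := FractionRing (IwasawaAlgebra p Γ)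

/-- The augmentation map `Λ(Γ) → ℤ_p`. -/
def augmentation : IwasawaAlgebra p Γ →+* ℤ_[p] :=
  ((MonoidAlgebra.lift ℤ_[p] ℤ_[p] (Γ ⧸ ((⊤ : OpenSubgroup Γ) : Subgroup Γ)) 1 :
      MonoidAlgebra ℤ_[p] (Γ ⧸ ((⊤ : OpenSubgroup Γ) : Subgroup Γ)) →ₐ[ℤ_[p]] ℤ_[p]) :
      MonoidAlgebra ℤ_[p] (Γ ⧸ ((⊤ : OpenSubgroup Γ) : Subgroup Γ)) →+* ℤ_[p]).comp
    ((Pi.evalRingHom _ (⊤ : OpenSubgroup Γ)).comp (iwasawaSubalgebra p Γ).subtype)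

/-- The map `Λ(Γ) → ℤ_p → ℚ_p`. -/
def augmentationQ : IwasawaAlgebra p Γ →+* ℚ_[p] :=
  (algebraMap ℤ_[p] ℚ_[p]).comp (augmentation p Γ)

variable {Γ}

/-- The element `γ - 1` of `Λ(Γ)`. -/
def varT (γ : Γ) : IwasawaAlgebra p Γ :=
  ⟨fun U => MonoidAlgebra.of ℤ_[p] (Γ ⧸ (U : Subgroup Γ)) (QuotientGroup.mk γ), by
    intro U V h
    simp [MonoidAlgebra.mapDomainAlgHom]
    rfl⟩ - 1

/-- `F = T^r G` in `Q(Γ)`, with `T = γ - 1` and `G = x / s` defined at `T = 0` with value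
`G(0) = x(0) / s(0) = c` in `ℚ_pˣ`. The exponent is written `r = m - n`. -/
def HasLeadingTerm (γ : Γ) (F : (QΓ p Γ)ˣ) (r : ℤ) (c : ℚ_[p]ˣ) : Prop :=
  ∃ (m n : ℕ) (x s : IwasawaAlgebra p Γ), r = m - n ∧
    augmentationQ p Γ x ≠ 0 ∧ augmentationQ p Γ s ≠ 0 ∧
    (F : QΓ p Γ) * algebraMap (IwasawaAlgebra p Γ) (QΓ p Γ) (varT p γ ^ n * s) =
      algebraMap (IwasawaAlgebra p Γ) (QΓ p Γ) (varT p γ ^ m * x) ∧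
    (c : ℚ_[p]) = augmentationQ p Γ x / augmentationQ p Γ s

/-- `A` belongs to `Σ_ss`: it lies in `C^p(Λ(Γ))`, and the cohomology of the complex formed by
`H^i(ℤ_p ⊗_{Λ(Γ)} A)` and the Bockstein morphisms is `ℤ_p`-torsion in all degrees. -/
structure IsSemisimple (γ : Γ) (A : CochainComplex (ModuleCat.{0} (IwasawaAlgebra p Γ)) ℤ) :
    Prop where
  perfect : IsStrictlyPerfect A
  torsion : ∃ B : Bockstein (augmentation p Γ) (varT p γ) A,
    ∀ (i : ℤ) (h : (baseChange (augmentation p Γ) A).homology (i + 1)),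
      (B.map (i + 1)).hom h = 0 →
        ∃ c : ℤ_[p], c ≠ 0 ∧ ∃ g, (B.map i).hom g = c • h

/-- `r_Γ(A) = ∑ (-1)^{i+1} dim_{ℚ_p} (H^i(A)^Γ ⊗ ℚ_p)`, where `H^i(A)^Γ` is the kernel of `T` on
`H^i(A)`. -/
def rGamma (γ : Γ) (A : CochainComplex (ModuleCat.{0} (IwasawaAlgebra p Γ)) ℤ) : ℤ :=
  ∑ᶠ i : ℤ, ((Int.negOnePow (i + 1) : ℤˣ) : ℤ) *
    (Module.finrank ℚ_[p] (ℚ_[p] ⊗[ℤ_[p]] RestrictScalars ℤ_[p] (IwasawaAlgebra p Γ)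
      (Submodule.torsionBy (IwasawaAlgebra p Γ) (A.homology i) (varT p γ))) : ℤ)

/-- `F` is the automorphism of `1_{Q(Γ)}` given by `1 → d(Q(Γ) ⊗ A) → 1`, where the first arrow is
induced by `a` and the second by the acyclicity of `Q(Γ) ⊗ A`. -/
def IsTheta (A : CochainComplex (ModuleCat.{0} (IwasawaAlgebra p Γ)) ℤ) (a : Triv A.X)
    (F : (QΓ p Γ)ˣ) : Prop :=
  ∃ a' b : Triv (baseChange (algebraMap (IwasawaAlgebra p Γ) (QΓ p Γ)) A).X,
    IsBaseChangeTriv (algebraMap (IwasawaAlgebra p Γ) (QΓ p Γ)) A a a' ∧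
    IsAcyclicTriv (baseChange (algebraMap (IwasawaAlgebra p Γ) (QΓ p Γ)) A) b ∧ a' = F • b

/-- `b` is the inverse `1 → d(ℚ_p ⊗ A)` of the canonical trivialization `t(A)`: the composite of
the canonical morphism `1 → d(H, 𝔅)` of the acyclic complex `(H, 𝔅)`, the equality
`d(H, 𝔅) = d(H, 0)` and the isomorphism `d(H, 0) ≅ d(ℚ_p ⊗ A)` induced by a morphism of complexes
`ι` which is the identity on cohomology; here `H` is the cohomology of `ℚ_p ⊗ A`. -/
def IsCanonicalTriv (γ : Γ) (A : CochainComplex (ModuleCat.{0} (IwasawaAlgebra p Γ)) ℤ)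
    (b : Triv (baseChange (augmentationQ p Γ) A).X) : Prop :=
  ∃ (B : Bockstein (augmentationQ p Γ) (varT p γ) A)
    (bH : Triv fun i => (baseChange (augmentationQ p Γ) A).homology i)
    (ι : cohomologyComplex (baseChange (augmentationQ p Γ) A) ⟶ baseChange (augmentationQ p Γ) A),
    IsAcyclicTriv B.complex bH ∧
    (∀ (i : ℤ) (h : (baseChange (augmentationQ p Γ) A).homology i),
      Represents (baseChange (augmentationQ p Γ) A) i ((ι.f i).hom h) h) ∧
    IsDetComp ι bH b

/-- `x` is the leading term `(A, a)^*(ρ_triv)`: it is `(-1)^{r_Γ(A)}` times the automorphism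
`1 → d(ℚ_p ⊗ A) → 1` given by `a` and `t(A)`. -/
def IsLeadingTerm (γ : Γ) (A : CochainComplex (ModuleCat.{0} (IwasawaAlgebra p Γ)) ℤ)
    (a : Triv A.X) (x : ℚ_[p]ˣ) : Prop :=
  ∃ (a' b : Triv (baseChange (augmentationQ p Γ) A).X) (y : ℚ_[p]ˣ),
    IsBaseChangeTriv (augmentationQ p Γ) A a a' ∧ IsCanonicalTriv p γ A b ∧
    a' = y • b ∧ x = (-1) ^ rGamma p γ A * y

end Iwasawa

end IwasawaLeadingTerm

end

/-! Write `k = ℚ_p`, let `ε : Λ → k` be the augmentation, and let `β` be the Bockstein differential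
on the cohomology `H` of `k ⊗ A`. A choice of representatives `ι : H → k ⊗ A`, completed by a
projection `π`, turns `β` into the perturbed differential `D = d + ιβπ` on `k ⊗ A`. Semisimplicity
makes `β` exact over `k`, hence `D` is exact too.

The heart of the proof is `exists_adapted_family`: there are elements `x j`, `z j` of `A`, of
degrees `deg j` and `deg j + 1`, with `d (x j) = z j` or `d (x j) = -T z j`, whose reductions form
bases of all `k ⊗ A^i` and satisfy `D (x j) = z j`. Being a basis is the nonvanishing of a
determinant in `Λ`, so the same elements are bases of `Q(Γ) ⊗ A^i`. In these bases `(Q(Γ) ⊗ A, d)`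
is a sum of two-term complexes with differential `1` or `-T`, and `(k ⊗ A, D)` is a sum of two-term
complexes with differential `1`. Both trivializations are then the same quotient of determinants of
the vectors `x j`, `z j`, one in `Q(Γ)` with an extra factor `(-T)^r`, the other reduced by `ε`
(`exists_isVal_of_fam`, `IsReduction.exists_values`). Here `r` counts the pairs with `-T`, with sign
`+` for even and `-` for odd `deg j`. Thus the order is `r`, and the sign `(-1)^r` is the one in the
definition of the leading term. Each pair with `-T` contributes rank one to the kernel of `T` on
`H^{deg j + 1}(A)`, which gives `r = r_Γ(A)` (`rGamma_eq`).

It remains to see that `t(A)`, defined through `(H, β)`, is the canonical trivialization of `(k ⊗ A,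
D)` (`isVal_of_isDetComp`): the differential of the cone of `ι` can be perturbed by `β` without
changing a contraction of square zero, and such a perturbation does not change the canonical
trivialization (`IsVal.perturb`).

The formal part rests on `isNilpotent_of_homogeneous`: comparison operators `(d + τ)(d + σ)` are
unipotent, so their determinant is `1`. This gives independence of contractions and, with shifts,
split sequences and cones, the relations of `K1` (`exists_charHom`). The properties of `Λ` that are
needed are collected in `isReduction_augmentationQ`. -/

noncomputable section

namespace IwasawaLeadingTerm

/-! ### Operators on graded modules and nilpotence. -/

section GradedOperators

variable {R : Type} [CommRing R]

/-- A family of linear maps between all components of two graded modules. -/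
abbrev GHom (X Y : ℤ → ModuleCat.{0} R) : Type := ∀ i j : ℤ, X i →ₗ[R] Y j

/-- The sum of the components whose degree satisfies `P`. -/
abbrev part (P : ℤ → Prop) (X : ℤ → ModuleCat.{0} R) : Type := ⨁ i : {i : ℤ // P i}, X i

/-- The inclusion of a component. -/
abbrev inPart {P : ℤ → Prop} (X : ℤ → ModuleCat.{0} R) (i : ℤ) (hi : P i) : X i →ₗ[R] part P X :=
  DirectSum.lof R {i : ℤ // P i} (fun i => X i) ⟨i, hi⟩

/-- The homogeneous operator of degree `k` with components taken from `h`. -/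
def homogOp {P Q : ℤ → Prop} {X Y : ℤ → ModuleCat.{0} R} (k : ℤ) (hk : ∀ i, P i → Q (i + k))
    (h : GHom X Y) : part P X →ₗ[R] part Q Y :=
  DirectSum.toModule R _ _ fun i : {i : ℤ // P i} => inPart Y (i + k) (hk i i.2) ∘ₗ h i (i + k)

variable {P Q : ℤ → Prop} {X Y : ℤ → ModuleCat.{0} R}

/-- The target degree is a variable `j` with a proof of `i + k = j`; this avoids transport between
components such as `X (i - 1 + 1)` and `X i`, and is the reason for the shape of `GHom`. -/
theorem homogOp_inPart {k : ℤ} (hk : ∀ i, P i → Q (i + k)) (h : GHom X Y) (i j : ℤ) (hi : P i)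
    (hj : Q j) (hij : i + k = j) (x : X i) :
    homogOp k hk h (inPart X i hi x) = inPart Y j hj (h i j x) := by
  subst hij
  simp [homogOp, inPart]

theorem part_hom_ext {N : Type*} [AddCommMonoid N] [Module R N] {f g : part P X →ₗ[R] N}
    (h : ∀ i (hi : P i) (x : X i), f (inPart X i hi x) = g (inPart X i hi x)) : f = g := by
  refine DirectSum.linearMap_ext R fun i => ?_
  ext x
  exact h i i.2 x

theorem part_induction {p : part P X → Prop} (x : part P X) (h0 : p 0)
    (h : ∀ i (hi : P i) (x : X i), p (inPart X i hi x)) (ha : ∀ x y, p x → p y → p (x + y)) :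
    p x :=
  DirectSum.induction_on x h0 (fun i x => h i i.2 x) ha

theorem evenMap_inPart (f : ∀ i, X i ⟶ Y i) (i : ℤ) (hi : Even i) (x : X i) :
    evenMap f (inPart X i hi x) = inPart Y i hi ((f i).hom x) := by
  simp [evenMap, inPart, DirectSum.lmap_lof]

theorem oddMap_inPart (f : ∀ i, X i ⟶ Y i) (i : ℤ) (hi : Odd i) (x : X i) :
    oddMap f (inPart X i hi x) = inPart Y i hi ((f i).hom x) := by
  simp [oddMap, inPart, DirectSum.lmap_lof]

theorem odd_add_one (i : ℤ) (h : Odd i) : Even (i + 1) := h.add_odd odd_one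
theorem even_add_one' (i : ℤ) (h : Even i) : Odd (i + 1) := h.add_odd odd_one
theorem odd_add_neg_one (i : ℤ) (h : Odd i) : Even (i + -1) := h.add_odd (by decide)
theorem even_add_neg_one (i : ℤ) (h : Even i) : Odd (i + -1) := h.add_odd (by decide)

/-- The operator `δ + σ` from the odd to the even part. -/
def oddOp (δ σ : GHom X Y) : oddPart X →ₗ[R] evenPart Y :=
  homogOp 1 odd_add_one δ + homogOp (-1) odd_add_neg_one σ

/-- The operator `δ + σ` from the even to the odd part. -/
def evenOp (δ σ : GHom X Y) : evenPart X →ₗ[R] oddPart Y :=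
  homogOp 1 even_add_one' δ + homogOp (-1) even_add_neg_one σ

theorem oddOp_inPart (δ σ : GHom X Y) (i j k : ℤ) (hij : i + 1 = j) (hjk : j + 1 = k) (hj : Odd j)
    (hi : Even i) (hk : Even k) (x : X j) :
    oddOp δ σ (inPart X j hj x) = inPart Y k hk (δ j k x) + inPart Y i hi (σ j i x) := by
  rw [oddOp, LinearMap.add_apply, homogOp_inPart _ _ _ _ _ hk hjk,
    homogOp_inPart _ _ _ _ _ hi (by omega)]

theorem evenOp_inPart (δ σ : GHom X Y) (i j k : ℤ) (hij : i + 1 = j) (hjk : j + 1 = k)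
    (hj : Even j) (hi : Odd i) (hk : Odd k) (x : X j) :
    evenOp δ σ (inPart X j hj x) = inPart Y k hk (δ j k x) + inPart Y i hi (σ j i x) := by
  rw [evenOp, LinearMap.add_apply, homogOp_inPart _ _ _ _ _ hk hjk,
    homogOp_inPart _ _ _ _ _ hi (by omega)]

/-- `σ` is a contraction of the graded module `X` with differential `δ`. -/
structure IsContraction (δ σ : GHom X X) : Prop where
  sq : ∀ i j k : ℤ, i + 1 = j → j + 1 = k → ∀ x, δ j k (δ i j x) = 0
  htpy : ∀ i j k : ℤ, i + 1 = j → j + 1 = k → ∀ x, δ i j (σ j i x) + σ k j (δ j k x) = x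

/-- Bounded graded modules with finite free components. -/
structure IsFiniteFree (X : ℤ → ModuleCat.{0} R) : Prop where
  finite : ∀ i, Module.Finite R (X i)
  free : ∀ i, Module.Free R (X i)
  bounded : ∃ m n : ℤ, ∀ i, i < m ∨ n < i → Subsingleton (X i)

theorem IsFiniteFree.finite_index [Nontrivial R] (hX : IsFiniteFree X) {η : ℤ → Type*}
    [∀ i, Finite (η i)] (b : ∀ i, Module.Basis (η i) R (X i)) (P : ℤ → Prop) :
    Finite (Σ i : {i : ℤ // P i}, η i) := by
  obtain ⟨m, n, h⟩ := hX.bounded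
  have hmem : ∀ x : Σ i : {i : ℤ // P i}, η i, (x.1 : ℤ) ∈ Set.Icc m n := by
    rintro ⟨i, y⟩
    by_contra hcon
    have := h i (by simp only [Set.mem_Icc] at hcon; omega)
    exact (b i).ne_zero y (Subsingleton.elim _ _)
  refine Finite.of_injective (β := Σ i : Set.Icc m n, η i)
    (fun x => ⟨⟨x.1, hmem x⟩, x.2⟩) ?_
  rintro ⟨⟨i, hi⟩, x⟩ ⟨⟨j, hj⟩, y⟩ h
  simp only [Sigma.mk.injEq, Subtype.mk.injEq] at h
  obtain ⟨rfl, h⟩ := h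
  simpa using h

theorem IsFiniteFree.finite_part (hX : IsFiniteFree X) (P : ℤ → Prop) :
    Module.Finite R (part P X) := by
  nontriviality R
  have := hX.finite
  have := hX.free
  have := hX.finite_index (fun i => Module.Free.chooseBasis R (X i)) P
  exact Module.Finite.of_basis
    (DFinsupp.basis fun i : {i : ℤ // P i} => Module.Free.chooseBasis R (X i))

/-- An endomorphism which is the sum of a square-zero operator of degree `0` and an operator of
degree `e ≠ 0` is nilpotent. -/
theorem isNilpotent_of_homogeneous (hX : IsFiniteFree X) (N : Module.End R (part P X))
    (n : ∀ i, X i →ₗ[R] X i) (e : ℤ) (he : e ≠ 0)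
    (n' : ∀ i, X i →ₗ[R] X (i + e)) (hP : ∀ i, P i → P (i + e))
    (hN : ∀ i (hi : P i) x, N (inPart X i hi x) =
      inPart X i hi (n i x) + inPart X (i + e) (hP i hi) (n' i x))
    (hn : ∀ i (_ : P i) x, n i (n i x) = 0) : IsNilpotent N := by
  obtain ⟨a, b, hab⟩ := hX.bounded
  -- The sum of the components of degree `i + e * l` with `l ≥ k`: what can be reached from degree
  -- `i` by at least `k` steps of length `e`.
  set S : ℤ → ℕ → Submodule R (part P X) := fun i k =>
    ⨆ l : ℕ, ⨆ (_ : k ≤ l), ⨆ hi : P (i + e * l), LinearMap.range (inPart X (i + e * l) hi)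
  have hS : ∀ i k (l : ℕ) j (hj : P j) (x : X j), k ≤ l → j = i + e * l →
      inPart X j hj x ∈ S i k := by
    intro i k l j hj x hl hjl
    subst hjl
    exact Submodule.mem_iSup_of_mem l <| Submodule.mem_iSup_of_mem hl <|
      Submodule.mem_iSup_of_mem hj ⟨x, rfl⟩
  -- In `(n + n')²` the term `n²` vanishes and every other term contains a step of length `e`.
  have hN2 : ∀ i k, ∀ y ∈ S i k, N (N y) ∈ S i (k + 1) := by
    intro i k y hy
    suffices S i k ≤ (S i (k + 1)).comap (N * N) from this hy
    refine iSup_le fun m => iSup_le fun hm => iSup_le fun hi => ?_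
    rintro _ ⟨x, rfl⟩
    simp only [Submodule.mem_comap, Module.End.mul_apply]
    rw [hN, map_add, hN, hN, hn _ hi, map_zero, zero_add]
    refine add_mem ?_ (add_mem ?_ ?_)
    · exact hS i _ (m + 1) _ _ _ (by omega) (by push_cast; ring)
    · exact hS i _ (m + 1) _ _ _ (by omega) (by push_cast; ring)
    · exact hS i _ (m + 2) _ _ _ (by omega) (by push_cast; ring)
  have hpow : ∀ k i (hi : P i) x, (N ^ (2 * k)) (inPart X i hi x) ∈ S i k := by
    intro k
    induction k with
    | zero => intro i hi x; simpa using hS i 0 0 i hi x le_rfl (by simp)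
    | succ k ih =>
      intro i hi x
      rw [show 2 * (k + 1) = 2 + 2 * k by ring, pow_add, Module.End.mul_apply, pow_two,
        Module.End.mul_apply]
      exact hN2 _ _ _ (ih i hi x)
  -- More steps than `b - a`, each of length at least `1` in the same direction, leave the interval
  -- `[a, b]` where `X` lives.
  set K : ℕ := (b - a).toNat + 1
  refine ⟨2 * K, part_hom_ext fun i hi x => ?_⟩
  rw [LinearMap.zero_apply]
  by_cases hi' : i < a ∨ b < i
  · have := hab i hi'
    rw [Subsingleton.elim x 0, map_zero, map_zero]
  have hbot : S i K = ⊥ := by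
    refine iSup_eq_bot.2 fun m => iSup_eq_bot.2 fun hm => iSup_eq_bot.2 fun hi => ?_
    have := hab (i + e * m) (by
      have hm' : ((b - a).toNat : ℤ) + 1 ≤ m := by exact_mod_cast hm
      have hba : b - a ≤ ((b - a).toNat : ℤ) := Int.self_le_toNat _
      rw [not_or, not_lt, not_lt] at hi'
      rcases lt_or_gt_of_ne he with he | he
      · left; nlinarith
      · right; nlinarith)
    refine (LinearMap.range_eq_bot).2 (LinearMap.ext fun x => ?_)
    rw [Subsingleton.elim x 0, map_zero, map_zero]
  have := hpow K i hi x
  rwa [hbot, Submodule.mem_bot] at this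

end GradedOperators

/-- The characteristic polynomial of `-N` is a power of `X`, and its value at `1` is `det (1 + N)`.
-/
theorem det_one_add_nilpotent {K M : Type*} [Field K] [AddCommGroup M] [Module K M]
    [Module.Finite K M] {N : Module.End K M} (hN : IsNilpotent N) : LinearMap.det (1 + N) = 1 := by
  have h := LinearMap.det_eq_sign_charpoly_coeff (1 + N)
  have h1 : (-N).charpoly = Polynomial.X ^ Module.finrank K M :=
    IsNilpotent.charpoly_eq_X_pow_finrank hN.neg
  have h2 : (-N).charpoly.eval 1 = LinearMap.det (1 + N) := by
    rw [LinearMap.eval_charpoly]; simp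
  rw [← h2, h1]; simp

/-! ### Trivializations as a torsor under the units, and contractions. -/

section Trivializations

variable {R : Type} [CommRing R] {X : ℤ → ModuleCat.{0} R}

theorem Triv.mk_eq_mk {u v : Rˣ} {φ ψ : oddPart X ≃ₗ[R] evenPart X} :
    Triv.mk u φ = Triv.mk v ψ ↔ v = u * LinearEquiv.det (φ.trans ψ.symm) :=
  Quotient.eq (r := PreTriv.setoid X)

theorem Triv.smul_mk (v u : Rˣ) (φ : oddPart X ≃ₗ[R] evenPart X) :
    v • Triv.mk u φ = Triv.mk (v * u) φ := rfl

theorem Triv.exists_mk (a : Triv X) : ∃ u φ, a = Triv.mk u φ := by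
  induction a using Quotient.inductionOn with
  | h a => exact ⟨a.unit, a.iso, rfl⟩

theorem Triv.mk_eq_smul (u : Rˣ) (φ ψ : oddPart X ≃ₗ[R] evenPart X) :
    Triv.mk u φ = (u * LinearEquiv.det (φ.trans ψ.symm)) • Triv.mk 1 ψ := by
  rw [Triv.smul_mk, mul_one, Triv.mk_eq_mk]

theorem Triv.smul_mk_one_inj {u v : Rˣ} {ψ : oddPart X ≃ₗ[R] evenPart X}
    (h : u • Triv.mk 1 ψ = v • Triv.mk 1 ψ) : u = v := by
  rw [Triv.smul_mk, Triv.smul_mk, Triv.mk_eq_mk] at h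
  have : ψ.trans ψ.symm = 1 := by ext1 x; simp
  rw [this, map_one] at h
  simpa using h.symm

theorem Triv.exists_eq_smul (a b : Triv X) : ∃ u : Rˣ, a = u • b := by
  obtain ⟨u, φ, rfl⟩ := a.exists_mk
  obtain ⟨v, ψ, rfl⟩ := b.exists_mk
  refine ⟨u * LinearEquiv.det (φ.trans ψ.symm) * v⁻¹, ?_⟩
  rw [Triv.mk_eq_smul u φ ψ, Triv.smul_mk, Triv.smul_mk, mul_one, inv_mul_cancel_right]

theorem Triv.mul_smul (u v : Rˣ) (a : Triv X) : (u * v) • a = u • v • a := by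
  obtain ⟨w, φ, rfl⟩ := a.exists_mk
  simp only [Triv.smul_mk, mul_assoc]

theorem Triv.one_smul (a : Triv X) : (1 : Rˣ) • a = a := by
  obtain ⟨w, φ, rfl⟩ := a.exists_mk
  simp only [Triv.smul_mk, one_mul]

/-- The trivialization `a` is `F` times the canonical one of the contractible differential `δ`. -/
def IsVal (δ : GHom X X) (a : Triv X) (F : Rˣ) : Prop :=
  ∃ (σ : GHom X X) (ψ : oddPart X ≃ₗ[R] evenPart X), IsContraction δ σ ∧
    (ψ : oddPart X →ₗ[R] evenPart X) = oddOp δ σ ∧ a = F • Triv.mk 1 ψ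

theorem IsVal.smul {δ : GHom X X} {a : Triv X} {F : Rˣ} (h : IsVal δ a F) (u : Rˣ) :
    IsVal δ (u • a) (u * F) := by
  obtain ⟨σ, ψ, h1, h2, rfl⟩ := h
  exact ⟨σ, ψ, h1, h2, (Triv.mul_smul _ _ _).symm⟩

/-- The expansion of `(δ' + σ')(δ + σ)` into its parts of degree `2`, `0` and `-2`, from which the
nilpotence statements are read off. -/
theorem evenOp_oddOp_inPart (δ σ δ' σ' : GHom X X) (h i j k l : ℤ) (hhi : h + 1 = i)
    (hij : i + 1 = j) (hjk : j + 1 = k) (hkl : k + 1 = l) (hh : Odd h) (hj : Odd j) (hl : Odd l)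
    (x : X j) :
    evenOp δ' σ' (oddOp δ σ (inPart X j hj x)) = inPart X l hl (δ' k l (δ j k x)) +
      inPart X j hj (σ' k j (δ j k x) + δ' i j (σ j i x)) + inPart X h hh (σ' i h (σ j i x)) := by
  have hi : Even i := hhi ▸ odd_add_one _ hh
  have hk : Even k := hjk ▸ odd_add_one _ hj
  rw [oddOp_inPart δ σ i j k hij hjk hj hi hk, map_add,
    evenOp_inPart δ' σ' j k l hjk hkl hk hj hl, evenOp_inPart δ' σ' h i j hhi hij hi hh hj, map_add]
  abel

theorem oddOp_evenOp_inPart (δ σ δ' σ' : GHom X X) (h i j k l : ℤ) (hhi : h + 1 = i)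
    (hij : i + 1 = j) (hjk : j + 1 = k) (hkl : k + 1 = l) (hh : Even h) (hj : Even j) (hl : Even l)
    (x : X j) :
    oddOp δ' σ' (evenOp δ σ (inPart X j hj x)) = inPart X l hl (δ' k l (δ j k x)) +
      inPart X j hj (σ' k j (δ j k x) + δ' i j (σ j i x)) + inPart X h hh (σ' i h (σ j i x)) := by
  have hi : Odd i := hhi ▸ even_add_one' _ hh
  have hk : Odd k := hjk ▸ even_add_one' _ hj
  rw [evenOp_inPart δ σ i j k hij hjk hj hi hk, map_add,
    oddOp_inPart δ' σ' j k l hjk hkl hk hj hl, oddOp_inPart δ' σ' h i j hhi hij hi hh hj, map_add]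
  abel

/-- The operator is `τδ + δσ - 1 = (τ - σ)δ`, and its square contains `δ(τ - σ)δ = δ - δ = 0`. -/
theorem IsContraction.sq_sub_eq_zero {δ σ τ : GHom X X} (hσ : IsContraction δ σ)
    (hτ : IsContraction δ τ) (i j k : ℤ) (hij : i + 1 = j) (hjk : j + 1 = k) (x : X j) :
    τ k j (δ j k (τ k j (δ j k x) + δ i j (σ j i x) - x)) +
      δ i j (σ j i (τ k j (δ j k x) + δ i j (σ j i x) - x)) -
      (τ k j (δ j k x) + δ i j (σ j i x) - x) = 0 := by
  have e1 : ∀ y : X j, δ i j (σ j i y) = y - σ k j (δ j k y) := fun y =>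
    eq_sub_of_add_eq (hσ.htpy i j k hij hjk y)
  have e2 : ∀ y : X k, δ j k (τ k j y) = y - τ (k + 1) k (δ k (k + 1) y) := fun y =>
    eq_sub_of_add_eq (hτ.htpy j k (k + 1) hjk rfl y)
  have e3 : ∀ y : X k, δ j k (σ k j y) = y - σ (k + 1) k (δ k (k + 1) y) := fun y =>
    eq_sub_of_add_eq (hσ.htpy j k (k + 1) hjk rfl y)
  have e4 : ∀ y : X j, δ k (k + 1) (δ j k y) = 0 := hσ.sq j k (k + 1) hjk rfl
  simp only [e1, map_add, map_sub, e2, e3, e4, map_zero, sub_zero]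
  abel

/-- In `(δ + τ)(δ + σ) - 1` the part `δδ` of degree `2` vanishes, the part of degree `0` has square
zero, and `τσ` has degree `-2`. Two different contractions are allowed because this is what shows
that the class of `δ + σ` does not depend on `σ`. -/
theorem IsContraction.isNilpotent_odd {δ σ τ : GHom X X} (hX : IsFiniteFree X)
    (hσ : IsContraction δ σ) (hτ : IsContraction δ τ) :
    IsNilpotent (evenOp δ τ ∘ₗ oddOp δ σ - 1 : Module.End R (oddPart X)) := by
  refine isNilpotent_of_homogeneous (P := Odd) hX _
    (fun j => τ (j + 1) j ∘ₗ δ j (j + 1) + δ (j - 1) j ∘ₗ σ j (j - 1) - LinearMap.id) (-2)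
    (by decide) (fun j => τ (j - 1) (j + -2) ∘ₗ σ j (j - 1)) (fun i hi => hi.add_even (by decide))
    (fun j hj x => ?_) (fun j hj x => ?_)
  · rw [LinearMap.sub_apply, LinearMap.comp_apply,
      evenOp_oddOp_inPart δ σ δ τ (j + -2) (j - 1) j (j + 1) (j + 2) (by ring) (by ring) rfl
        (by ring) (hj.add_even (by decide)) hj (hj.add_even (by decide)),
      hσ.sq j (j + 1) (j + 2) rfl (by ring)]
    simp only [Module.End.one_apply, map_zero, zero_add, LinearMap.sub_apply, LinearMap.add_apply,
      LinearMap.comp_apply, LinearMap.id_apply, map_sub]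
    abel
  · exact hσ.sq_sub_eq_zero hτ (j - 1) j (j + 1) (by ring) rfl x

theorem IsContraction.isNilpotent_even {δ σ τ : GHom X X} (hX : IsFiniteFree X)
    (hσ : IsContraction δ σ) (hτ : IsContraction δ τ) :
    IsNilpotent (oddOp δ τ ∘ₗ evenOp δ σ - 1 : Module.End R (evenPart X)) := by
  refine isNilpotent_of_homogeneous (P := Even) hX _
    (fun j => τ (j + 1) j ∘ₗ δ j (j + 1) + δ (j - 1) j ∘ₗ σ j (j - 1) - LinearMap.id) (-2)
    (by decide) (fun j => τ (j - 1) (j + -2) ∘ₗ σ j (j - 1)) (fun i hi => hi.add (by decide))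
    (fun j hj x => ?_) (fun j hj x => ?_)
  · rw [LinearMap.sub_apply, LinearMap.comp_apply,
      oddOp_evenOp_inPart δ σ δ τ (j + -2) (j - 1) j (j + 1) (j + 2) (by ring) (by ring) rfl
        (by ring) (hj.add (by decide)) hj (hj.add (by decide)),
      hσ.sq j (j + 1) (j + 2) rfl (by ring)]
    simp only [Module.End.one_apply, map_zero, zero_add, LinearMap.sub_apply, LinearMap.add_apply,
      LinearMap.comp_apply, LinearMap.id_apply, map_sub]
    abel
  · exact hσ.sq_sub_eq_zero hτ (j - 1) j (j + 1) (by ring) rfl x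

/-- For a contraction `σ` of `δ` the operator `δ + σ` is invertible. -/
theorem IsContraction.exists_equiv {δ σ : GHom X X} (hX : IsFiniteFree X)
    (hσ : IsContraction δ σ) :
    ∃ ψ : oddPart X ≃ₗ[R] evenPart X, (ψ : oddPart X →ₗ[R] evenPart X) = oddOp δ σ := by
  have h1 := (hσ.isNilpotent_odd hX hσ).isUnit_add_one
  have h2 := (hσ.isNilpotent_even hX hσ).isUnit_add_one
  rw [sub_add_cancel, Module.End.isUnit_iff] at h1 h2
  refine ⟨LinearEquiv.ofBijective (oddOp δ σ) ⟨?_, ?_⟩, rfl⟩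
  · exact Function.Injective.of_comp (f := evenOp δ σ) h1.1
  · exact Function.Surjective.of_comp (g := evenOp δ σ) h2.2

theorem IsContraction.exists_isVal {δ σ : GHom X X} (hX : IsFiniteFree X)
    (hσ : IsContraction δ σ) (a : Triv X) : ∃ F, IsVal δ a F := by
  obtain ⟨ψ, hψ⟩ := hσ.exists_equiv hX
  obtain ⟨F, hF⟩ := a.exists_eq_smul (Triv.mk 1 ψ)
  exact ⟨F, σ, ψ, hσ, hψ, hF⟩

end Trivializations

/-! ### Canonical trivializations over a field: uniqueness and perturbation. -/

section Field

variable {K : Type} [Field K] {X : ℤ → ModuleCat.{0} K}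

theorem IsContraction.det_evenOp_oddOp {δ σ τ : GHom X X} (hX : IsFiniteFree X)
    (hσ : IsContraction δ σ) (hτ : IsContraction δ τ) :
    LinearMap.det (evenOp δ τ ∘ₗ oddOp δ σ) = 1 := by
  have := hX.finite_part Odd
  have h := det_one_add_nilpotent (hσ.isNilpotent_odd hX hτ)
  rwa [add_sub_cancel] at h

/-- Maps from the odd to the even part have no determinant of their own; they are compared after
composition with one common map back. -/
theorem mk_one_eq_of_det {ψ ψ' : oddPart X ≃ₗ[K] evenPart X} (χ : evenPart X →ₗ[K] oddPart X)
    (h : LinearMap.det (χ ∘ₗ (ψ : oddPart X →ₗ[K] evenPart X)) = 1)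
    (h' : LinearMap.det (χ ∘ₗ (ψ' : oddPart X →ₗ[K] evenPart X)) = 1) :
    Triv.mk 1 ψ = Triv.mk 1 ψ' := by
  rw [Triv.mk_eq_mk, one_mul, eq_comm, Units.ext_iff, LinearEquiv.coe_det, Units.val_one]
  have : χ ∘ₗ (ψ : oddPart X →ₗ[K] evenPart X) = (χ ∘ₗ (ψ' : oddPart X →ₗ[K] evenPart X)) ∘ₗ
      (ψ.trans ψ'.symm : oddPart X →ₗ[K] oddPart X) := by
    refine LinearMap.ext fun x => ?_
    simp
  rw [this, LinearMap.det_comp, h', one_mul] at h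
  exact h

theorem IsVal.unique (hX : IsFiniteFree X) {δ : GHom X X} {a : Triv X} {F F' : Kˣ}
    (h : IsVal δ a F) (h' : IsVal δ a F') : F = F' := by
  obtain ⟨σ, ψ, hσ, hψ, rfl⟩ := h
  obtain ⟨τ, ψ', hτ, hψ', h⟩ := h'
  have : Triv.mk 1 ψ = Triv.mk 1 ψ' := by
    refine mk_one_eq_of_det (evenOp δ σ) ?_ ?_
    · rw [hψ]; exact hσ.det_evenOp_oddOp hX hσ
    · rw [hψ']; exact hτ.det_evenOp_oddOp hX hσ
  rw [this] at h
  exact Triv.smul_mk_one_inj h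

theorem IsVal.of_contraction (hX : IsFiniteFree X) {δ σ : GHom X X} {a : Triv X} {F : Kˣ}
    (h : IsVal δ a F) (hσ : IsContraction δ σ) (ψ : oddPart X ≃ₗ[K] evenPart X)
    (hψ : (ψ : oddPart X →ₗ[K] evenPart X) = oddOp δ σ) : a = F • Triv.mk 1 ψ := by
  obtain ⟨G, hG⟩ := a.exists_eq_smul (Triv.mk 1 ψ)
  rwa [h.unique hX ⟨σ, ψ, hσ, hψ, hG⟩]

/-- Two differentials with a common contraction `τ` of square zero have the same canonical
trivialization. -/
theorem IsVal.perturb (hX : IsFiniteFree X) {δ δ' τ : GHom X X} (hτ : IsContraction δ τ)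
    (hτ' : IsContraction δ' τ) (hsq : ∀ i j k : ℤ, i + 1 = j → j + 1 = k → ∀ x, τ j i (τ k j x) = 0)
    {a : Triv X} {F : Kˣ} (h : IsVal δ a F) : IsVal δ' a F := by
  obtain ⟨ψ, hψ⟩ := hτ.exists_equiv hX
  obtain ⟨ψ', hψ'⟩ := hτ'.exists_equiv hX
  refine ⟨τ, ψ', hτ', hψ', ?_⟩
  rw [h.of_contraction hX hτ ψ hψ]
  congr 1
  have := hX.finite_part Odd
  refine mk_one_eq_of_det (evenOp δ τ) ?_ ?_
  · rw [hψ]; exact hτ.det_evenOp_oddOp hX hτ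
  rw [hψ']
  suffices hN : IsNilpotent (evenOp δ τ ∘ₗ oddOp δ' τ - 1 : Module.End K (oddPart X)) by
    have h := det_one_add_nilpotent hN
    rwa [add_sub_cancel] at h
  -- Now it is the part `ττ` of degree `-2` that vanishes, while the part `δδ'` of degree `2`
  -- remains.
  refine isNilpotent_of_homogeneous (P := Odd) hX _
    (fun j => τ (j + 1) j ∘ₗ δ' j (j + 1) + δ (j - 1) j ∘ₗ τ j (j - 1) - LinearMap.id) 2
    (by decide) (fun j => δ (j + 1) (j + 2) ∘ₗ δ' j (j + 1)) (fun i hi => hi.add_even (by decide))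
    (fun j hj x => ?_) (fun j hj x => ?_)
  · rw [LinearMap.sub_apply, LinearMap.comp_apply,
      evenOp_oddOp_inPart δ' τ δ τ (j + -2) (j - 1) j (j + 1) (j + 2) (by ring) (by ring) rfl
        (by ring) (hj.add_even (by decide)) hj (hj.add_even (by decide)),
      hsq (j + -2) (j - 1) j (by ring) (by ring)]
    simp only [Module.End.one_apply, map_zero, LinearMap.sub_apply, LinearMap.add_apply,
      LinearMap.comp_apply, LinearMap.id_apply, map_sub]
    abel
  -- The part of degree `0` is `τδ' + δτ - 1 = τ(δ' - δ)`. Since `(δ' - δ)τ = τ(δ - δ')`, its square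
  -- contains `ττ = 0`.
  · have e1 : ∀ y : X j, δ (j - 1) j (τ j (j - 1) y) = y - τ (j + 1) j (δ j (j + 1) y) := fun y =>
      eq_sub_of_add_eq (hτ.htpy (j - 1) j (j + 1) (by ring) rfl y)
    have e2 : ∀ y : X (j + 1), δ' j (j + 1) (τ (j + 1) j y) =
        y - τ (j + 1 + 1) (j + 1) (δ' (j + 1) (j + 1 + 1) y) := fun y =>
      eq_sub_of_add_eq (hτ'.htpy j (j + 1) (j + 1 + 1) rfl rfl y)
    have e3 : ∀ y : X (j + 1), δ j (j + 1) (τ (j + 1) j y) =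
        y - τ (j + 1 + 1) (j + 1) (δ (j + 1) (j + 1 + 1) y) := fun y =>
      eq_sub_of_add_eq (hτ.htpy j (j + 1) (j + 1 + 1) rfl rfl y)
    have e4 : ∀ y, τ (j + 1) j (τ (j + 1 + 1) (j + 1) y) = 0 := hsq _ _ _ rfl rfl
    simp only [LinearMap.sub_apply, LinearMap.add_apply,
      LinearMap.comp_apply, LinearMap.id_apply, e1, map_add, map_sub, e2, e3, e4]
    abel

end Field

/-! ### Shifts and inverse trivializations. -/

section Shift

variable {R : Type} [CommRing R] {X : ℤ → ModuleCat.{0} R}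

theorem evenShift_symm_inPart (i : ℤ) (hi : Odd i) (x : X (i + 1)) :
    (evenShift X).symm (inPart (shiftTerms X) i hi x) = inPart X (i + 1) (odd_add_one i hi) x :=
  DirectSum.lequivCongrLeft_symm_lof R (M := fun i : {i : ℤ // Even i} => X i) (h := evenEquivOdd)
    (k := ⟨i, hi⟩)

theorem oddShift_symm_inPart (i : ℤ) (hi : Even i) (x : X (i + 1)) :
    (oddShift X).symm (inPart (shiftTerms X) i hi x) = inPart X (i + 1) (even_add_one' i hi) x :=
  DirectSum.lequivCongrLeft_symm_lof R (M := fun i : {i : ℤ // Odd i} => X i) (h := oddEquivEven)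
    (k := ⟨i, hi⟩)

theorem IsFiniteFree.shift (hX : IsFiniteFree X) : IsFiniteFree (shiftTerms X) where
  finite i := hX.finite (i + 1)
  free i := hX.free (i + 1)
  bounded := by
    obtain ⟨m, n, h⟩ := hX.bounded
    exact ⟨m - 1, n - 1, fun i hi => h (i + 1) (by omega)⟩

/-- The family on the shifted graded module given by the negatives of the maps in `h`. -/
def shiftNeg (h : GHom X X) : GHom (shiftTerms X) (shiftTerms X) := fun i j => -h (i + 1) (j + 1)

theorem IsContraction.shift {δ σ : GHom X X} (h : IsContraction δ σ) :
    IsContraction (shiftNeg δ) (shiftNeg σ) where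
  sq i j k hij hjk x := by
    simpa [shiftNeg] using h.sq (i + 1) (j + 1) (k + 1) (by omega) (by omega) x
  htpy i j k hij hjk x := by
    simpa [shiftNeg] using h.htpy (i + 1) (j + 1) (k + 1) (by omega) (by omega) x

/-- The shifted complex has differential `-δ` and contraction `-σ`, so its operator is `-(δ + σ)` on
the even part. This is the sign that `Triv.inv` carries. -/
theorem oddOp_shiftNeg (δ σ : GHom X X) (x : oddPart (shiftTerms X)) :
    (oddShift X).symm (oddOp (shiftNeg δ) (shiftNeg σ) x) =
      -evenOp δ σ ((evenShift X).symm x) := by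
  suffices (oddShift X).symm.toLinearMap ∘ₗ oddOp (shiftNeg δ) (shiftNeg σ) =
      -(evenOp δ σ ∘ₗ (evenShift X).symm.toLinearMap) from LinearMap.congr_fun this x
  refine part_hom_ext fun i hi x => ?_
  have h1 : Even (i - 1) := hi.sub_odd odd_one
  simp only [LinearMap.comp_apply, LinearMap.neg_apply, LinearEquiv.coe_coe]
  rw [oddOp_inPart _ _ (i - 1) i (i + 1) (by ring) rfl hi h1 (odd_add_one i hi), map_add,
    evenShift_symm_inPart, oddShift_symm_inPart, oddShift_symm_inPart,
    evenOp_inPart δ σ (i - 1 + 1) (i + 1) (i + 1 + 1) (by ring) rfl (odd_add_one i hi)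
      (by simpa using hi) (hi.add_odd odd_one |>.add_odd odd_one)]
  simp only [shiftNeg, LinearMap.neg_apply, map_neg, neg_add]

end Shift

section Field

variable {K : Type} [Field K] {X : ℤ → ModuleCat.{0} K}

theorem IsContraction.det_oddOp_evenOp {δ σ τ : GHom X X} (hX : IsFiniteFree X)
    (hσ : IsContraction δ σ) (hτ : IsContraction δ τ) :
    LinearMap.det (oddOp δ τ ∘ₗ evenOp δ σ) = 1 := by
  have := hX.finite_part Even
  have h := det_one_add_nilpotent (hσ.isNilpotent_even hX hτ)
  rwa [add_sub_cancel] at h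

/-- The inverse is represented by `-(δ + σ)⁻¹`, the canonical isomorphism of the shift by `-(δ +
σ)`. They differ by the determinant of `(δ + σ)(δ + σ)` on the even part, which is `1`. -/
theorem IsVal.inv (hX : IsFiniteFree X) {δ : GHom X X} {a : Triv X} {F : Kˣ}
    (h : IsVal δ a F) : IsVal (shiftNeg δ) a.inv F⁻¹ := by
  obtain ⟨σ, ψ, hσ, hψ, rfl⟩ := h
  obtain ⟨ψ', hψ'⟩ := hσ.shift.exists_equiv hX.shift
  refine ⟨shiftNeg σ, ψ', hσ.shift, hψ', ?_⟩
  change Triv.mk (F * 1)⁻¹ (((((evenShift X).symm.trans ψ.symm).trans (LinearEquiv.neg K)).trans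
    (oddShift X))) = F⁻¹ • Triv.mk 1 ψ'
  rw [Triv.smul_mk, mul_one, mul_one, Triv.mk_eq_mk, left_eq_mul, ← inv_eq_one, ← map_inv,
    Units.ext_iff, LinearEquiv.coe_det, Units.val_one]
  rw [← LinearMap.det_conj _ (evenShift X).symm, ← hσ.det_oddOp_evenOp hX hσ]
  congr 1
  refine LinearMap.ext fun x => ?_
  have h1 : ∀ y, ψ' y = oddOp (shiftNeg δ) (shiftNeg σ) y := LinearMap.congr_fun hψ'
  have h2 : ∀ y, ψ y = oddOp δ σ y := LinearMap.congr_fun hψ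
  change (evenShift X).symm (((((((evenShift X).symm.trans ψ.symm).trans (LinearEquiv.neg K)).trans
    (oddShift X)).trans ψ'.symm).symm) ((evenShift X).symm.symm x)) = _
  simp [h1, h2, oddOp_shiftNeg]

theorem det_of_split {M' M M'' : Type} [AddCommGroup M'] [Module K M'] [AddCommGroup M] [Module K M]
    [AddCommGroup M''] [Module K M''] [Module.Finite K M]
    (f : M' →ₗ[K] M) (g : M →ₗ[K] M'') (hf : Function.Injective f) (hg : Function.Surjective g)
    (hfg : Function.Exact f g) (e' : M' →ₗ[K] M') (e : M →ₗ[K] M) (e'' : M'' →ₗ[K] M'')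
    (h1 : ∀ x, e (f x) = f (e' x)) (h2 : ∀ x, g (e x) = e'' (g x)) :
    LinearMap.det e = LinearMap.det e' * LinearMap.det e'' := by
  have he : LinearMap.range f ≤ (LinearMap.range f).comap e := by
    rintro _ ⟨x, rfl⟩
    exact ⟨e' x, (h1 x).symm⟩
  rw [LinearMap.det_eq_det_mul_det (LinearMap.range f) e he]
  congr 1
  · rw [← LinearMap.det_conj e' (LinearEquiv.ofInjective f hf)]
    congr 1
    refine LinearMap.ext fun y => ?_
    obtain ⟨x, rfl⟩ := (LinearEquiv.ofInjective f hf).surjective y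
    ext
    simp [h1]
  · have hk : LinearMap.range f = LinearMap.ker g := (LinearMap.exact_iff.1 hfg).symm
    rw [← LinearMap.det_conj _
      ((Submodule.quotEquivOfEq _ _ hk).trans (g.quotKerEquivOfSurjective hg))]
    congr 1
    refine LinearMap.ext fun y => ?_
    obtain ⟨x, rfl⟩ := hg y
    have : ((Submodule.quotEquivOfEq _ _ hk).trans (g.quotKerEquivOfSurjective hg)).symm (g x) =
        Submodule.Quotient.mk x := by
      rw [LinearEquiv.symm_apply_eq]
      rfl
    rw [LinearMap.comp_apply, LinearMap.comp_apply, LinearEquiv.coe_coe, LinearEquiv.coe_coe, this,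
      ← h2]
    rfl

end Field

/-! ### Split exact sequences and multiplicativity of values. -/

section Split

variable {R : Type} [CommRing R] {X' X X'' : ℤ → ModuleCat.{0} R}

/-- A degreewise split short exact sequence with maps `f`, `g`, retraction `r` and section `j`. -/
structure IsSplitExact (f : ∀ i, X' i ⟶ X i) (g : ∀ i, X i ⟶ X'' i) (r : ∀ i, X i ⟶ X' i)
    (j : ∀ i, X'' i ⟶ X i) : Prop where
  retr : ∀ i x, (r i).hom ((f i).hom x) = x
  sect : ∀ i x, (g i).hom ((j i).hom x) = x
  zero : ∀ i x, (g i).hom ((f i).hom x) = 0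
  decomp : ∀ i x, (f i).hom ((r i).hom x) + (j i).hom ((g i).hom x) = x

variable {f : ∀ i, X' i ⟶ X i} {g : ∀ i, X i ⟶ X'' i} {r : ∀ i, X i ⟶ X' i}
  {j : ∀ i, X'' i ⟶ X i}

theorem exists_isSplitExact (hinj : ∀ i, Function.Injective (f i).hom)
    (hsurj : ∀ i, Function.Surjective (g i).hom)
    (hex : ∀ i, Function.Exact (f i).hom (g i).hom) (hproj : ∀ i, Module.Projective R (X'' i)) :
    ∃ r j, IsSplitExact f g r j := by
  have hj : ∀ i, ∃ j : X'' i →ₗ[R] X i, (g i).hom ∘ₗ j = LinearMap.id := fun i =>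
    Module.projective_lifting_property _ _ (hsurj i)
  choose j hj using hj
  have hj' : ∀ i x, (g i).hom (j i x) = x := fun i x => LinearMap.congr_fun (hj i) x
  have hmem : ∀ i x, ∃ y, (f i).hom y = x - j i ((g i).hom x) := fun i x =>
    (hex i _).1 (by rw [map_sub, hj', sub_self])
  choose r hr using hmem
  let r' : ∀ i, X i →ₗ[R] X' i := fun i =>
    { toFun := r i
      map_add' := fun x y => hinj i (by simp only [map_add, hr]; abel)
      map_smul' := fun c x => hinj i (by
        simp only [map_smul, hr, RingHom.id_apply, smul_sub]) }
  refine ⟨fun i => ModuleCat.ofHom (r' i), fun i => ModuleCat.ofHom (j i), ?_, ?_, ?_, ?_⟩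
  · intro i x
    refine hinj i ((hr i _).trans ?_)
    rw [(hex i).apply_apply_eq_zero, map_zero, sub_zero]
  · exact hj'
  · exact fun i x => (hex i).apply_apply_eq_zero x
  · intro i x
    change (f i).hom (r i x) + j i ((g i).hom x) = x
    rw [hr, sub_add_cancel]

theorem IsSplitExact.oddMap_injective (h : IsSplitExact f g r j) :
    Function.Injective (oddMap f) :=
  (DirectSum.lmap_injective _).2 fun i => Function.LeftInverse.injective (h.retr i)

theorem IsSplitExact.oddMap_surjective (h : IsSplitExact f g r j) :
    Function.Surjective (oddMap g) :=
  (DirectSum.lmap_surjective _).2 fun i => Function.RightInverse.surjective (h.sect i)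

theorem IsSplitExact.oddMap_decomp (h : IsSplitExact f g r j) (x : oddPart X) :
    oddMap f (oddMap r x) + oddMap j (oddMap g x) = x := by
  ext i; exact h.decomp i _

theorem IsSplitExact.oddMap_zero (h : IsSplitExact f g r j) (x : oddPart X') :
    oddMap g (oddMap f x) = 0 := by
  ext i; exact h.zero i _

theorem IsSplitExact.oddMap_exact (h : IsSplitExact f g r j) :
    Function.Exact (oddMap f) (oddMap g) := by
  intro x
  refine ⟨fun hx => ⟨oddMap r x, ?_⟩, ?_⟩
  · simpa [hx] using h.oddMap_decomp x
  · rintro ⟨y, rfl⟩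
    exact h.oddMap_zero y

theorem oddOp_comm {Y : ℤ → ModuleCat.{0} R} (f : ∀ i, X i ⟶ Y i) (δ σ : GHom X X)
    (δ' σ' : GHom Y Y)
    (hδ : ∀ i j : ℤ, i + 1 = j → ∀ x, δ' i j ((f i).hom x) = (f j).hom (δ i j x))
    (hσ : ∀ i j : ℤ, i + 1 = j → ∀ x, σ' j i ((f j).hom x) = (f i).hom (σ j i x))
    (x : oddPart X) : oddOp δ' σ' (oddMap f x) = evenMap f (oddOp δ σ x) := by
  suffices oddOp δ' σ' ∘ₗ oddMap f = evenMap f ∘ₗ oddOp δ σ from LinearMap.congr_fun this x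
  refine part_hom_ext fun i hi x => ?_
  have h1 : Even (i - 1) := hi.sub_odd odd_one
  rw [LinearMap.comp_apply, LinearMap.comp_apply, oddMap_inPart,
    oddOp_inPart _ _ (i - 1) i (i + 1) (by ring) rfl hi h1 (odd_add_one i hi),
    oddOp_inPart _ _ (i - 1) i (i + 1) (by ring) rfl hi h1 (odd_add_one i hi), map_add,
    evenMap_inPart, evenMap_inPart, hδ _ _ rfl, hσ _ _ (by ring)]

/-- Contractions of the outer terms of a split exact sequence extend to the middle term. -/
theorem IsSplitExact.exists_contraction (h : IsSplitExact f g r j)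
    {δ' σ' : GHom X' X'} {δ : GHom X X} {δ'' σ'' : GHom X'' X''}
    (hf : ∀ i k : ℤ, i + 1 = k → ∀ x, δ i k ((f i).hom x) = (f k).hom (δ' i k x))
    (hg : ∀ i k : ℤ, i + 1 = k → ∀ x, δ'' i k ((g i).hom x) = (g k).hom (δ i k x))
    (hsq : ∀ i j k : ℤ, i + 1 = j → j + 1 = k → ∀ x, δ j k (δ i j x) = 0)
    (h' : IsContraction δ' σ') (h'' : IsContraction δ'' σ'') :
    ∃ σ : GHom X X, IsContraction δ σ ∧
      (∀ i k : ℤ, i + 1 = k → ∀ x, σ k i ((f k).hom x) = (f i).hom (σ' k i x)) ∧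
      (∀ i k : ℤ, i + 1 = k → ∀ x, σ'' k i ((g k).hom x) = (g i).hom (σ k i x)) := by
  -- The splitting need not respect the differentials, so `s` is a contraction only up to the defect
  -- `N = δs + sδ - 1`.
  set s : GHom X X := fun i k => (f k).hom ∘ₗ σ' i k ∘ₗ (r i).hom +
    (j k).hom ∘ₗ σ'' i k ∘ₗ (g i).hom with hs
  have sf : ∀ i k x, s i k ((f i).hom x) = (f k).hom (σ' i k x) := fun i k x => by
    simp [hs, h.retr, h.zero]
  have gs : ∀ i k x, (g k).hom (s i k x) = σ'' i k ((g i).hom x) := fun i k x => by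
    simp [hs, h.sect, h.zero]
  set N : ∀ i, X i →ₗ[R] X i := fun i =>
    δ (i - 1) i ∘ₗ s i (i - 1) + s (i + 1) i ∘ₗ δ i (i + 1) - LinearMap.id with hNdef
  have hN : ∀ a b c : ℤ, a + 1 = b → b + 1 = c → ∀ x,
      N b x = δ a b (s b a x) + s c b (δ b c x) - x := by
    intro a b c hab hbc x
    obtain rfl : a = b - 1 := by omega
    subst hbc
    simp [hNdef]
  have Nf : ∀ i x, N i ((f i).hom x) = 0 := by
    intro i x
    rw [hN (i - 1) i (i + 1) (by ring) rfl, sf, hf _ _ (by ring), hf _ _ rfl, sf, ← map_add,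
      h'.htpy _ _ _ (by ring) rfl, sub_self]
  have gN : ∀ i x, (g i).hom (N i x) = 0 := by
    intro i x
    rw [hN (i - 1) i (i + 1) (by ring) rfl, map_sub, map_add, gs, ← hg _ _ (by ring), gs,
      ← hg _ _ rfl, h''.htpy _ _ _ (by ring) rfl, sub_self]
  have NN : ∀ i x, N i (N i x) = 0 := by
    intro i x
    have := h.decomp i (N i x)
    rw [gN, map_zero, add_zero] at this
    rw [← this, Nf]
  have Nδ : ∀ a b : ℤ, a + 1 = b → ∀ x, N b (δ a b x) = δ a b (N a x) := by
    intro a b hab x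
    rw [hN a b (b + 1) hab rfl, hN (a - 1) a b (by ring) hab, hsq a b (b + 1) hab rfl, map_zero,
      add_zero, map_sub, map_add, hsq (a - 1) a b (by ring) hab, zero_add]
  -- `N` commutes with `δ` and has square zero, so `(1 - N)s` is a contraction: `(1 - N)(δs + sδ) =
  -- (1 - N)(1 + N) = 1`. It still induces `σ'` and `σ''` because `N` vanishes on the image of `f`
  -- and `g` vanishes on that of `N`.
  refine ⟨fun i k => s i k - N k ∘ₗ s i k, ⟨hsq, ?_⟩, ?_, ?_⟩
  · intro a b c hab hbc x
    have h1 : δ a b (s b a x) + s c b (δ b c x) = N b x + x := by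
      rw [hN a b c hab hbc, sub_add_cancel]
    simp only [LinearMap.sub_apply, LinearMap.comp_apply, map_sub]
    rw [← Nδ a b hab]
    calc _ = (δ a b (s b a x) + s c b (δ b c x)) - N b (δ a b (s b a x) + s c b (δ b c x)) := by
          rw [map_add]; abel
      _ = x := by rw [h1, map_add, NN]; abel
  · intro i k hik x
    simp [sf, Nf]
  · intro i k hik x
    simp [gs, gN]

end Split

/-- With compatible contractions both `φ` and `δ + σ` respect the exact sequence, so the determinant
comparing them on the middle term is the product of the outer ones. -/
theorem IsVal.product {K : Type} [Field K] {X' X X'' : ℤ → ModuleCat.{0} K}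
    {f : ∀ i, X' i ⟶ X i} {g : ∀ i, X i ⟶ X'' i} {r : ∀ i, X i ⟶ X' i}
    {j : ∀ i, X'' i ⟶ X i} (hX : IsFiniteFree X) (h : IsSplitExact f g r j)
    {δ' : GHom X' X'} {δ : GHom X X} {δ'' : GHom X'' X''}
    (hf : ∀ i k : ℤ, i + 1 = k → ∀ x, δ i k ((f i).hom x) = (f k).hom (δ' i k x))
    (hg : ∀ i k : ℤ, i + 1 = k → ∀ x, δ'' i k ((g i).hom x) = (g k).hom (δ i k x))
    (hsq : ∀ i j k : ℤ, i + 1 = j → j + 1 = k → ∀ x, δ j k (δ i j x) = 0)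
    {a' : Triv X'} {a : Triv X} {a'' : Triv X''} (ha : IsProduct f g a' a a'')
    {F' F'' : Kˣ} (h' : IsVal δ' a' F') (h'' : IsVal δ'' a'' F'') : IsVal δ a (F' * F'') := by
  obtain ⟨u', u'', φ', φ, φ'', rfl, rfl, rfl, hφ', hφ''⟩ := ha
  obtain ⟨σ', ψ', hσ', hψ', h'⟩ := h'
  obtain ⟨σ'', ψ'', hσ'', hψ'', h''⟩ := h''
  obtain ⟨σ, hσ, h1, h2⟩ := h.exists_contraction hf hg hsq hσ' hσ''
  obtain ⟨ψ, hψ⟩ := hσ.exists_equiv hX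
  refine ⟨σ, ψ, hσ, hψ, ?_⟩
  rw [Triv.mk_eq_smul u' φ' ψ'] at h'
  rw [Triv.mk_eq_smul u'' φ'' ψ''] at h''
  rw [Triv.mk_eq_smul _ φ ψ, ← Triv.smul_mk_one_inj h', ← Triv.smul_mk_one_inj h'',
    mul_mul_mul_comm]
  congr 2
  rw [Units.ext_iff, Units.val_mul, LinearEquiv.coe_det, LinearEquiv.coe_det, LinearEquiv.coe_det]
  have := hX.finite_part Odd
  have c' : ∀ x, ψ (oddMap f x) = evenMap f (ψ' x) := fun x => by
    rw [show ψ (oddMap f x) = oddOp δ σ (oddMap f x) from LinearMap.congr_fun hψ _,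
      show ψ' x = oddOp δ' σ' x from LinearMap.congr_fun hψ' _]
    exact oddOp_comm f _ _ _ _ hf h1 x
  have c'' : ∀ x, ψ'' (oddMap g x) = evenMap g (ψ x) := fun x => by
    rw [show ψ x = oddOp δ σ x from LinearMap.congr_fun hψ _,
      show ψ'' (oddMap g x) = oddOp δ'' σ'' (oddMap g x) from LinearMap.congr_fun hψ'' _]
    exact oddOp_comm g _ _ _ _ hg h2 x
  refine det_of_split (oddMap f) (oddMap g) h.oddMap_injective h.oddMap_surjective h.oddMap_exact
    _ _ _ (fun x => ?_) (fun x => ?_)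
  · change ψ.symm (φ (oddMap f x)) = oddMap f (ψ'.symm (φ' x))
    rw [LinearEquiv.symm_apply_eq, c', hφ', LinearEquiv.apply_symm_apply]
  · change oddMap g (ψ.symm (φ x)) = ψ''.symm (φ'' (oddMap g x))
    rw [LinearEquiv.eq_symm_apply, c'', LinearEquiv.apply_symm_apply, hφ'']

/-! ### Base change of finite free modules. -/

section BaseChangeMap

variable {R S : Type} [CommRing R] [CommRing S] (f : R →+* S)
  {M M' N N' : Type} [AddCommGroup M] [Module R M] [AddCommGroup M'] [Module R M']
  [AddCommGroup N] [Module S N] [AddCommGroup N'] [Module S N']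

/-- The additive map `l` exhibits `N` as the base change along `f` of the finite free module `M`. -/
structure IsFreeBaseChange (l : M →+ N) : Prop where
  smul : ∀ r x, l (r • x) = f r • l x
  exists_basis : ∃ (ι : Type) (_ : Finite ι) (b : Module.Basis ι R M) (b' : Module.Basis ι S N),
    ∀ i, b' i = l (b i)

variable {f} {l : M →+ N} {l' : M' →+ N'}

theorem IsFreeBaseChange.hom_ext (h : IsFreeBaseChange f l) {g₁ g₂ : N →ₗ[S] N'}
    (h' : ∀ x, g₁ (l x) = g₂ (l x)) : g₁ = g₂ := by
  obtain ⟨ι, _, b, b', hb⟩ := h.exists_basis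
  exact b'.ext fun i => by rw [hb, h']

theorem IsFreeBaseChange.exists_map (h : IsFreeBaseChange f l)
    (h' : ∀ r x, l' (r • x) = f r • l' x) (g : M →ₗ[R] M') :
    ∃ g' : N →ₗ[S] N', ∀ x, g' (l x) = l' (g x) := by
  obtain ⟨ι, _, b, b', hb⟩ := h.exists_basis
  refine ⟨b'.constr S fun i => l' (g (b i)), fun x => ?_⟩
  induction b.mem_span x using Submodule.span_induction with
  | mem x hx =>
    obtain ⟨i, rfl⟩ := hx
    rw [← hb, b'.constr_basis]
  | zero => simp
  | add x y _ _ hx hy => simp only [map_add, hx, hy]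
  | smul c x _ hx => rw [h.smul, map_smul, hx, map_smul, h']

theorem IsFreeBaseChange.exists_equiv (h : IsFreeBaseChange f l) (h' : IsFreeBaseChange f l')
    (φ : M ≃ₗ[R] M') : ∃ φ' : N ≃ₗ[S] N', ∀ x, φ' (l x) = l' (φ x) := by
  obtain ⟨g, hg⟩ := h.exists_map h'.smul (φ : M →ₗ[R] M')
  obtain ⟨k, hk⟩ := h'.exists_map h.smul (φ.symm : M' →ₗ[R] M)
  refine ⟨LinearEquiv.ofLinearMap g k (h'.hom_ext fun x => ?_) (h.hom_ext fun x => ?_), hg⟩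
  · simp [hk, hg]
  · simp [hk, hg]

theorem IsFreeBaseChange.det_eq (h : IsFreeBaseChange f l) (g : M →ₗ[R] M) (g' : N →ₗ[S] N)
    (hg : ∀ x, g' (l x) = l (g x)) : LinearMap.det g' = f (LinearMap.det g) := by
  classical
  obtain ⟨ι, _, b, b', hb⟩ := h.exists_basis
  have := Fintype.ofFinite ι
  rw [← LinearMap.det_toMatrix b, ← LinearMap.det_toMatrix b', RingHom.map_det]
  congr 1
  have hrepr : ∀ x i, b'.repr (l x) i = f (b.repr x i) := by
    intro x i
    conv_lhs => rw [← b.sum_repr x, map_sum]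
    simp only [h.smul, ← hb, map_sum, map_smul, Module.Basis.repr_self]
    simp [Finsupp.single_apply]
  ext i j
  rw [LinearMap.toMatrix_apply, hb, hg, hrepr, RingHom.mapMatrix_apply, Matrix.map_apply,
    LinearMap.toMatrix_apply]

end BaseChangeMap

/-! ### Base change of graded modules, trivializations and contractions. -/

section GradedBaseChange

variable {R S : Type} [CommRing R] [CommRing S] (f : R →+* S) (X : ℤ → ModuleCat.{0} R)

/-- The base change of a graded module. -/
abbrev bcTerms : ℤ → ModuleCat.{0} S := fun i => (ModuleCat.extendScalars f).obj (X i)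

/-- The map `x ↦ 1 ⊗ x`. -/
def toBC (i : ℤ) : X i →+ bcTerms f X i where
  toFun x := ((1 : S) ⊗ₜ[R,f] x : (ModuleCat.extendScalars f).obj (X i))
  map_zero' := TensorProduct.tmul_zero _ _
  map_add' x y := TensorProduct.tmul_add _ x y

variable {X} in
/-- The base change of a family of maps. -/
def bcHom {Y : ℤ → ModuleCat.{0} R} (h : GHom X Y) : GHom (bcTerms f X) (bcTerms f Y) := fun i j =>
  ((ModuleCat.extendScalars f).map (ModuleCat.ofHom (h i j))).hom

theorem bcHom_toBC {Y : ℤ → ModuleCat.{0} R} (h : GHom X Y) (i j : ℤ) (x : X i) :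
    bcHom f h i j (toBC f X i x) = toBC f Y j (h i j x) :=
  ModuleCat.ExtendScalars.map_tmul _ _ _ _

theorem toBC_smul (i : ℤ) (r : R) (x : X i) : toBC f X i (r • x) = f r • toBC f X i x := by
  let _ := f.toAlgebra
  change (1 : S) ⊗ₜ[R] (r • x) = f r • ((1 : S) ⊗ₜ[R] x)
  rw [TensorProduct.tmul_smul, TensorProduct.smul_tmul', TensorProduct.smul_tmul', Algebra.smul_def]
  rfl

theorem exists_basis_toBC (i : ℤ) {ι : Type} (b : Module.Basis ι R (X i)) :
    ∃ b' : Module.Basis ι S (bcTerms f X i), ∀ k, b' k = toBC f X i (b k) := by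
  let _ := f.toAlgebra
  exact ⟨Algebra.TensorProduct.basis S b, fun k => Algebra.TensorProduct.basis_apply _ _⟩

variable {X}

theorem bcHom_ext {i : ℤ} {N : Type} [AddCommGroup N] [Module S N] {g₁ g₂ : bcTerms f X i →ₗ[S] N}
    (h : ∀ x, g₁ (toBC f X i x) = g₂ (toBC f X i x)) : g₁ = g₂ := by
  have : ModuleCat.ofHom g₁ = ModuleCat.ofHom g₂ := ModuleCat.ExtendScalars.hom_ext h
  exact congrArg ModuleCat.Hom.hom this

theorem IsFiniteFree.baseChange (hX : IsFiniteFree X) : IsFiniteFree (bcTerms f X) where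
  finite i := by
    have := hX.finite i
    have := hX.free i
    obtain ⟨b', -⟩ := exists_basis_toBC f X i (Module.Free.chooseBasis R (X i))
    exact Module.Finite.of_basis b'
  free i := by
    have := hX.free i
    obtain ⟨b', -⟩ := exists_basis_toBC f X i (Module.Free.chooseBasis R (X i))
    exact Module.Free.of_basis b'
  bounded := by
    obtain ⟨m, n, h⟩ := hX.bounded
    refine ⟨m, n, fun i hi => ?_⟩
    have := h i hi
    have h0 : (LinearMap.id : bcTerms f X i →ₗ[S] bcTerms f X i) = 0 := bcHom_ext f fun x => by
      rw [Subsingleton.elim x 0, map_zero, map_zero, map_zero]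
    exact ⟨fun x y => (LinearMap.congr_fun h0 x).trans (LinearMap.congr_fun h0 y).symm⟩

/-- The map `x ↦ 1 ⊗ x` on the sum of the components whose degree satisfies `P`. -/
def partToBC (P : ℤ → Prop) : part P X →+ part P (bcTerms f X) :=
  DirectSum.map fun i : {i : ℤ // P i} => toBC f X i

theorem partToBC_inPart (P : ℤ → Prop) (i : ℤ) (hi : P i) (x : X i) :
    partToBC f P (inPart X i hi x) = inPart (bcTerms f X) i hi (toBC f X i x) :=
  DirectSum.map_of _ _ _

theorem partBasis_apply {R : Type} [CommRing R] {X : ℤ → ModuleCat.{0} R} {P : ℤ → Prop}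
    {η : {i : ℤ // P i} → Type} (b : ∀ i : {i : ℤ // P i}, Module.Basis (η i) R (X i))
    (i : {i : ℤ // P i}) (k : η i) :
    (DFinsupp.basis b : Module.Basis (Σ i, η i) R (part P X)) ⟨i, k⟩ = inPart X i i.2 (b i k) := by
  classical
  change ((sigmaFinsuppLequivDFinsupp R).symm.symm.trans
    (DFinsupp.mapRange.linearEquiv fun i => (b i).repr).symm) (Finsupp.single ⟨i, k⟩ 1) = _
  rw [LinearEquiv.trans_apply, LinearEquiv.symm_apply_eq]
  change sigmaFinsuppEquivDFinsupp (Finsupp.single ⟨i, k⟩ 1) =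
    DFinsupp.mapRange (fun i => (b i).repr) (fun i => map_zero _)
      (DFinsupp.single (β := fun i : {i : ℤ // P i} => X i) i (b i k))
  rw [sigmaFinsuppEquivDFinsupp_single, DFinsupp.mapRange_single]
  simp

theorem IsFiniteFree.isFreeBaseChange (hX : IsFiniteFree X) (P : ℤ → Prop) [Nontrivial R] :
    IsFreeBaseChange f (partToBC f P : part P X →+ part P (bcTerms f X)) where
  smul r x := by
    induction x using part_induction with
    | h0 => simp
    | h i hi x => rw [← map_smul, partToBC_inPart, toBC_smul, map_smul, partToBC_inPart]
    | ha x y hx hy => simp only [smul_add, map_add, hx, hy]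
  exists_basis := by
    have := hX.finite
    have := hX.free
    have hfin := hX.finite_index (fun i => Module.Free.chooseBasis R (X i)) P
    choose b' hb' using fun i => exists_basis_toBC f X i (Module.Free.chooseBasis R (X i))
    refine ⟨_, hfin, DFinsupp.basis fun i : {i : ℤ // P i} => Module.Free.chooseBasis R (X i),
      DFinsupp.basis fun i : {i : ℤ // P i} => b' i, ?_⟩
    rintro ⟨i, k⟩
    rw [partBasis_apply, partBasis_apply, partToBC_inPart, hb']

variable {f}

/-- `a'` is the trivialization of the base change induced by `a`. -/
def IsBCTriv (f : R →+* S) (a : Triv X) (a' : Triv (bcTerms f X)) : Prop :=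
  ∃ (u : Rˣ) (φ : oddPart X ≃ₗ[R] evenPart X)
    (φ' : oddPart (bcTerms f X) ≃ₗ[S] evenPart (bcTerms f X)),
    a = Triv.mk u φ ∧ a' = Triv.mk (Units.map (f : R →* S) u) φ' ∧
    ∀ x : oddPart X, φ' (partToBC f Odd x) = partToBC f Even (φ x)

/-- `IsBCTriv` speaks of one representative; any other serves as well because determinants commute
with base change. -/
theorem IsBCTriv.eq_mk [Nontrivial R] (hX : IsFiniteFree X) {a : Triv X} {a' : Triv (bcTerms f X)}
    (h : IsBCTriv f a a') {u : Rˣ} {φ : oddPart X ≃ₗ[R] evenPart X}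
    {φ' : oddPart (bcTerms f X) ≃ₗ[S] evenPart (bcTerms f X)} (ha : a = Triv.mk u φ)
    (hφ : ∀ x : oddPart X, φ' (partToBC f Odd x) = partToBC f Even (φ x)) :
    a' = Triv.mk (Units.map (f : R →* S) u) φ' := by
  obtain ⟨v, ψ, ψ', rfl, rfl, hψ⟩ := h
  rw [Triv.mk_eq_mk] at ha ⊢
  rw [ha, map_mul]
  congr 1
  ext
  rw [Units.coe_map, LinearEquiv.coe_det, LinearEquiv.coe_det, MonoidHom.coe_coe]
  refine ((hX.isFreeBaseChange f Odd).det_eq _ _ fun x => ?_).symm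
  change φ'.symm (ψ' _) = partToBC f Odd (φ.symm (ψ x))
  rw [LinearEquiv.symm_apply_eq, hψ, hφ, LinearEquiv.apply_symm_apply]

theorem IsBCTriv.unique [Nontrivial R] (hX : IsFiniteFree X) {a : Triv X}
    {a' a'' : Triv (bcTerms f X)}
    (h : IsBCTriv f a a') (h' : IsBCTriv f a a'') : a' = a'' := by
  obtain ⟨v, ψ, ψ', h1, rfl, hψ⟩ := h'
  exact h.eq_mk hX h1 hψ

theorem exists_equiv_bc [Nontrivial R] (hX : IsFiniteFree X) (f : R →+* S)
    (φ : oddPart X ≃ₗ[R] evenPart X) :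
    ∃ φ' : oddPart (bcTerms f X) ≃ₗ[S] evenPart (bcTerms f X),
      ∀ x : oddPart X, φ' (partToBC f Odd x) = partToBC f Even (φ x) :=
  (hX.isFreeBaseChange f Odd).exists_equiv (hX.isFreeBaseChange f Even) φ

theorem exists_isBCTriv [Nontrivial R] (hX : IsFiniteFree X) (f : R →+* S) (a : Triv X) :
    ∃ a' : Triv (bcTerms f X), IsBCTriv f a a' := by
  obtain ⟨u, φ, rfl⟩ := a.exists_mk
  obtain ⟨φ', h⟩ := exists_equiv_bc hX f φ
  exact ⟨_, u, φ, φ', rfl, rfl, h⟩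

theorem partToBC_evenShift (x : evenPart X) :
    partToBC f Odd (evenShift X x) = evenShift (bcTerms f X) (partToBC f Even x) := by
  ext i; rfl

theorem partToBC_oddShift (x : oddPart X) :
    partToBC f Even (oddShift X x) = oddShift (bcTerms f X) (partToBC f Odd x) := by
  ext i; rfl

theorem IsBCTriv.inv {a : Triv X} {a' : Triv (bcTerms f X)} (h : IsBCTriv f a a') :
    IsBCTriv f a.inv a'.inv := by
  obtain ⟨v, ψ, ψ', rfl, rfl, hψ⟩ := h
  refine ⟨_, _, _, rfl, rfl, fun x => ?_⟩
  obtain ⟨x, rfl⟩ := (evenShift X).surjective x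
  obtain ⟨x, rfl⟩ := ψ.surjective x
  rw [partToBC_evenShift, ← hψ]
  simp only [LinearEquiv.trans_apply, LinearEquiv.symm_apply_apply, LinearEquiv.neg_apply, map_neg,
    partToBC_oddShift]

/-- The base change of a degreewise family of maps. -/
abbrev bcMap (f : R →+* S) {Y : ℤ → ModuleCat.{0} R} (g : ∀ i, X i ⟶ Y i) (i : ℤ) :
    bcTerms f X i ⟶ bcTerms f Y i :=
  (ModuleCat.extendScalars f).map (g i)

theorem bcMap_toBC {Y : ℤ → ModuleCat.{0} R} (g : ∀ i, X i ⟶ Y i) (i : ℤ) (x : X i) :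
    (bcMap f g i).hom (toBC f X i x) = toBC f Y i ((g i).hom x) :=
  ModuleCat.ExtendScalars.map_tmul _ _ _ _

theorem oddMap_bcMap {Y : ℤ → ModuleCat.{0} R} (g : ∀ i, X i ⟶ Y i) (x : oddPart X) :
    oddMap (bcMap f g) (partToBC f Odd x) = partToBC f Odd (oddMap g x) := by
  ext i; exact bcMap_toBC g i _

theorem evenMap_bcMap {Y : ℤ → ModuleCat.{0} R} (g : ∀ i, X i ⟶ Y i) (x : evenPart X) :
    evenMap (bcMap f g) (partToBC f Even x) = partToBC f Even (evenMap g x) := by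
  ext i; exact bcMap_toBC g i _

theorem IsProduct.baseChange [Nontrivial R] {X' X'' : ℤ → ModuleCat.{0} R} (hX' : IsFiniteFree X')
    (hX : IsFiniteFree X) (hX'' : IsFiniteFree X'') {g : ∀ i, X' i ⟶ X i} {h : ∀ i, X i ⟶ X'' i}
    {a' : Triv X'} {a : Triv X} {a'' : Triv X''} (H : IsProduct g h a' a a'')
    {b' : Triv (bcTerms f X')} {b : Triv (bcTerms f X)} {b'' : Triv (bcTerms f X'')}
    (hb' : IsBCTriv f a' b') (hb : IsBCTriv f a b) (hb'' : IsBCTriv f a'' b'') :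
    IsProduct (bcMap f g) (bcMap f h) b' b b'' := by
  obtain ⟨u', u'', φ', φ, φ'', h1, h2, h3, h4, h5⟩ := H
  obtain ⟨ψ', hψ'⟩ := exists_equiv_bc hX' f φ'
  obtain ⟨ψ, hψ⟩ := exists_equiv_bc hX f φ
  obtain ⟨ψ'', hψ''⟩ := exists_equiv_bc hX'' f φ''
  refine ⟨Units.map (f : R →* S) u', Units.map (f : R →* S) u'', ψ', ψ, ψ'',
    hb'.eq_mk hX' h1 hψ', hb''.eq_mk hX'' h2 hψ'', ?_, ?_, ?_⟩
  · rw [← map_mul]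
    exact hb.eq_mk hX h3 hψ
  · refine fun x => LinearMap.congr_fun (f := (ψ : _ →ₗ[S] _) ∘ₗ oddMap (bcMap f g))
      (g := evenMap (bcMap f g) ∘ₗ (ψ' : _ →ₗ[S] _)) ?_ x
    refine (hX'.isFreeBaseChange f Odd).hom_ext fun x => ?_
    change ψ (oddMap _ _) = evenMap _ (ψ' _)
    rw [oddMap_bcMap, hψ, h4, hψ', evenMap_bcMap]
  · refine fun x => LinearMap.congr_fun (f := evenMap (bcMap f h) ∘ₗ (ψ : _ →ₗ[S] _))
      (g := (ψ'' : _ →ₗ[S] _) ∘ₗ oddMap (bcMap f h)) ?_ x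
    refine (hX.isFreeBaseChange f Odd).hom_ext fun x => ?_
    change evenMap _ (ψ _) = ψ'' (oddMap _ _)
    rw [oddMap_bcMap, hψ, hψ'', ← h5, evenMap_bcMap]

theorem IsContraction.baseChange {δ σ : GHom X X} (h : IsContraction δ σ) :
    IsContraction (bcHom f δ) (bcHom f σ) where
  sq i j k hij hjk := by
    refine LinearMap.congr_fun (f := bcHom f δ j k ∘ₗ bcHom f δ i j) (g := 0) ?_
    refine bcHom_ext f fun x => ?_
    rw [LinearMap.comp_apply, bcHom_toBC, bcHom_toBC, h.sq i j k hij hjk, map_zero]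
    rfl
  htpy i j k hij hjk := by
    refine LinearMap.congr_fun (f := bcHom f δ i j ∘ₗ bcHom f σ j i +
      bcHom f σ k j ∘ₗ bcHom f δ j k) (g := LinearMap.id) ?_
    refine bcHom_ext f fun x => ?_
    simp only [LinearMap.add_apply, LinearMap.comp_apply, bcHom_toBC, LinearMap.id_apply]
    rw [← map_add, h.htpy i j k hij hjk]

theorem oddOp_partToBC (δ σ : GHom X X) (x : oddPart X) :
    oddOp (bcHom f δ) (bcHom f σ) (partToBC f Odd x) = partToBC f Even (oddOp δ σ x) := by
  induction x using part_induction with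
  | h0 => simp
  | ha x y hx hy => simp only [map_add, hx, hy]
  | h i hi x =>
    have h1 : Even (i - 1) := hi.sub_odd odd_one
    rw [partToBC_inPart,
      oddOp_inPart _ _ (i - 1) i (i + 1) (by ring) rfl hi h1 (odd_add_one i hi),
      oddOp_inPart _ _ (i - 1) i (i + 1) (by ring) rfl hi h1 (odd_add_one i hi), map_add,
      partToBC_inPart, partToBC_inPart, bcHom_toBC, bcHom_toBC]

theorem IsVal.baseChange [Nontrivial R] (hX : IsFiniteFree X) {δ : GHom X X} {a : Triv X} {F : Rˣ}
    (h : IsVal δ a F) {a' : Triv (bcTerms f X)} (ha : IsBCTriv f a a') :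
    IsVal (bcHom f δ) a' (Units.map (f : R →* S) F) := by
  obtain ⟨σ, ψ, hσ, hψ, rfl⟩ := h
  obtain ⟨ψ', hψ'⟩ := exists_equiv_bc hX f ψ
  refine ⟨bcHom f σ, ψ', hσ.baseChange, ?_, ?_⟩
  · refine (hX.isFreeBaseChange f Odd).hom_ext fun x => ?_
    rw [oddOp_partToBC, ← hψ]
    exact hψ' x
  · rw [Triv.smul_mk] at ha ⊢
    rw [ha.eq_mk hX rfl hψ', map_mul, map_one]

end GradedBaseChange

/-! ### Homotopies of complexes as contractions. -/

section Complexes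

variable {R : Type} [CommRing R]

/-- The differential of a complex as a family of maps. -/
abbrev dFam (C : CochainComplex (ModuleCat.{0} R) ℤ) : GHom C.X C.X := fun i j => (C.d i j).hom

theorem dFam_sq (C : CochainComplex (ModuleCat.{0} R) ℤ) (i j k : ℤ) (x : C.X i) :
    dFam C j k (dFam C i j x) = 0 :=
  LinearMap.congr_fun (congrArg ModuleCat.Hom.hom (C.d_comp_d i j k)) x

theorem dPlusS_eq_oddOp {C : CochainComplex (ModuleCat.{0} R) ℤ} (s : Homotopy (𝟙 C) 0) :
    dPlusS s = oddOp (dFam C) (fun i j => (s.hom i j).hom) := by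
  refine part_hom_ext fun i hi x => ?_
  rw [oddOp_inPart _ _ (i - 1) i (i + 1) (by ring) rfl hi (hi.sub_odd odd_one) (odd_add_one i hi),
    dPlusS, DirectSum.toModule_lof]
  rfl

theorem isContraction_of_homotopy {C : CochainComplex (ModuleCat.{0} R) ℤ}
    (s : Homotopy (𝟙 C) 0) : IsContraction (dFam C) (fun i j => (s.hom i j).hom) where
  sq i j k _ _ x := dFam_sq C i j k x
  htpy i j k hij hjk x := by
    have h := s.comm j
    rw [dNext_eq s.hom (show (ComplexShape.up ℤ).Rel j k from hjk),
      prevD_eq s.hom (show (ComplexShape.up ℤ).Rel i j from hij)] at h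
    have h2 := LinearMap.congr_fun (congrArg ModuleCat.Hom.hom h) x
    simp at h2
    rw [add_comm]
    exact h2.symm

/-- A `Homotopy` must vanish outside degree `-1`, where `σ` is arbitrary; hence `σ` is cut off and
agreement is claimed only for `j + 1 = i`. -/
theorem exists_homotopy {C : CochainComplex (ModuleCat.{0} R) ℤ} {σ : GHom C.X C.X}
    (h : IsContraction (dFam C) σ) : ∃ s : Homotopy (𝟙 C) 0,
      ∀ i j, j + 1 = i → (s.hom i j).hom = σ i j := by
  classical
  refine ⟨{ hom := fun i j => if j + 1 = i then ModuleCat.ofHom (σ i j) else 0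
            zero := fun i j hij => if_neg hij
            comm := fun j => ?_ }, fun i j hij => ?_⟩
  · rw [dNext_eq _ (show (ComplexShape.up ℤ).Rel j (j + 1) from rfl),
      prevD_eq _ (show (ComplexShape.up ℤ).Rel (j - 1) j by simp)]
    ext x
    simp
    rw [add_comm]
    exact (h.htpy (j - 1) j (j + 1) (by ring) rfl x).symm
  · simp [hij]

theorem oddOp_congr {X Y : ℤ → ModuleCat.{0} R} {δ σ δ' σ' : GHom X Y}
    (h : ∀ i j, i + 1 = j → δ i j = δ' i j) (h' : ∀ i j, j + 1 = i → σ i j = σ' i j) :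
    oddOp δ σ = oddOp δ' σ' := by
  refine part_hom_ext fun i hi x => ?_
  rw [oddOp_inPart _ _ (i - 1) i (i + 1) (by ring) rfl hi (hi.sub_odd odd_one) (odd_add_one i hi),
    oddOp_inPart _ _ (i - 1) i (i + 1) (by ring) rfl hi (hi.sub_odd odd_one) (odd_add_one i hi),
    h _ _ rfl, h' _ _ (by ring)]

/-- `IsVal` is more flexible than `IsAcyclicTriv`: it keeps track of a factor, and it applies to
perturbed differentials on the terms of a complex. -/
theorem isAcyclicTriv_iff (C : CochainComplex (ModuleCat.{0} R) ℤ) (b : Triv C.X) :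
    IsAcyclicTriv C b ↔ IsVal (dFam C) b 1 := by
  constructor
  · rintro ⟨s, ψ, hψ, rfl⟩
    exact ⟨_, ψ, isContraction_of_homotopy s, by rw [hψ, dPlusS_eq_oddOp], (Triv.one_smul _).symm⟩
  · rintro ⟨σ, ψ, hσ, hψ, rfl⟩
    obtain ⟨s, hs⟩ := exists_homotopy hσ
    refine ⟨s, ψ, ?_, Triv.one_smul _⟩
    rw [hψ, dPlusS_eq_oddOp]
    exact oddOp_congr (fun _ _ _ => rfl) fun i j h => (hs i j h).symm

end Complexes

/-! ### Mapping cones as split extensions. -/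

section Cone

variable {R : Type} [CommRing R]

theorem IsSplitExact.isFiniteFree {X' X X'' : ℤ → ModuleCat.{0} R}
    {f : ∀ i, X' i ⟶ X i} {g : ∀ i, X i ⟶ X'' i} {r : ∀ i, X i ⟶ X' i}
    {j : ∀ i, X'' i ⟶ X i} (h : IsSplitExact f g r j) (hX' : IsFiniteFree X')
    (hX'' : IsFiniteFree X'') : IsFiniteFree X := by
  have rj : ∀ i x, (r i).hom ((j i).hom x) = 0 := by
    intro i x
    have h1 := h.decomp i ((j i).hom x)
    rw [h.sect, add_eq_right] at h1
    rw [← h.retr i ((r i).hom ((j i).hom x)), h1, map_zero]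
  have e : ∀ i, Nonempty (X i ≃ₗ[R] X' i × X'' i) := fun i =>
    ⟨LinearEquiv.ofLinearMap ((r i).hom.prod (g i).hom) ((f i).hom.coprod (j i).hom)
      (by ext x <;> simp [h.retr, h.zero, rj, h.sect]) (by ext x; simp [h.decomp])⟩
  refine ⟨fun i => ?_, fun i => ?_, ?_⟩
  · have := hX'.finite i
    have := hX''.finite i
    exact Module.Finite.equiv (e i).some.symm
  · have := hX'.free i
    have := hX''.free i
    exact Module.Free.of_equiv (e i).some.symm
  · obtain ⟨m, n, h⟩ := hX'.bounded
    obtain ⟨m', n', h'⟩ := hX''.bounded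
    refine ⟨min m m', max n n', fun i hi => ?_⟩
    have := h i (by omega)
    have := h' i (by omega)
    exact (e i).some.toEquiv.subsingleton

theorem IsStrictlyPerfect.isFiniteFree [IsLocalRing R] {C : CochainComplex (ModuleCat.{0} R) ℤ}
    (h : IsStrictlyPerfect C) : IsFiniteFree C.X where
  finite := h.finite
  free i := by
    have := h.finite i
    have := h.projective i
    exact Module.free_of_flat_of_isLocalRing
  bounded := h.bounded

open CochainComplex

variable {C C' : CochainComplex (ModuleCat.{0} R) ℤ} (f : C ⟶ C')

theorem hom_congr_apply {M N : ModuleCat.{0} R} {f g : M ⟶ N} (h : f = g) (x : M) :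
    f.hom x = g.hom x := by rw [h]

theorem isSplitExact_mappingCone : IsSplitExact (X'' := shiftTerms C.X)
    (fun i => (mappingCone.inr f).f i) (fun i => (mappingCone.fst f).1.v i (i + 1) rfl)
    (fun i => (mappingCone.snd f).v i i (add_zero i))
    (fun i => (mappingCone.inl f).v (i + 1) i (by omega)) where
  retr i x := hom_congr_apply (mappingCone.inr_f_snd_v f i) x
  sect i x := hom_congr_apply (mappingCone.inl_v_fst_v f (i + 1) i rfl) x
  zero i x := hom_congr_apply (mappingCone.inr_f_fst_v f i (i + 1) rfl) x
  decomp i x := by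
    rw [add_comm]
    exact hom_congr_apply (mappingCone.id_X f i (i + 1) rfl) x

theorem dFam_mappingCone_inr (i k : ℤ) (x : C'.X i) :
    dFam (mappingCone f) i k (((mappingCone.inr f).f i).hom x) =
      ((mappingCone.inr f).f k).hom (dFam C' i k x) :=
  hom_congr_apply (mappingCone.inr_f_d f i k) x

theorem fst_dFam_mappingCone (i k l : ℤ) (hik : i + 1 = k) (hkl : k + 1 = l)
    (x : (mappingCone f).X i) :
    ((mappingCone.fst f).1.v k l hkl).hom (dFam (mappingCone f) i k x) =
      -dFam C k l (((mappingCone.fst f).1.v i k hik).hom x) :=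
  hom_congr_apply (mappingCone.d_fst_v f i k l hik hkl) x

theorem dFam_shift (C : CochainComplex (ModuleCat.{0} R) ℤ) :
    dFam ((CategoryTheory.shiftFunctor (CochainComplex (ModuleCat.{0} R) ℤ) (1 : ℤ)).obj C) =
      shiftNeg (dFam C) := by
  funext i j
  change (((1 : ℤ).negOnePow • C.d _ _)).hom = _
  simp [shiftNeg, Int.negOnePow_one, Units.smul_def]

end Cone

/-! ### The characteristic element and the homomorphism on `K1`. -/

section Characteristic

variable {R K : Type} [CommRing R] [Field K] (f : R →+* K)

/-- `F` is the automorphism of the unit object given by `a` and the acyclicity of `K ⊗_R C`. -/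
def IsCharElt (C : CochainComplex (ModuleCat.{0} R) ℤ) (a : Triv C.X) (F : Kˣ) : Prop :=
  ∃ a' : Triv (bcTerms f C.X), IsBCTriv f a a' ∧ IsVal (bcHom f (dFam C)) a' F

variable {f}

theorem IsCharElt.unique [Nontrivial R] {C : CochainComplex (ModuleCat.{0} R) ℤ}
    (hC : IsFiniteFree C.X)
    {a : Triv C.X} {F F' : Kˣ} (h : IsCharElt f C a F) (h' : IsCharElt f C a F') : F = F' := by
  obtain ⟨a', h1, h2⟩ := h
  obtain ⟨a'', h1', h2'⟩ := h'
  obtain rfl := h1.unique hC h1'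
  exact h2.unique (hC.baseChange f) h2'

theorem IsSplitExact.baseChange {X' X X'' : ℤ → ModuleCat.{0} R}
    {g : ∀ i, X' i ⟶ X i} {h : ∀ i, X i ⟶ X'' i} {r : ∀ i, X i ⟶ X' i}
    {j : ∀ i, X'' i ⟶ X i} (H : IsSplitExact g h r j) :
    IsSplitExact (bcMap f g) (bcMap f h) (bcMap f r) (bcMap f j) where
  retr i x := by
    refine LinearMap.congr_fun (f := (bcMap f r i).hom ∘ₗ (bcMap f g i).hom) (g := .id) ?_ x
    exact bcHom_ext f fun x => by simp [bcMap_toBC, H.retr]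
  sect i x := by
    refine LinearMap.congr_fun (f := (bcMap f h i).hom ∘ₗ (bcMap f j i).hom) (g := .id) ?_ x
    exact bcHom_ext f fun x => by simp [bcMap_toBC, H.sect]
  zero i x := by
    refine LinearMap.congr_fun (f := (bcMap f h i).hom ∘ₗ (bcMap f g i).hom) (g := 0) ?_ x
    exact bcHom_ext f fun x => by simp [bcMap_toBC, H.zero]
  decomp i x := by
    refine LinearMap.congr_fun (f := (bcMap f g i).hom ∘ₗ (bcMap f r i).hom +
      (bcMap f j i).hom ∘ₗ (bcMap f h i).hom) (g := .id) ?_ x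
    exact bcHom_ext f fun x => by simp [bcMap_toBC, ← map_add, H.decomp]

/-- A family of maps commuting with the differentials does so after base change. -/
theorem bcMap_comm {X Y : ℤ → ModuleCat.{0} R} (g : ∀ i, X i ⟶ Y i) {δ : GHom X X} {δ' : GHom Y Y}
    {i k : ℤ} (h : ∀ x, δ' i k ((g i).hom x) = (g k).hom (δ i k x)) (x : bcTerms f X i) :
    bcHom f δ' i k ((bcMap f g i).hom x) = (bcMap f g k).hom (bcHom f δ i k x) := by
  refine LinearMap.congr_fun (f := bcHom f δ' i k ∘ₗ (bcMap f g i).hom)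
    (g := (bcMap f g k).hom ∘ₗ bcHom f δ i k) ?_ x
  exact bcHom_ext f fun x => by
    rw [LinearMap.comp_apply, LinearMap.comp_apply, bcMap_toBC, bcHom_toBC, bcHom_toBC, bcMap_toBC,
      h]

theorem bcHom_sq {X : ℤ → ModuleCat.{0} R} {δ : GHom X X} {i j k : ℤ}
    (h : ∀ x, δ j k (δ i j x) = 0) (x : bcTerms f X i) :
    bcHom f δ j k (bcHom f δ i j x) = 0 := by
  refine LinearMap.congr_fun (f := bcHom f δ j k ∘ₗ bcHom f δ i j) (g := 0) ?_ x
  exact bcHom_ext f fun x => by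
    rw [LinearMap.comp_apply, bcHom_toBC, bcHom_toBC, h, map_zero, LinearMap.zero_apply]

theorem bcHom_shiftNeg {X : ℤ → ModuleCat.{0} R} (δ : GHom X X) :
    bcHom f (shiftNeg δ) = shiftNeg (bcHom f δ) := by
  funext i j
  refine bcHom_ext f fun x => ?_
  rw [bcHom_toBC]
  refine (map_neg (toBC f X (j + 1)) _).trans ?_
  rw [← bcHom_toBC]
  rfl

theorem IsCharElt.shift {C : CochainComplex (ModuleCat.{0} R) ℤ} (hC : IsFiniteFree C.X)
    {a : Triv C.X} {F : Kˣ} (h : IsCharElt f C a F) :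
    IsCharElt f ((shiftFunctor (CochainComplex (ModuleCat.{0} R) ℤ) (1 : ℤ)).obj C) a.inv F⁻¹ := by
  obtain ⟨a', h1, h2⟩ := h
  refine ⟨a'.inv, h1.inv, ?_⟩
  have h3 := h2.inv (hC.baseChange f)
  rw [← bcHom_shiftNeg] at h3
  rw [dFam_shift]
  exact h3

theorem IsCharElt.product [Nontrivial R] {S : ShortComplex (CochainComplex (ModuleCat.{0} R) ℤ)}
    (hS : S.ShortExact) (h₁ : IsFiniteFree S.X₁.X) (h₂ : IsFiniteFree S.X₂.X)
    (h₃ : IsFiniteFree S.X₃.X) {a₁ : Triv S.X₁.X} {a₂ : Triv S.X₂.X} {a₃ : Triv S.X₃.X}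
    (ha : IsProduct (fun i => S.f.f i) (fun i => S.g.f i) a₁ a₂ a₃) {F₁ F₃ : Kˣ}
    (hF₁ : IsCharElt f S.X₁ a₁ F₁) (hF₃ : IsCharElt f S.X₃ a₃ F₃) :
    IsCharElt f S.X₂ a₂ (F₁ * F₃) := by
  have hS' : ∀ i, (S.map (HomologicalComplex.eval _ _ i)).ShortExact := fun i =>
    hS.map_of_exact (HomologicalComplex.eval (ModuleCat.{0} R) (ComplexShape.up ℤ) i)
  obtain ⟨r, j, H⟩ := exists_isSplitExact (f := fun i => S.f.f i) (g := fun i => S.g.f i)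
    (fun i => (ModuleCat.mono_iff_injective _).1 (hS' i).mono_f)
    (fun i => (ModuleCat.epi_iff_surjective _).1 (hS' i).epi_g)
    (fun i => (ShortComplex.ShortExact.moduleCat_exact_iff_function_exact _).1 (hS' i).exact)
    (fun i => have := h₃.free i; inferInstance)
  obtain ⟨b₁, h1, h1'⟩ := hF₁
  obtain ⟨b₃, h3, h3'⟩ := hF₃
  obtain ⟨b₂, h2⟩ := exists_isBCTriv h₂ f a₂
  refine ⟨b₂, h2, IsVal.product (h₂.baseChange f) (H.baseChange (f := f)) ?_ ?_ ?_
    (ha.baseChange h₁ h₂ h₃ h1 h2 h3) h1' h3'⟩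
  · exact fun i k _ => bcMap_comm (fun i => S.f.f i) fun x => hom_congr_apply (S.f.comm i k) x
  · exact fun i k _ => bcMap_comm (fun i => S.g.f i) fun x => hom_congr_apply (S.g.comm i k) x
  · exact fun i j k _ _ => bcHom_sq (dFam_sq _ _ _ _)

/-- The trivialization of the cone has value `1` by definition, and value `F' * F⁻¹` by
multiplicativity along `C' → cone(g) → C[1]`. -/
theorem IsCharElt.quasiIso [Nontrivial R] {C C' : CochainComplex (ModuleCat.{0} R) ℤ}
    (hC : IsFiniteFree C.X)
    (hC' : IsFiniteFree C'.X) (g : C ⟶ C') {a : Triv C.X} {a' : Triv C'.X}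
    (hg : IsDetComp g a a') {F F' : Kˣ} (hF : IsCharElt f C a F) (hF' : IsCharElt f C' a' F') :
    F' = F := by
  obtain ⟨b, hb, hp⟩ := hg
  rw [isAcyclicTriv_iff] at hb
  have H := isSplitExact_mappingCone g
  have hX := H.isFiniteFree hC' hC.shift
  obtain ⟨b', hb'⟩ := exists_isBCTriv hX f b
  have h1 := hb.baseChange hX hb'
  obtain ⟨c, hc, hc'⟩ := hF
  obtain ⟨c', hd, hd'⟩ := hF'
  have h2 : IsVal (bcHom f (dFam (CochainComplex.mappingCone g))) b' (F' * F⁻¹) := by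
    refine IsVal.product (hX.baseChange f) (H.baseChange (f := f)) ?_ ?_ ?_
      (hp.baseChange hC' hX hC.shift hd hb' hc.inv) hd' (hc'.inv (hC.baseChange f))
    · exact fun i k _ => bcMap_comm _ fun x => dFam_mappingCone_inr g i k x
    · intro i k hik
      rw [← bcHom_shiftNeg]
      refine bcMap_comm _ fun x => ?_
      rw [fst_dFam_mappingCone g i k (k + 1) hik rfl]
      subst hik
      rfl
    · exact fun i j k _ _ => bcHom_sq (dFam_sq _ _ _ _)
  have := h1.unique (hX.baseChange f) h2
  rw [map_one] at this
  exact (mul_inv_eq_one.1 this.symm)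

theorem isCharElt_of_isZero [Nontrivial R] {Z : CochainComplex (ModuleCat.{0} R) ℤ}
    (hZ : Limits.IsZero Z)
    (hFF : IsFiniteFree Z.X) (φ : oddPart Z.X ≃ₗ[R] evenPart Z.X) {F : Kˣ}
    (h : IsCharElt f Z (Triv.mk 1 φ) F) : F = 1 := by
  obtain ⟨a', h1, σ, ψ, -, -, rfl⟩ := h
  obtain ⟨φ', hφ'⟩ := exists_equiv_bc hFF f φ
  have h2 := h1.eq_mk hFF rfl hφ'
  rw [map_one, Triv.smul_mk, mul_one, Triv.mk_eq_mk] at h2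
  have hsub : ∀ i, Subsingleton (Z.X i) := fun i => by
    have h0 : 𝟙 Z = 0 := hZ.eq_of_src _ _
    have h0 : 𝟙 (Z.X i) = 0 := by
      rw [← HomologicalComplex.id_f, h0, HomologicalComplex.zero_f]
    exact ⟨fun x y => (hom_congr_apply h0 x).trans (hom_congr_apply h0 y).symm⟩
  have hs : ∀ x : oddPart (bcTerms f Z.X), x = 0 := by
    refine LinearMap.congr_fun (f := (LinearMap.id : _ →ₗ[K] _)) (g := 0) ?_
    refine (hFF.isFreeBaseChange f Odd).hom_ext fun x => ?_
    have : x = 0 := by ext i; exact Subsingleton.elim (h := hsub i) _ _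
    rw [this, map_zero, map_zero, map_zero]
  have : ψ.trans φ'.symm = 1 := by
    refine LinearEquiv.ext fun x => ?_
    rw [hs ((ψ.trans φ'.symm) x), hs ((1 : _ ≃ₗ[K] _) x)]
  rw [this, map_one, mul_one] at h2
  exact h2.symm

/-- The four kinds of relations hold for characteristic elements by `isCharElt_of_isZero`,
`IsCharElt.quasiIso`, `IsCharElt.product` and `IsCharElt.shift`. About `Sig` only the freeness of
the terms and the existence of the element are needed. -/
theorem exists_charHom [Nontrivial R] (f : R →+* K)
    (Sig : CochainComplex (ModuleCat.{0} R) ℤ → Prop)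
    (hFF : ∀ C, Sig C → IsFiniteFree C.X)
    (hex : ∀ C, Sig C → ∀ a : Triv C.X, ∃ F, IsCharElt f C a F) :
    ∃ ch : K1 Sig →* Kˣ, ∀ C (hC : Sig C) a F, ch (K1.mk C hC a) = F ↔ IsCharElt f C a F := by
  choose v hv using hex
  let v' : K1Gen Sig → Kˣ := fun g => v g.C g.mem g.a
  have hrel : ∀ w ∈ {w | K1Rel Sig w}, FreeGroup.lift v' w = 1 := by
    rintro w (⟨Z, hZ, h, φ⟩ | ⟨C, C', h, h', g, hg, a, a', haa'⟩ |
      ⟨S, hS, h₁, h₂, h₃, a₁, a₂, a₃, ha⟩ | ⟨C, h, h', a⟩)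
    · simpa [v'] using isCharElt_of_isZero hZ (hFF Z h) φ (hv Z h _)
    · have := (hv C h a).quasiIso (hFF _ h) (hFF _ h') g haa' (hv C' h' a')
      simp [v', this]
    · have := (hv _ h₂ a₂).unique (hFF _ h₂) (IsCharElt.product hS (hFF _ h₁) (hFF _ h₂) (hFF _ h₃)
        ha (hv _ h₁ a₁) (hv _ h₃ a₃))
      simp [v', this]
    · have := (hv _ h' a.inv).unique (hFF _ h') ((hv C h a).shift (hFF _ h))
      simp [v', this]
  refine ⟨Abelianization.lift (PresentedGroup.toGroup hrel), fun C hC a F => ?_⟩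
  have : Abelianization.lift (PresentedGroup.toGroup hrel) (K1.mk C hC a) = v C hC a := by
    simp [K1.mk, v']
  rw [this]
  exact ⟨fun h => h ▸ hv C hC a, fun h => (hv C hC a).unique (hFF C hC) h⟩

end Characteristic

/-! ### Group rings over `ℤ_[p]` generated by one element of `p`-power order. -/

section GroupRing

variable {p : ℕ} [Fact p.Prime] {G : Type} [CommGroup G]

/-- The augmentation of the group ring. -/
abbrev groupAug (p : ℕ) [Fact p.Prime] (G : Type) [CommGroup G] :
    MonoidAlgebra ℤ_[p] G →ₐ[ℤ_[p]] ℤ_[p] :=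
  MonoidAlgebra.lift ℤ_[p] ℤ_[p] G 1

theorem groupAug_of (g : G) : groupAug p G (MonoidAlgebra.of ℤ_[p] G g) = 1 := by
  simp [groupAug]

/-- Modulo `g - 1` every power of `g` becomes `1`, so every element becomes its augmentation. -/
theorem sub_one_dvd_of_groupAug_eq_zero {g : G} (hg : ∀ h : G, ∃ n : ℕ, g ^ n = h)
    (x : MonoidAlgebra ℤ_[p] G) (hx : groupAug p G x = 0) :
    MonoidAlgebra.of ℤ_[p] G g - 1 ∣ x := by
  suffices H : ∀ x : MonoidAlgebra ℤ_[p] G, MonoidAlgebra.of ℤ_[p] G g - 1 ∣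
      x - algebraMap ℤ_[p] _ (groupAug p G x) by
    simpa [hx] using H x
  intro x
  induction x using MonoidAlgebra.induction_on with
  | of h =>
    obtain ⟨n, rfl⟩ := hg h
    rw [groupAug_of, map_one, map_pow]
    exact sub_one_dvd_pow_sub_one _ _
  | add x y hx hy =>
    rw [map_add, map_add, add_sub_add_comm]
    exact dvd_add hx hy
  | smul r x hx =>
    rw [map_smul, smul_eq_mul, map_mul, Algebra.smul_def, ← mul_sub]
    exact hx.mul_left _

/-- Modulo `p` the `p ^ m`-th power is additive, so `(g - 1) ^ p ^ m` is congruent to `g ^ p ^ m - 1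
= 0`. -/
theorem exists_sub_one_pow_eq {g : G} {m : ℕ} (hg : g ^ p ^ m = 1) :
    ∃ r, (MonoidAlgebra.of ℤ_[p] G g - 1) ^ p ^ m = (p : MonoidAlgebra ℤ_[p] G) * r := by
  obtain ⟨r, hr⟩ := exists_add_pow_prime_pow_eq (Fact.out : p.Prime)
    (MonoidAlgebra.of ℤ_[p] G g - 1) 1 m
  rw [sub_add_cancel, ← map_pow, hg, map_one, one_pow] at hr
  refine ⟨-((MonoidAlgebra.of ℤ_[p] G g - 1) * r), ?_⟩
  linear_combination -hr

/-- Multiplication by this element is the identity modulo `p`, hence surjective by Nakayama's lemma.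
-/
theorem isUnit_one_add_p_mul [Finite G] (r : MonoidAlgebra ℤ_[p] G) :
    IsUnit (1 + (p : MonoidAlgebra ℤ_[p] G) * r) := by
  set y := 1 + (p : MonoidAlgebra ℤ_[p] G) * r
  have hfin : Module.Finite ℤ_[p] (MonoidAlgebra ℤ_[p] G) :=
    Module.Finite.equiv (MonoidAlgebra.coeffLinearEquiv ℤ_[p]).symm
  have key : (⊤ : Submodule ℤ_[p] (MonoidAlgebra ℤ_[p] G)) ≤
      LinearMap.range (LinearMap.mulLeft ℤ_[p] y) := by
    refine Submodule.le_of_le_smul_of_le_jacobson_bot (I := IsLocalRing.maximalIdeal ℤ_[p])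
      hfin.fg_top (IsLocalRing.maximalIdeal_le_jacobson _) ?_
    intro x _
    refine Submodule.mem_sup.2 ⟨y * x, ⟨x, rfl⟩, (p : ℤ_[p]) • (-(r * x)), ?_, ?_⟩
    · refine Submodule.smul_mem_smul ?_ trivial
      rw [PadicInt.maximalIdeal_eq_span_p]
      exact Ideal.mem_span_singleton_self _
    · rw [Algebra.smul_def, map_natCast]
      simp only [y]
      ring
  obtain ⟨z, hz⟩ := key (trivial : (1 : MonoidAlgebra ℤ_[p] G) ∈ ⊤)
  exact IsUnit.of_mul_eq_one z hz

theorem isUnit_of_isUnit_groupAug [Finite G] {g : G} {m : ℕ} (hg : g ^ p ^ m = 1)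
    (hgen : ∀ h : G, ∃ n : ℕ, g ^ n = h) (x : MonoidAlgebra ℤ_[p] G)
    (hx : IsUnit (groupAug p G x)) : IsUnit x := by
  obtain ⟨w, hw⟩ := sub_one_dvd_of_groupAug_eq_zero hgen
    (x - algebraMap ℤ_[p] _ (groupAug p G x)) (by simp)
  obtain ⟨r, hr⟩ := exists_sub_one_pow_eq (p := p) hg
  set T := MonoidAlgebra.of ℤ_[p] G g - 1
  obtain ⟨c, hc⟩ := (hx.map (algebraMap ℤ_[p] (MonoidAlgebra ℤ_[p] G))).pow (p ^ m)
  -- Writing `x = c + T * w` with `c` its augmentation, `x` divides `c ^ p ^ m - (-(T * w)) ^ p ^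
  -- m`, a unit minus a multiple of `p`.
  have h1 : x ∣ (algebraMap ℤ_[p] (MonoidAlgebra ℤ_[p] G) (groupAug p G x)) ^ p ^ m -
      (-(T * w)) ^ p ^ m := by
    refine dvd_trans (dvd_of_eq ?_) (sub_dvd_pow_sub_pow _ _ _)
    rw [← hw]; ring
  have h2 : (-(T * w)) ^ p ^ m = (p : MonoidAlgebra ℤ_[p] G) * (r * (-w) ^ p ^ m) := by
    rw [show -(T * w) = T * -w by ring, mul_pow, hr]; ring
  rw [h2, ← hc] at h1
  refine isUnit_of_dvd_unit h1 ?_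
  have h3 : (c : MonoidAlgebra ℤ_[p] G) - (p : MonoidAlgebra ℤ_[p] G) * (r * (-w) ^ p ^ m) =
      c * (1 + (p : MonoidAlgebra ℤ_[p] G) *
        (-(r * (-w) ^ p ^ m) * ((c⁻¹ : (MonoidAlgebra ℤ_[p] G)ˣ) : MonoidAlgebra ℤ_[p] G))) := by
    linear_combination (p : MonoidAlgebra ℤ_[p] G) * (r * (-w) ^ p ^ m) * c.mul_inv
  rw [h3]
  exact c.isUnit.mul (isUnit_one_add_p_mul _)

theorem eq_zero_of_forall_p_pow_dvd (x : MonoidAlgebra ℤ_[p] G)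
    (h : ∀ k : ℕ, (p : MonoidAlgebra ℤ_[p] G) ^ k ∣ x) : x = 0 := by
  refine MonoidAlgebra.coeff_injective (Finsupp.ext fun g => ?_)
  have h1 : ∀ k : ℕ, (p : ℤ_[p]) ^ k ∣ x.coeff g := by
    intro k
    obtain ⟨y, rfl⟩ := h k
    refine ⟨y.coeff g, ?_⟩
    have : (p : MonoidAlgebra ℤ_[p] G) ^ k * y = (p : ℤ_[p]) ^ k • y := by
      rw [Algebra.smul_def, map_pow, map_natCast]
    rw [this]
    rfl
  by_contra hne
  have h2 := FiniteMultiplicity.of_prime_left (PadicInt.prime_p (p := p)) hne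
  obtain ⟨n, hn⟩ := h2
  exact hn (h1 _)

end GroupRing

/-! ### Quotients of `Γ` by open subgroups. -/

section Quotients

variable {p : ℕ} [Fact p.Prime] {Γ : Type} [CommGroup Γ] [TopologicalSpace Γ]

/-- The image of `γ` in `Γ / U`. -/
abbrev imageIn (U : OpenSubgroup Γ) (γ : Γ) : Γ ⧸ (U : Subgroup Γ) := QuotientGroup.mk γ

theorem exists_zpow_eq [IsTopologicalGroup Γ]
    {γ : Γ} (hγ : Dense (Subgroup.zpowers γ : Set Γ)) (U : OpenSubgroup Γ)
    (h : Γ ⧸ (U : Subgroup Γ)) : ∃ n : ℤ, imageIn U γ ^ n = h := by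
  obtain ⟨g, rfl⟩ := QuotientGroup.mk_surjective h
  have hop : IsOpen ((fun x => g⁻¹ * x) ⁻¹' (U : Set Γ)) :=
    U.isOpen.preimage (continuous_const_mul g⁻¹)
  obtain ⟨_, ⟨n, rfl⟩, hx⟩ := hγ.exists_mem_open hop ⟨g, by simp⟩
  refine ⟨n, ?_⟩
  rw [← QuotientGroup.mk_zpow]
  exact (QuotientGroup.eq.2 hx).symm

/-- In `ℤ_[p]` the multiples `p ^ m * a` tend to `0`, so `γ ^ p ^ m` eventually enters every open
subgroup. -/
theorem exists_pow_prime_pow_eq_one (hΓ : Nonempty (Γ ≃ₜ* Multiplicative ℤ_[p])) (γ : Γ)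
    (U : OpenSubgroup Γ) : ∃ m : ℕ, imageIn U γ ^ p ^ m = 1 := by
  obtain ⟨e⟩ := hΓ
  have h1 : Filter.Tendsto (fun m : ℕ => (p : ℤ_[p]) ^ m * (e γ).toAdd) Filter.atTop (nhds 0) := by
    rw [← zero_mul (e γ).toAdd]
    refine Filter.Tendsto.mul_const _ (tendsto_pow_atTop_nhds_zero_of_norm_lt_one ?_)
    rw [PadicInt.norm_p]
    exact inv_lt_one_of_one_lt₀ (by exact_mod_cast (Fact.out : p.Prime).one_lt)
  have h2 : Filter.Tendsto (fun m : ℕ => γ ^ p ^ m) Filter.atTop (nhds 1) := by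
    have h3 := ((map_continuous e.symm).tendsto 1).comp
      ((continuous_ofAdd (X := ℤ_[p])).tendsto 0 |>.comp h1)
    rw [map_one] at h3
    refine h3.congr fun m => ?_
    change e.symm (Multiplicative.ofAdd ((p : ℤ_[p]) ^ m * (e γ).toAdd)) = _
    rw [← Nat.cast_pow, ← nsmul_eq_mul, ofAdd_nsmul, ofAdd_toAdd, map_pow]
    simp
  obtain ⟨m, hm⟩ := (h2.eventually (U.isOpen.mem_nhds U.one_mem)).exists
  refine ⟨m, ?_⟩
  rw [← QuotientGroup.mk_pow]
  exact (QuotientGroup.eq_one_iff _).2 hm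

theorem exists_pow_eq [IsTopologicalGroup Γ]
    (hΓ : Nonempty (Γ ≃ₜ* Multiplicative ℤ_[p])) {γ : Γ}
    (hγ : Dense (Subgroup.zpowers γ : Set Γ)) (U : OpenSubgroup Γ) (h : Γ ⧸ (U : Subgroup Γ)) :
    ∃ n : ℕ, imageIn U γ ^ n = h := by
  obtain ⟨m, hm⟩ := exists_pow_prime_pow_eq_one hΓ γ U
  have hfin : IsOfFinOrder (imageIn U γ) :=
    isOfFinOrder_iff_pow_eq_one.2 ⟨p ^ m, pow_pos (Fact.out : p.Prime).pos m, hm⟩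
  obtain ⟨n, rfl⟩ := exists_zpow_eq hγ U h
  exact (Submonoid.mem_powers_iff _ _).1 ((hfin.mem_powers_iff_mem_zpowers).2 ⟨n, rfl⟩)

theorem finite_quotient [IsTopologicalGroup Γ]
    (hΓ : Nonempty (Γ ≃ₜ* Multiplicative ℤ_[p])) {γ : Γ}
    (hγ : Dense (Subgroup.zpowers γ : Set Γ)) (U : OpenSubgroup Γ) :
    Finite (Γ ⧸ (U : Subgroup Γ)) := by
  obtain ⟨m, hm⟩ := exists_pow_prime_pow_eq_one hΓ γ U
  refine Finite.of_surjective (fun n : Fin (p ^ m) => imageIn U γ ^ (n : ℕ)) fun h => ?_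
  obtain ⟨n, rfl⟩ := exists_pow_eq hΓ hγ U h
  refine ⟨⟨n % p ^ m, Nat.mod_lt _ (pow_pos (Fact.out : p.Prime).pos m)⟩, ?_⟩
  exact (pow_eq_pow_mod n hm).symm

theorem exists_pow_ne_one (hΓ : Nonempty (Γ ≃ₜ* Multiplicative ℤ_[p])) {γ : Γ}
    (hγ : Dense (Subgroup.zpowers γ : Set Γ)) (k : ℕ) :
    ∃ U : OpenSubgroup Γ, imageIn U γ ^ p ^ k ≠ 1 := by
  obtain ⟨e⟩ := hΓ
  have hne : (e γ).toAdd ≠ 0 := by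
    intro h0
    have h1 : γ = 1 := by
      apply e.injective
      rw [map_one]
      exact h0
    have : T1Space Γ := e.toHomeomorph.symm.t1Space
    rw [h1, Subgroup.zpowers_one_eq_bot, Subgroup.coe_bot, dense_iff_closure_eq,
      closure_singleton] at hγ
    have h2 : e.symm (Multiplicative.ofAdd 1) = 1 := by
      have : e.symm (Multiplicative.ofAdd 1) ∈ ({1} : Set Γ) := hγ ▸ trivial
      exact this
    have h3 : (Multiplicative.ofAdd (1 : ℤ_[p])) = 1 := by
      rw [← e.apply_symm_apply (Multiplicative.ofAdd 1), h2, map_one]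
    exact one_ne_zero (α := ℤ_[p]) h3
  set r : ℝ := ‖(p : ℤ_[p]) ^ k * (e γ).toAdd‖
  have hr : 0 < r := norm_pos_iff.2 (mul_ne_zero (pow_ne_zero _ PadicInt.prime_p.ne_zero) hne)
  -- The open ball whose radius is the norm of the image of `γ ^ p ^ k`. It is a subgroup by the
  -- ultrametric inequality, and `γ ^ p ^ k` lies just outside it.
  let V : OpenSubgroup Γ :=
    { carrier := {x | ‖(e x).toAdd‖ < r}
      mul_mem' := fun {x y} hx hy => by
        simp only [Set.mem_ofPred_eq, map_mul, toAdd_mul] at hx hy ⊢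
        exact (PadicInt.nonarchimedean _ _).trans_lt (max_lt hx hy)
      one_mem' := by simpa using hr
      inv_mem' := fun {x} hx => by simpa using hx
      isOpen' := by
        refine isOpen_lt ?_ continuous_const
        exact continuous_norm.comp (continuous_toAdd.comp (map_continuous e)) }
  refine ⟨V, fun h => ?_⟩
  rw [← QuotientGroup.mk_pow, QuotientGroup.eq_one_iff] at h
  have h : ‖(e (γ ^ p ^ k)).toAdd‖ < r := h
  rw [map_pow, toAdd_pow, nsmul_eq_mul, Nat.cast_pow] at h
  exact lt_irrefl _ h

end Quotients

/-! ### The Iwasawa algebra: locality, `T`-adic separation, regularity of `T`, the augmentation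
ideal. -/

section IwasawaAlgebraStructure

variable {p : ℕ} [Fact p.Prime] {Γ : Type} [CommGroup Γ] [TopologicalSpace Γ]

/-- The transition map between group rings of quotients. -/
abbrev transMap (p : ℕ) [Fact p.Prime] (U V : OpenSubgroup Γ) (h : (U : Subgroup Γ) ≤ V) :
    MonoidAlgebra ℤ_[p] (Γ ⧸ (U : Subgroup Γ)) →ₐ[ℤ_[p]]
      MonoidAlgebra ℤ_[p] (Γ ⧸ (V : Subgroup Γ)) :=
  MonoidAlgebra.mapDomainAlgHom ℤ_[p] ℤ_[p]
    (QuotientGroup.map (U : Subgroup Γ) (V : Subgroup Γ) (MonoidHom.id Γ) h)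

theorem groupAug_transMap (U V : OpenSubgroup Γ) (h : (U : Subgroup Γ) ≤ V)
    (x : MonoidAlgebra ℤ_[p] (Γ ⧸ (U : Subgroup Γ))) :
    groupAug p _ (transMap p U V h x) = groupAug p _ x := by
  suffices (groupAug p (Γ ⧸ (V : Subgroup Γ))).comp (transMap p U V h) =
      groupAug p (Γ ⧸ (U : Subgroup Γ)) from AlgHom.congr_fun this x
  apply MonoidAlgebra.algHom_ext
  · intro g
    simp [transMap, groupAug, MonoidAlgebra.mapDomainAlgHom]
  · exact Subsingleton.elim _ _

theorem groupAug_apply (x : IwasawaAlgebra p Γ) (U : OpenSubgroup Γ) :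
    groupAug p _ (x.1 U) = augmentation p Γ x := by
  have h := x.2 U ⊤ le_top
  change _ = groupAug p _ (x.1 ⊤)
  rw [← h, groupAug_transMap]

theorem transMap_of (U V : OpenSubgroup Γ) (h : (U : Subgroup Γ) ≤ V) (γ : Γ) :
    transMap p U V h (MonoidAlgebra.of ℤ_[p] _ (imageIn U γ)) =
      MonoidAlgebra.of ℤ_[p] _ (imageIn V γ) := by
  simp [transMap, MonoidAlgebra.mapDomainAlgHom]
  rfl

theorem varT_apply (γ : Γ) (U : OpenSubgroup Γ) :
    (varT p γ).1 U = MonoidAlgebra.of ℤ_[p] _ (imageIn U γ) - 1 := rfl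

theorem augmentation_varT (γ : Γ) : augmentation p Γ (varT p γ) = 0 := by
  rw [← groupAug_apply _ ⊤, varT_apply, map_sub, groupAug_of, map_one, sub_self]

/-- An element with unit augmentation is a unit at every finite level; inverses are unique, hence
compatible. Locality of `Λ(Γ)` is then inherited from `ℤ_[p]`. -/
theorem isLocalHom_augmentation [IsTopologicalGroup Γ]
    (hΓ : Nonempty (Γ ≃ₜ* Multiplicative ℤ_[p])) {γ : Γ}
    (hγ : Dense (Subgroup.zpowers γ : Set Γ)) : IsLocalHom (augmentation p Γ) := by
  refine ⟨fun x hx => ?_⟩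
  have hU : ∀ U : OpenSubgroup Γ, IsUnit (x.1 U) := fun U => by
    obtain ⟨m, hm⟩ := exists_pow_prime_pow_eq_one hΓ γ U
    have := finite_quotient hΓ hγ U
    exact isUnit_of_isUnit_groupAug hm (exists_pow_eq hΓ hγ U) _ (by rwa [groupAug_apply])
  choose y hy using fun U => (hU U).exists_right_inv
  refine IsUnit.of_mul_eq_one ⟨y, fun U V h => ?_⟩ (Subtype.ext (funext fun U => hy U))
  refine (hU V).mul_left_cancel ?_
  rw [hy, ← x.2 U V h, ← map_mul, hy, map_one]

theorem isLocalRing_iwasawaAlgebra [IsTopologicalGroup Γ]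
    (hΓ : Nonempty (Γ ≃ₜ* Multiplicative ℤ_[p])) {γ : Γ}
    (hγ : Dense (Subgroup.zpowers γ : Set Γ)) : IsLocalRing (IwasawaAlgebra p Γ) :=
  have := isLocalHom_augmentation hΓ hγ
  (augmentation p Γ).domain_isLocalRing

/-- At each finite level some power of `T` is divisible by `p`, so the component of `x` is divisible
by all powers of `p`. -/
theorem eq_zero_of_forall_varT_pow_dvd (hΓ : Nonempty (Γ ≃ₜ* Multiplicative ℤ_[p])) {γ : Γ}
    (x : IwasawaAlgebra p Γ)
    (h : ∀ n : ℕ, varT p γ ^ n ∣ x) : x = 0 := by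
  refine Subtype.ext (funext fun U => ?_)
  obtain ⟨m, hm⟩ := exists_pow_prime_pow_eq_one hΓ γ U
  obtain ⟨r, hr⟩ := exists_sub_one_pow_eq (p := p) hm
  refine eq_zero_of_forall_p_pow_dvd _ fun k => ?_
  obtain ⟨y, rfl⟩ := h (p ^ m * k)
  refine ⟨r ^ k * y.1 U, ?_⟩
  change (varT p γ).1 U ^ (p ^ m * k) * y.1 U = _
  rw [varT_apply, pow_mul, hr, mul_pow, mul_assoc]

/-- If `T * y = 0`, each component of `y` is invariant under the generator, hence has constant
coefficients, and the augmentation of `y` is that constant times the order of `Γ / U`. These orders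
are divisible by arbitrarily high powers of `p`, so the augmentation is `0`, and then so are the
constants. -/
theorem varT_mul_eq_zero [IsTopologicalGroup Γ]
    (hΓ : Nonempty (Γ ≃ₜ* Multiplicative ℤ_[p])) {γ : Γ}
    (hγ : Dense (Subgroup.zpowers γ : Set Γ)) (y : IwasawaAlgebra p Γ)
    (h : varT p γ * y = 0) : y = 0 := by
  have hconst : ∀ U : OpenSubgroup Γ, ∀ g, (y.1 U).coeff g = (y.1 U).coeff 1 := by
    intro U g
    obtain ⟨n, rfl⟩ := exists_pow_eq hΓ hγ U g
    have hU : MonoidAlgebra.of ℤ_[p] _ (imageIn U γ) * y.1 U = y.1 U := by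
      have := congrFun (congrArg Subtype.val h) U
      have : (MonoidAlgebra.of ℤ_[p] _ (imageIn U γ) - 1) * y.1 U = 0 := this
      rwa [sub_mul, one_mul, sub_eq_zero] at this
    induction n with
    | zero => rw [pow_zero]
    | succ n ih =>
      rw [← ih]
      conv_lhs => rw [← hU]
      rw [MonoidAlgebra.of_apply, MonoidAlgebra.coeff_single_mul_apply, one_mul, pow_succ']
      simp
  have haug : ∀ U : OpenSubgroup Γ,
      augmentation p Γ y = Nat.card (Γ ⧸ (U : Subgroup Γ)) * (y.1 U).coeff 1 := by
    intro U
    have := finite_quotient hΓ hγ U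
    have := Fintype.ofFinite (Γ ⧸ (U : Subgroup Γ))
    rw [← groupAug_apply y U]
    rw [MonoidAlgebra.lift_apply, Finsupp.sum_fintype _ _ (by simp)]
    simp [hconst]
  have h0 : augmentation p Γ y = 0 := by
    by_contra hne
    obtain ⟨n, hn⟩ := FiniteMultiplicity.of_prime_left (PadicInt.prime_p (p := p)) hne
    obtain ⟨U, hU⟩ := exists_pow_ne_one hΓ hγ n
    apply hn
    rw [haug U]
    refine Dvd.dvd.mul_right ?_ _
    rw [← Nat.cast_pow]
    refine Nat.cast_dvd_cast ?_
    obtain ⟨m, hm⟩ := exists_pow_prime_pow_eq_one hΓ γ U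
    obtain ⟨k, -, hk⟩ := (Nat.dvd_prime_pow Fact.out).1 (orderOf_dvd_of_pow_eq_one hm)
    refine dvd_trans ?_ (orderOf_dvd_natCard (imageIn U γ))
    rw [hk]
    refine pow_dvd_pow _ ?_
    by_contra hlt
    refine hU (orderOf_dvd_iff_pow_eq_one.1 ?_)
    rw [hk]
    exact pow_dvd_pow _ (by omega)
  refine Subtype.ext (funext fun U => MonoidAlgebra.coeff_injective (Finsupp.ext fun g => ?_))
  have := finite_quotient hΓ hγ U
  have h1 := haug U
  rw [h0, eq_comm, mul_eq_zero, Nat.cast_eq_zero] at h1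
  rw [hconst]
  exact h1.resolve_left Nat.card_pos.ne'

/-- Division by `T` is possible at each finite level but not unique, so compatible quotients have to
be chosen. The families solving the problem at all levels above a given one form a directed system
of nonempty closed subsets of a compact product of copies of `ℤ_[p]`, and a common point exists. -/
theorem varT_dvd_of_augmentation_eq_zero [IsTopologicalGroup Γ]
    (hΓ : Nonempty (Γ ≃ₜ* Multiplicative ℤ_[p])) {γ : Γ}
    (hγ : Dense (Subgroup.zpowers γ : Set Γ))
    (x : IwasawaAlgebra p Γ) (hx : augmentation p Γ x = 0) :
    varT p γ ∣ x := by
  have hfin := finite_quotient hΓ hγ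
  let E : ∀ U : OpenSubgroup Γ, (Γ ⧸ (U : Subgroup Γ) → ℤ_[p]) ≃ₗ[ℤ_[p]]
      MonoidAlgebra ℤ_[p] (Γ ⧸ (U : Subgroup Γ)) := fun U =>
    ((MonoidAlgebra.coeffLinearEquiv ℤ_[p]).trans
      (Finsupp.linearEquivFunOnFinite ℤ_[p] ℤ_[p] _)).symm
  let Z : OpenSubgroup Γ → Set (∀ U : OpenSubgroup Γ, Γ ⧸ (U : Subgroup Γ) → ℤ_[p]) := fun W =>
    {z | ∀ V : OpenSubgroup Γ, (W : Subgroup Γ) ≤ V →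
      (varT p γ).1 V * E V (z V) = x.1 V ∧
      ∀ (U : OpenSubgroup Γ) (h : (V : Subgroup Γ) ≤ U), transMap p V U h (E V (z V)) = E U (z U)}
  have hclosed : ∀ W, IsClosed (Z W) := by
    intro W
    simp only [Z, Set.ofPred_forall, Set.ofPred_and]
    refine isClosed_iInter fun V => isClosed_iInter fun hV => IsClosed.inter ?_
      (isClosed_iInter fun U => isClosed_iInter fun h => ?_)
    · have hc : Continuous fun z : ∀ U : OpenSubgroup Γ, Γ ⧸ (U : Subgroup Γ) → ℤ_[p] =>
          (E V).symm ((varT p γ).1 V * E V (z V)) :=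
        (LinearMap.continuous_on_pi ((E V).symm.toLinearMap ∘ₗ
          LinearMap.mulLeft ℤ_[p] ((varT p γ).1 V) ∘ₗ (E V).toLinearMap)).comp (continuous_apply V)
      have := isClosed_eq hc (continuous_const (y := (E V).symm (x.1 V)))
      simpa only [EmbeddingLike.apply_eq_iff_eq] using this
    · have hc : Continuous fun z : ∀ U : OpenSubgroup Γ, Γ ⧸ (U : Subgroup Γ) → ℤ_[p] =>
          (E U).symm (transMap p V U h (E V (z V))) :=
        (LinearMap.continuous_on_pi ((E U).symm.toLinearMap ∘ₗ
          (transMap p V U h).toLinearMap ∘ₗ (E V).toLinearMap)).comp (continuous_apply V)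
      have := isClosed_eq hc (continuous_apply U)
      simpa only [LinearEquiv.symm_apply_eq] using this
  have hne : ∀ W, (Z W).Nonempty := by
    classical
    intro W
    obtain ⟨y, hy⟩ := sub_one_dvd_of_groupAug_eq_zero (exists_pow_eq hΓ hγ W) (x.1 W)
      (by rw [groupAug_apply, hx])
    -- One quotient at level `W` is pushed forward to all `V` containing `W`; the other components
    -- do not matter for `Z W` and are set to `0`.
    refine ⟨fun V => if h : (W : Subgroup Γ) ≤ V then (E V).symm (transMap p W V h y) else 0,
      fun V hV => ⟨?_, fun U hU => ?_⟩⟩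
    · beta_reduce
      rw [dif_pos hV, LinearEquiv.apply_symm_apply, varT_apply, ← transMap_of W V hV,
        ← map_one (transMap p W V hV), ← map_sub, ← map_mul, ← hy]
      exact x.2 W V hV
    · beta_reduce
      rw [dif_pos hV, dif_pos (hV.trans hU), LinearEquiv.apply_symm_apply,
        LinearEquiv.apply_symm_apply]
      suffices (transMap p V U hU).comp (transMap p W V hV) = transMap p W U (hV.trans hU) from
        AlgHom.congr_fun this y
      apply MonoidAlgebra.algHom_ext
      · intro g
        obtain ⟨g, rfl⟩ := QuotientGroup.mk_surjective g
        change transMap p V U hU (transMap p W V hV (MonoidAlgebra.of ℤ_[p] _ (imageIn W g))) =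
          transMap p W U _ (MonoidAlgebra.of ℤ_[p] _ (imageIn W g))
        rw [transMap_of, transMap_of, transMap_of]
      · exact Subsingleton.elim _ _
  have hdir : Directed (fun s t => s ⊇ t) Z := by
    intro U V
    refine ⟨U ⊓ V, fun z hz W hW => hz W (le_trans inf_le_left hW),
      fun z hz W hW => hz W (le_trans inf_le_right hW)⟩
  obtain ⟨z, hz⟩ := IsCompact.nonempty_iInter_of_directed_nonempty_isCompact_isClosed Z hdir hne
    (fun W => (hclosed W).isCompact) hclosed
  rw [Set.mem_iInter] at hz
  refine ⟨⟨fun U => E U (z U), fun U V h => (hz U U le_rfl).2 V h⟩, Subtype.ext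
    (funext fun U => ?_)⟩
  exact ((hz U U le_rfl).1).symm

end IwasawaAlgebraStructure

/-! ### Order and leading coefficient at `T = 0`. -/

section LeadingTerms

variable {R k : Type} [CommRing R] [Field k]

/-- `ε` is reduction modulo the nonzerodivisor `T`, followed by the inclusion of `R / T` in its
field of fractions `k`, and `R` is `T`-adically separated. -/
structure IsReduction (T : R) (ε : R →+* k) : Prop where
  map_T : ε T = 0
  dvd : ∀ x, ε x = 0 → T ∣ x
  nzd : ∀ y, T * y = 0 → y = 0
  sep : ∀ x, (∀ n : ℕ, T ^ n ∣ x) → x = 0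
  frac : ∀ c : k, ∃ a b : R, ε b ≠ 0 ∧ ε b * c = ε a

variable {T : R} {ε : R →+* k}

theorem IsReduction.nontrivial (_ : IsReduction T ε) : Nontrivial R := ε.domain_nontrivial

theorem IsReduction.mul_left_cancel (h : IsReduction T ε) {x y : R} (hxy : T * x = T * y) :
    x = y :=
  sub_eq_zero.1 (h.nzd _ (by rw [mul_sub, hxy, sub_self]))

theorem IsReduction.pow_mul_left_cancel (h : IsReduction T ε) (n : ℕ) {x y : R}
    (hxy : T ^ n * x = T ^ n * y) : x = y := by
  induction n with
  | zero => simpa using hxy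
  | succ n ih => exact ih (h.mul_left_cancel (by rwa [← mul_assoc, ← mul_assoc, ← pow_succ']))

theorem IsReduction.exists_eq_pow_mul (h : IsReduction T ε) {x : R} (hx : x ≠ 0) :
    ∃ (m : ℕ) (y : R), x = T ^ m * y ∧ ε y ≠ 0 := by
  have hfin : FiniteMultiplicity T x := by
    by_contra hcon
    rw [FiniteMultiplicity.not_iff_forall] at hcon
    exact hx (h.sep x hcon)
  obtain ⟨y, hy, hT⟩ := hfin.exists_eq_pow_mul_and_not_dvd
  exact ⟨_, y, hy, fun h0 => hT (h.dvd y h0)⟩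

/-- Nonzero elements are `T ^ m * x` with `ε x ≠ 0`. In a vanishing product the powers of `T`
cancel, and `ε` of the rest is nonzero. -/
theorem IsReduction.isDomain (h : IsReduction T ε) : IsDomain R := by
  have := h.nontrivial
  have : NoZeroDivisors R := by
    refine ⟨fun {a b} hab => ?_⟩
    by_contra! hcon
    obtain ⟨m, x, rfl, hx⟩ := h.exists_eq_pow_mul hcon.1
    obtain ⟨n, y, rfl, hy⟩ := h.exists_eq_pow_mul hcon.2
    have h1 : x * y = 0 := h.pow_mul_left_cancel (m + n) (by rw [mul_zero, ← hab]; ring)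
    have h2 := congrArg ε h1
    rw [map_mul, map_zero] at h2
    exact (mul_ne_zero hx hy) h2
  exact NoZeroDivisors.to_isDomain R

theorem IsReduction.exponent_le (h : IsReduction T ε) {a b : ℕ} {u v : R} (hu : ε u ≠ 0)
    (huv : T ^ a * u = T ^ b * v) : b ≤ a := by
  by_contra! hlt
  obtain ⟨c, rfl⟩ := Nat.exists_eq_add_of_lt hlt
  have h1 : u = T * (T ^ c * v) := h.pow_mul_left_cancel a (by rw [huv]; ring)
  exact hu (by rw [h1, map_mul, h.map_T, zero_mul])

theorem IsReduction.exponent_unique (h : IsReduction T ε) {a b : ℕ} {u v : R} (hu : ε u ≠ 0)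
    (hv : ε v ≠ 0) (huv : T ^ a * u = T ^ b * v) : a = b ∧ u = v := by
  obtain rfl := le_antisymm (h.exponent_le hv huv.symm) (h.exponent_le hu huv)
  exact ⟨rfl, h.pow_mul_left_cancel a huv⟩

/-- `F = T^r G` with `G` defined and of value `c ≠ 0` at `T = 0`. -/
def HasLeading (T : R) (ε : R →+* k) (F : (FractionRing R)ˣ) (r : ℤ) (c : kˣ) : Prop :=
  ∃ (m n : ℕ) (x s : R), r = m - n ∧ ε x ≠ 0 ∧ ε s ≠ 0 ∧
    (F : FractionRing R) * algebraMap R (FractionRing R) (T ^ n * s) =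
      algebraMap R (FractionRing R) (T ^ m * x) ∧ (c : k) = ε x / ε s

theorem IsReduction.exists_hasLeading (h : IsReduction T ε) (F : (FractionRing R)ˣ) :
    ∃ r c, HasLeading T ε F r c := by
  have := h.isDomain
  obtain ⟨⟨a, b⟩, hab⟩ := IsLocalization.surj (nonZeroDivisors R) (F : FractionRing R)
  have hb : (b : R) ≠ 0 := nonZeroDivisors.ne_zero b.2
  have ha : a ≠ 0 := by
    rintro rfl
    rw [map_zero] at hab
    have := (mul_eq_zero.1 hab).resolve_left F.ne_zero
    exact hb ((IsFractionRing.to_map_eq_zero_iff).1 this)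
  obtain ⟨m, x, hx, hx0⟩ := h.exists_eq_pow_mul ha
  obtain ⟨n, s, hs, hs0⟩ := h.exists_eq_pow_mul hb
  refine ⟨m - n, Units.mk0 _ (div_ne_zero hx0 hs0), m, n, x, s, rfl, hx0, hs0, ?_, rfl⟩
  rw [← hx, ← hs, hab]

theorem HasLeading.unique (h : IsReduction T ε) {F : (FractionRing R)ˣ} {r r' : ℤ} {c c' : kˣ}
    (h1 : HasLeading T ε F r c) (h2 : HasLeading T ε F r' c') : r = r' ∧ c = c' := by
  obtain ⟨m, n, x, s, rfl, hx, hs, hF, hc⟩ := h1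
  obtain ⟨m', n', x', s', rfl, hx', hs', hF', hc'⟩ := h2
  have key : T ^ (m + n') * (x * s') = T ^ (m' + n) * (x' * s) := by
    apply IsFractionRing.injective R (FractionRing R)
    have e1 : T ^ (m + n') * (x * s') = (T ^ m * x) * (T ^ n' * s') := by ring
    have e2 : T ^ (m' + n) * (x' * s) = (T ^ m' * x') * (T ^ n * s) := by ring
    rw [e1, e2, map_mul _ (T ^ m * x), map_mul _ (T ^ m' * x'), ← hF, ← hF']
    ring
  obtain ⟨h1, h2⟩ := h.exponent_unique (by rw [map_mul]; exact mul_ne_zero hx hs')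
    (by rw [map_mul]; exact mul_ne_zero hx' hs) key
  refine ⟨by omega, Units.ext ?_⟩
  rw [hc, hc', div_eq_div_iff hs hs', ← map_mul, h2, map_mul]

theorem HasLeading.mul {F F' : (FractionRing R)ˣ} {r r' : ℤ} {c c' : kˣ}
    (h1 : HasLeading T ε F r c) (h2 : HasLeading T ε F' r' c') :
    HasLeading T ε (F * F') (r + r') (c * c') := by
  obtain ⟨m, n, x, s, rfl, hx, hs, hF, hc⟩ := h1
  obtain ⟨m', n', x', s', rfl, hx', hs', hF', hc'⟩ := h2
  refine ⟨m + m', n + n', x * x', s * s', by push_cast; ring,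
    by rw [map_mul]; exact mul_ne_zero hx hx', by rw [map_mul]; exact mul_ne_zero hs hs', ?_, ?_⟩
  · have e1 : T ^ (n + n') * (s * s') = (T ^ n * s) * (T ^ n' * s') := by ring
    have e2 : T ^ (m + m') * (x * x') = (T ^ m * x) * (T ^ m' * x') := by ring
    rw [e1, e2, map_mul _ (T ^ n * s), map_mul _ (T ^ m * x), ← hF, ← hF', Units.val_mul]
    ring
  · rw [Units.val_mul, hc, hc', map_mul, map_mul, div_mul_div_comm]

theorem IsReduction.exists_leadHom (h : IsReduction T ε) :
    ∃ (ord : (FractionRing R)ˣ → ℤ) (lead : (FractionRing R)ˣ →* kˣ),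
      ∀ F r c, HasLeading T ε F r c ↔ ord F = r ∧ lead F = c := by
  choose ord lead hl using h.exists_hasLeading
  refine ⟨ord, MonoidHom.mk' lead fun F F' => ?_, fun F r c => ⟨fun H => (hl F).unique h H, ?_⟩⟩
  · exact ((hl (F * F')).unique h ((hl F).mul (hl F'))).2
  · rintro ⟨rfl, rfl⟩
    exact hl F

end LeadingTerms

theorem isReduction_augmentationQ {p : ℕ} [Fact p.Prime] {Γ : Type} [CommGroup Γ]
    [TopologicalSpace Γ] [IsTopologicalGroup Γ] (hΓ : Nonempty (Γ ≃ₜ* Multiplicative ℤ_[p]))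
    {γ : Γ} (hγ : Dense (Subgroup.zpowers γ : Set Γ)) :
    IsReduction (varT p γ) (augmentationQ p Γ) where
  map_T := by rw [augmentationQ, RingHom.comp_apply, augmentation_varT, map_zero]
  dvd x hx := varT_dvd_of_augmentation_eq_zero hΓ hγ x
    ((map_eq_zero_iff _ (IsFractionRing.injective ℤ_[p] ℚ_[p])).1 hx)
  nzd := varT_mul_eq_zero hΓ hγ
  sep := eq_zero_of_forall_varT_pow_dvd hΓ
  frac c := by
    obtain ⟨⟨a, b⟩, hab⟩ := IsLocalization.surj (nonZeroDivisors ℤ_[p]) c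
    have haug : ∀ r : ℤ_[p],
        augmentationQ p Γ (algebraMap ℤ_[p] (IwasawaAlgebra p Γ) r) = algebraMap _ _ r :=
          fun r => by
      rw [augmentationQ, RingHom.comp_apply, ← groupAug_apply _ ⊤]
      congr 1
      exact AlgHom.commutes _ r
    refine ⟨algebraMap _ _ a, algebraMap _ _ (b : ℤ_[p]), ?_, ?_⟩
    · rw [haug]
      exact (map_ne_zero_iff _ (IsFractionRing.injective ℤ_[p] ℚ_[p])).2
        (nonZeroDivisors.ne_zero b.2)
    · rw [haug, haug, mul_comm, hab]

/-! ### Bases made of pairs of vectors in consecutive degrees. -/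

section Family

variable {R : Type} [CommRing R] {X : ℤ → ModuleCat.{0} R} {J : Type} {deg : J → ℤ}

/-- The indices of the vectors `x j`, `z j` of degree `i`. -/
abbrev FamIndex (deg : J → ℤ) (i : ℤ) : Type := {j // deg j = i} ⊕ {j // deg j + 1 = i}

/-- The vectors of degree `i` in a family of vectors `x j` of degree `deg j` and `z j` of degree
`deg j + 1`. -/
def fam (x : ∀ j, X (deg j)) (z : ∀ j, X (deg j + 1)) (i : ℤ) : FamIndex deg i → X i :=
  Sum.elim (fun j => j.2 ▸ x j.1) (fun j => j.2 ▸ z j.1)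

/-- The vectors of odd degree. -/
def oddVec (x : ∀ j, X (deg j)) (z : ∀ j, X (deg j + 1)) (j : J) : oddPart X :=
  if h : Odd (deg j) then inPart X (deg j) h (x j)
  else inPart X (deg j + 1) (even_add_one' _ (Int.not_odd_iff_even.1 h)) (z j)

/-- The vectors of even degree. -/
def evenVec (x : ∀ j, X (deg j)) (z : ∀ j, X (deg j + 1)) (j : J) : evenPart X :=
  if h : Odd (deg j) then inPart X (deg j + 1) (odd_add_one _ h) (z j)
  else inPart X (deg j) (Int.not_odd_iff_even.1 h) (x j)

/-- The indices of the vectors of odd degree. -/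
def oddIndexEquiv (deg : J → ℤ) : (Σ i : {i : ℤ // Odd i}, FamIndex deg i) ≃ J where
  toFun s := Sum.elim (fun j => j.1) (fun j => j.1) s.2
  invFun j :=
    if h : Odd (deg j) then ⟨⟨deg j, h⟩, Sum.inl ⟨j, rfl⟩⟩
    else ⟨⟨deg j + 1, even_add_one' _ (Int.not_odd_iff_even.1 h)⟩, Sum.inr ⟨j, rfl⟩⟩
  left_inv := by
    rintro ⟨⟨i, hi⟩, ⟨j, h⟩ | ⟨j, h⟩⟩
    · change deg j = i at h
      subst h
      simp [hi]
    · change deg j + 1 = i at h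
      subst h
      have : ¬ Odd (deg j) := fun h => by
        have := odd_add_one _ h
        exact Int.not_even_iff_odd.2 hi this
      simp [this]
  right_inv j := by
    beta_reduce
    by_cases h : Odd (deg j)
    · rw [dif_pos h]; rfl
    · rw [dif_neg h]; rfl

/-- The indices of the vectors of even degree. -/
def evenIndexEquiv (deg : J → ℤ) : (Σ i : {i : ℤ // Even i}, FamIndex deg i) ≃ J where
  toFun s := Sum.elim (fun j => j.1) (fun j => j.1) s.2
  invFun j :=
    if h : Odd (deg j) then ⟨⟨deg j + 1, odd_add_one _ h⟩, Sum.inr ⟨j, rfl⟩⟩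
    else ⟨⟨deg j, Int.not_odd_iff_even.1 h⟩, Sum.inl ⟨j, rfl⟩⟩
  left_inv := by
    rintro ⟨⟨i, hi⟩, ⟨j, h⟩ | ⟨j, h⟩⟩
    · change deg j = i at h
      subst h
      simp [Int.not_odd_iff_even.2 hi]
    · change deg j + 1 = i at h
      subst h
      have : Odd (deg j) := by
        by_contra h
        exact Int.not_odd_iff_even.2 hi (even_add_one' _ (Int.not_odd_iff_even.1 h))
      simp [this]
  right_inv j := by
    beta_reduce
    by_cases h : Odd (deg j)
    · rw [dif_pos h]; rfl
    · rw [dif_neg h]; rfl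

/-- Of the two vectors `x j`, `z j` exactly one has odd degree and one even degree. So the odd and
the even part both acquire bases indexed by `J`, which allows determinants on the two sides to be
compared. -/
theorem exists_oddBasis (x : ∀ j, X (deg j)) (z : ∀ j, X (deg j + 1))
    (b : ∀ i, Module.Basis (FamIndex deg i) R (X i)) (hb : ∀ i, ⇑(b i) = fam x z i) :
    ∃ e : Module.Basis J R (oddPart X), ⇑e = oddVec x z := by
  refine ⟨(DFinsupp.basis fun i : {i : ℤ // Odd i} => b i).reindex (oddIndexEquiv deg),
    funext fun j => ?_⟩
  rw [Module.Basis.reindex_apply]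
  by_cases h : Odd (deg j)
  · have : (oddIndexEquiv deg).symm j = ⟨⟨deg j, h⟩, Sum.inl ⟨j, rfl⟩⟩ := by
      simp [oddIndexEquiv, h]
    rw [this, partBasis_apply, oddVec, dif_pos h, hb]
    rfl
  · have : (oddIndexEquiv deg).symm j =
        ⟨⟨deg j + 1, even_add_one' _ (Int.not_odd_iff_even.1 h)⟩, Sum.inr ⟨j, rfl⟩⟩ := by
      simp [oddIndexEquiv, h]
    rw [this, partBasis_apply, oddVec, dif_neg h, hb]
    rfl

theorem exists_evenBasis (x : ∀ j, X (deg j)) (z : ∀ j, X (deg j + 1))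
    (b : ∀ i, Module.Basis (FamIndex deg i) R (X i)) (hb : ∀ i, ⇑(b i) = fam x z i) :
    ∃ e : Module.Basis J R (evenPart X), ⇑e = evenVec x z := by
  refine ⟨(DFinsupp.basis fun i : {i : ℤ // Even i} => b i).reindex (evenIndexEquiv deg),
    funext fun j => ?_⟩
  rw [Module.Basis.reindex_apply]
  by_cases h : Odd (deg j)
  · have : (evenIndexEquiv deg).symm j = ⟨⟨deg j + 1, odd_add_one _ h⟩, Sum.inr ⟨j, rfl⟩⟩ := by
      simp [evenIndexEquiv, h]
    rw [this, partBasis_apply, evenVec, dif_pos h, hb]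
    rfl
  · have : (evenIndexEquiv deg).symm j =
        ⟨⟨deg j, Int.not_odd_iff_even.1 h⟩, Sum.inl ⟨j, rfl⟩⟩ := by
      simp [evenIndexEquiv, h]
    rw [this, partBasis_apply, evenVec, dif_neg h, hb]
    rfl

theorem partToBC_oddVec {S : Type} [CommRing S] (f : R →+* S) (x : ∀ j, X (deg j))
    (z : ∀ j, X (deg j + 1)) (j : J) :
    partToBC f Odd (oddVec x z j) =
      oddVec (fun j => toBC f X _ (x j)) (fun j => toBC f X _ (z j)) j := by
  by_cases h : Odd (deg j)
  · rw [oddVec, dif_pos h, oddVec, dif_pos h, partToBC_inPart]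
  · rw [oddVec, dif_neg h, oddVec, dif_neg h, partToBC_inPart]

theorem partToBC_evenVec {S : Type} [CommRing S] (f : R →+* S) (x : ∀ j, X (deg j))
    (z : ∀ j, X (deg j + 1)) (j : J) :
    partToBC f Even (evenVec x z j) =
      evenVec (fun j => toBC f X _ (x j)) (fun j => toBC f X _ (z j)) j := by
  by_cases h : Odd (deg j)
  · rw [evenVec, dif_pos h, evenVec, dif_pos h, partToBC_inPart]
  · rw [evenVec, dif_neg h, evenVec, dif_neg h, partToBC_inPart]

theorem toBC_fam {S : Type} [CommRing S] (f : R →+* S) (x : ∀ j, X (deg j))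
    (z : ∀ j, X (deg j + 1)) (i : ℤ) (s : FamIndex deg i) :
    toBC f X i (fam x z i s) =
      fam (X := bcTerms f X) (fun j => toBC f X _ (x j)) (fun j => toBC f X _ (z j)) i s := by
  rcases s with ⟨j, rfl⟩ | ⟨j, rfl⟩ <;> rfl

theorem hom_ext_of_fam {x : ∀ j, X (deg j)} {z : ∀ j, X (deg j + 1)}
    {i : ℤ} (b : Module.Basis (FamIndex deg i) R (X i)) (hb : ⇑b = fam x z i)
    {N : Type} [AddCommGroup N] [Module R N] {f g : X i →ₗ[R] N}
    (h1 : ∀ j (h : deg j = i), f (h ▸ x j) = g (h ▸ x j))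
    (h2 : ∀ j (h : deg j + 1 = i), f (h ▸ z j) = g (h ▸ z j)) : f = g := by
  refine b.ext fun s => ?_
  rw [hb]
  rcases s with ⟨j, h⟩ | ⟨j, h⟩
  · exact h1 j h
  · exact h2 j h

end Family

/-! ### Values of trivializations for diagonal differentials. -/

section ElementaryContraction

variable {K : Type} [Field K] {X : ℤ → ModuleCat.{0} K} {J : Type} {deg : J → ℤ}

/-- A differential which is diagonal with respect to a basis of vectors `x j`, `z j` is
contractible, and `δ + σ` is diagonal as well. -/
theorem exists_contraction_of_fam {x : ∀ j, X (deg j)} {z : ∀ j, X (deg j + 1)}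
    (b : ∀ i, Module.Basis (FamIndex deg i) K (X i)) (hb : ∀ i, ⇑(b i) = fam x z i)
    {δ : GHom X X} (hsq : ∀ i j k : ℤ, i + 1 = j → j + 1 = k → ∀ x, δ j k (δ i j x) = 0)
    {c : J → K} (hc : ∀ j, c j ≠ 0) (hδ : ∀ j, δ (deg j) (deg j + 1) (x j) = c j • z j) :
    ∃ σ : GHom X X, IsContraction δ σ ∧ ∀ j, oddOp δ σ (oddVec x z j) =
      (if Odd (deg j) then c j else (c j)⁻¹) • evenVec x z j := by
  classical
  let σ : GHom X X := fun i k => (b i).constr K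
    (Sum.elim (fun _ => 0) fun j => if h : deg j.1 = k then (c j.1)⁻¹ • (h ▸ x j.1) else 0)
  have σx : ∀ j k, σ (deg j) k (x j) = 0 := by
    intro j k
    have : x j = b (deg j) (Sum.inl ⟨j, rfl⟩) := by rw [hb]; rfl
    rw [this]
    simp only [σ]
    rw [Module.Basis.constr_basis, Sum.elim_inl]
  have σz : ∀ j, σ (deg j + 1) (deg j) (z j) = (c j)⁻¹ • x j := by
    intro j
    have : z j = b (deg j + 1) (Sum.inr ⟨j, rfl⟩) := by rw [hb]; rfl
    rw [this]
    simp only [σ]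
    rw [Module.Basis.constr_basis, Sum.elim_inr, dif_pos rfl]
  have δz : ∀ j, z j = (c j)⁻¹ • δ (deg j) (deg j + 1) (x j) := fun j => by
    rw [hδ, smul_smul, inv_mul_cancel₀ (hc j), one_smul]
  have δδ : ∀ j, δ (deg j + 1) (deg j + 1 + 1) (z j) = 0 := fun j => by
    rw [δz, map_smul, hsq _ _ _ rfl rfl, smul_zero]
  refine ⟨σ, ⟨hsq, fun i j k hij hjk => ?_⟩, fun j => ?_⟩
  · refine LinearMap.congr_fun (f := δ i j ∘ₗ σ j i + σ k j ∘ₗ δ j k) (g := LinearMap.id) ?_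
    refine hom_ext_of_fam (b j) (hb j) (fun m hm => ?_) (fun m hm => ?_)
    · subst hm hjk
      simp [σx, hδ, σz, hc]
    · subst hm hjk
      obtain rfl : i = deg m := by omega
      simp [δδ, hδ, σz, hc]
  -- For odd `deg j` the odd vector is `x j`, sent by `δ` to `c j • z j`; for even `deg j` it is `z
  -- j`, sent by `σ` to `(c j)⁻¹ • x j`. This is the source of the signs of all exponents below.
  · by_cases h : Odd (deg j)
    · rw [oddVec, dif_pos h, evenVec, dif_pos h, if_pos h,
        oddOp_inPart δ σ (deg j - 1) (deg j) (deg j + 1) (by ring) rfl h (h.sub_odd odd_one)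
          (odd_add_one _ h), σx, map_zero, add_zero, hδ, map_smul]
    · have h' := Int.not_odd_iff_even.1 h
      rw [oddVec, dif_neg h, evenVec, dif_neg h, if_neg h,
        oddOp_inPart δ σ (deg j) (deg j + 1) (deg j + 1 + 1) rfl rfl (even_add_one' _ h') h'
          (odd_add_one _ (even_add_one' _ h')), δδ, map_zero, zero_add, σz, map_smul]

end ElementaryContraction

/-! ### Determinants of families of vectors under base change. -/

section BaseChangeDet

variable {R S : Type} [CommRing R] [CommRing S] {f : R →+* S} {M N : Type} [AddCommGroup M]
  [Module R M] [AddCommGroup N] [Module S N] {l : M →+ N} {J : Type} [Fintype J] [DecidableEq J]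

theorem det_baseChange (hl : ∀ r x, l (r • x) = f r • l x) (b : Module.Basis J R M)
    (b' : Module.Basis J S N) (hb : ∀ i, b' i = l (b i)) (v : J → M) :
    b'.det (fun j => l (v j)) = f (b.det v) := by
  rw [Module.Basis.det_apply, Module.Basis.det_apply, RingHom.map_det]
  congr 1
  have hrepr : ∀ x i, b'.repr (l x) i = f (b.repr x i) := by
    intro x i
    conv_lhs => rw [← b.sum_repr x, map_sum]
    simp only [hl, ← hb, map_sum, map_smul, Module.Basis.repr_self]
    simp [Finsupp.single_apply]
  ext i j
  simp [Module.Basis.toMatrix_apply, hrepr]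

/-- A basis of `M` induces a basis of the base change. -/
theorem IsFreeBaseChange.exists_basis_map {J : Type} [Nontrivial R] (hl : IsFreeBaseChange f l)
    (e : Module.Basis J R M) : ∃ e' : Module.Basis J S N, ∀ i, e' i = l (e i) := by
  obtain ⟨ι, _, b, b', hb⟩ := hl.exists_basis
  let E : ι ≃ J := b.indexEquiv e
  obtain ⟨φ', hφ'⟩ := hl.exists_equiv hl (b.equiv e E)
  refine ⟨(b'.reindex E).map φ', fun i => ?_⟩
  rw [Module.Basis.map_apply, Module.Basis.reindex_apply, hb, hφ', Module.Basis.equiv_apply,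
    Equiv.apply_symm_apply]

/-- If the base change has a basis indexed by `J`, then so does `M`. -/
theorem IsFreeBaseChange.exists_basis_index {J : Type} [Nontrivial S] (hl : IsFreeBaseChange f l)
    (e : Module.Basis J S N) : Nonempty (Module.Basis J R M) := by
  obtain ⟨ι, _, b, b', hb⟩ := hl.exists_basis
  exact ⟨b.reindex (b'.indexEquiv e)⟩

end BaseChangeDet

section ElementaryValue

variable {R K : Type} [CommRing R] [Nontrivial R] [Field K] {f : R →+* K}
  {X : ℤ → ModuleCat.{0} R} {J : Type} [Fintype J] [DecidableEq J] {deg : J → ℤ}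

/-- The value of a trivialization with respect to a differential which is diagonal on a basis. -/
theorem exists_isVal_of_fam (hX : IsFiniteFree X) {x : ∀ j, X (deg j)} {z : ∀ j, X (deg j + 1)}
    (b : ∀ i, Module.Basis (FamIndex deg i) K (bcTerms f X i))
    (hb : ∀ i s, b i s = toBC f X i (fam x z i s))
    {δ : GHom (bcTerms f X) (bcTerms f X)}
    (hsq : ∀ i j k : ℤ, i + 1 = j → j + 1 = k → ∀ x, δ j k (δ i j x) = 0)
    {c : J → K} (hc : ∀ j, c j ≠ 0)
    (hδ : ∀ j, δ (deg j) (deg j + 1) (toBC f X _ (x j)) = c j • toBC f X _ (z j))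
    (e : Module.Basis J R (oddPart X)) (u : Rˣ) (φ : oddPart X ≃ₗ[R] evenPart X)
    {a' : Triv (bcTerms f X)} (ha : IsBCTriv f (Triv.mk u φ) a') :
    ∃ F : Kˣ, IsVal δ a' F ∧ f (e.det (oddVec x z)) ≠ 0 ∧
      f ((e.map φ).det (evenVec x z)) ≠ 0 ∧
      F * ((∏ j, if Odd (deg j) then c j else (c j)⁻¹) *
        f ((e.map φ).det (evenVec x z))) = f u * f (e.det (oddVec x z)) := by
  classical
  have hb' : ∀ i, ⇑(b i) = fam (X := bcTerms f X) (fun j => toBC f X _ (x j))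
      (fun j => toBC f X _ (z j)) i := fun i => funext fun s => by rw [hb, toBC_fam]
  obtain ⟨σ, hσ, hdiag⟩ := exists_contraction_of_fam b hb' hsq hc hδ
  obtain ⟨ψ, hψ⟩ := hσ.exists_equiv (hX.baseChange f)
  obtain ⟨φ', hφ'⟩ := exists_equiv_bc hX f φ
  obtain rfl := ha.eq_mk hX rfl hφ'
  have hO := hX.isFreeBaseChange f Odd
  obtain ⟨eO, heO⟩ := exists_oddBasis _ _ b hb'
  obtain ⟨eE, heE⟩ := exists_evenBasis _ _ b hb'
  obtain ⟨e', he'⟩ := hO.exists_basis_map e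
  have hdO : e'.det eO = f (e.det (oddVec x z)) := by
    rw [← det_baseChange hO.smul e e' he']
    congr 1
    funext j
    rw [heO, partToBC_oddVec]
  have hmap : ∀ i, (e'.map φ') i = partToBC f Even ((e.map φ) i) := fun i => by
    rw [Module.Basis.map_apply, he', hφ', Module.Basis.map_apply]
  have hdE : (e'.map φ').det eE = f ((e.map φ).det (evenVec x z)) := by
    rw [← det_baseChange (hX.isFreeBaseChange f Even).smul (e.map φ) (e'.map φ') hmap]
    congr 1
    funext j
    rw [heE, partToBC_evenVec]
  refine ⟨Units.map (f : R →* K) u * LinearEquiv.det (φ'.trans ψ.symm),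
    ⟨σ, ψ, hσ, hψ, Triv.mk_eq_smul _ _ _⟩, ?_, ?_, ?_⟩
  · rw [← hdO]
    exact (e'.isUnit_det eO).ne_zero
  · rw [← hdE]
    exact ((e'.map φ').isUnit_det eE).ne_zero
  -- The even vectors are measured in the image of `e'` under `φ'`. Then `φ'⁻¹ψ` carries the odd
  -- vectors to the pulled-back even ones, up to the diagonal factors.
  · have h1 : LinearMap.det (φ'.symm.toLinearMap ∘ₗ ψ.toLinearMap) * e'.det eO =
        (∏ j, if Odd (deg j) then c j else (c j)⁻¹) * (e'.map φ').det eE := by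
      rw [← Module.Basis.det_comp, Module.Basis.det_map]
      have : (φ'.symm.toLinearMap ∘ₗ ψ.toLinearMap) ∘ eO =
          fun j => (if Odd (deg j) then c j else (c j)⁻¹) • (φ'.symm ∘ eE) j := by
        funext j
        simp only [Function.comp_apply, LinearMap.comp_apply]
        rw [hψ, heO, hdiag, heE]
        exact map_smul φ'.symm _ _
      rw [this, AlternatingMap.map_smul_univ, smul_eq_mul]
    have h2 : (LinearEquiv.det (φ'.trans ψ.symm) : K) *
        LinearMap.det (φ'.symm.toLinearMap ∘ₗ ψ.toLinearMap) = 1 := by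
      have h3 : (φ'.trans ψ.symm).toLinearMap ∘ₗ (φ'.symm.toLinearMap ∘ₗ ψ.toLinearMap) =
          LinearMap.id := LinearMap.ext fun y => by simp
      rw [LinearEquiv.coe_det, ← LinearMap.det_comp, h3, LinearMap.det_id]
    rw [← hdE, ← h1, hdO, Units.val_mul, Units.coe_map, MonoidHom.coe_coe]
    linear_combination f u * f (e.det (oddVec x z)) * h2

end ElementaryValue

/-! ### Cocycles and their classes. -/

section Represents

variable {R : Type} [CommRing R] {C : CochainComplex (ModuleCat.{0} R) ℤ} {i j : ℤ}

theorem Represents.d_eq_zero {c : C.X i} {h : C.homology i} (hc : Represents C i c h) (j : ℤ) :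
    (C.d i j).hom c = 0 := by
  obtain ⟨z, rfl, -⟩ := hc
  exact hom_congr_apply (C.iCycles_d i j) z

theorem exists_represents_of_d_eq_zero {c : C.X i} (hc : (C.d i (i + 1)).hom c = 0) :
    ∃ h, Represents C i c h := by
  let g : ModuleCat.of R R ⟶ C.X i := ModuleCat.ofHom (LinearMap.toSpanSingleton R _ c)
  have hg : g ≫ C.d i (i + 1) = 0 := by
    ext
    simpa [g] using hc
  refine ⟨_, (C.liftCycles g (i + 1) (by simp) hg).hom 1, ?_, rfl⟩
  exact (hom_congr_apply (C.liftCycles_i g (i + 1) (by simp) hg) (1 : R)).trans (one_smul R c)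

theorem exists_represents (h : C.homology i) : ∃ c, Represents C i c h := by
  obtain ⟨z, rfl⟩ := (ModuleCat.epi_iff_surjective (C.homologyπ i)).1 inferInstance h
  exact ⟨_, z, rfl, rfl⟩

theorem Represents.unique {c : C.X i} {h h' : C.homology i} (hc : Represents C i c h)
    (hc' : Represents C i c h') : h = h' := by
  obtain ⟨z, rfl, rfl⟩ := hc
  obtain ⟨z', hz, rfl⟩ := hc'
  rw [(ModuleCat.mono_iff_injective (C.iCycles i)).1 inferInstance hz]

theorem Represents.add {c c' : C.X i} {h h' : C.homology i} (hc : Represents C i c h)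
    (hc' : Represents C i c' h') : Represents C i (c + c') (h + h') := by
  obtain ⟨z, rfl, rfl⟩ := hc
  obtain ⟨z', rfl, rfl⟩ := hc'
  exact ⟨z + z', map_add _ _ _, map_add _ _ _⟩

theorem Represents.smul {c : C.X i} {h : C.homology i} (hc : Represents C i c h) (r : R) :
    Represents C i (r • c) (r • h) := by
  obtain ⟨z, rfl, rfl⟩ := hc
  exact ⟨r • z, map_smul _ _ _, map_smul _ _ _⟩

theorem Represents.zero : Represents C i 0 0 := ⟨0, map_zero _, map_zero _⟩

theorem Represents.neg {c : C.X i} {h : C.homology i} (hc : Represents C i c h) :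
    Represents C i (-c) (-h) := by
  simpa using hc.smul (-1)

theorem Represents.sub {c c' : C.X i} {h h' : C.homology i} (hc : Represents C i c h)
    (hc' : Represents C i c' h') : Represents C i (c - c') (h - h') := by
  simpa [sub_eq_add_neg] using hc.add hc'.neg

theorem represents_d (b : C.X i) : Represents C j ((C.d i j).hom b) 0 := by
  refine ⟨(C.toCycles i j).hom b, hom_congr_apply (C.toCycles_i i j) b, ?_⟩
  exact hom_congr_apply (C.toCycles_comp_homologyπ i j) b

theorem Represents.exists_eq_d (hij : i + 1 = j) {c : C.X j} (hc : Represents C j c 0) :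
    ∃ b, (C.d i j).hom b = c := by
  obtain ⟨z, rfl, hz⟩ := hc
  have hS : (ShortComplex.mk (C.toCycles i j) (C.homologyπ j)
      (C.toCycles_comp_homologyπ i j)).Exact :=
    ShortComplex.exact_of_g_is_cokernel _ (C.homologyIsCokernel i j (by simp [← hij]))
  obtain ⟨b, hb⟩ := (ShortComplex.moduleCat_exact_iff _).1 hS z hz
  refine ⟨b, ?_⟩
  change (C.toCycles i j).hom b = z at hb
  rw [← hb]
  exact (hom_congr_apply (C.toCycles_i i j) b).symm

end Represents

/-! ### Deformation retractions of a complex over a field onto its cohomology. -/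

section Retract

variable {k : Type} [Field k]

/-- Extending a section over the range gives `g` with `fgf = f`; replacing `g` by `gfg` gives the
second identity as well. -/
theorem exists_pseudoInverse {M N : Type*} [AddCommGroup M] [Module k M] [AddCommGroup N]
    [Module k N] (f : M →ₗ[k] N) :
    ∃ g : N →ₗ[k] M, (∀ x, f (g (f x)) = f x) ∧ ∀ y, g (f (g y)) = g y := by
  obtain ⟨s, hs⟩ := f.rangeRestrict.exists_rightInverse_of_surjective f.range_rangeRestrict
  obtain ⟨g, hg⟩ := s.exists_extend
  have h1 : ∀ x, f (g (f x)) = f x := fun x => by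
    have e1 : g (f x) = s (f.rangeRestrict x) := LinearMap.congr_fun hg (f.rangeRestrict x)
    have e2 := congrArg Subtype.val (LinearMap.congr_fun hs (f.rangeRestrict x))
    rw [e1]
    exact e2
  exact ⟨g ∘ₗ f ∘ₗ g, fun x => by simp [h1], fun y => by simp [h1]⟩

/-- A deformation retraction of a complex onto a graded subspace `ι : H → C`. -/
structure IsRetract (C : CochainComplex (ModuleCat.{0} k) ℤ) {H : ℤ → ModuleCat.{0} k}
    (ι : ∀ i, H i →ₗ[k] C.X i) (π : ∀ i, C.X i →ₗ[k] H i) (σ : GHom C.X C.X) : Prop where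
  π_ι : ∀ i h, π i (ι i h) = h
  d_ι : ∀ i j h, dFam C i j (ι i h) = 0
  π_d : ∀ i j x, i + 1 = j → π j (dFam C i j x) = 0
  σ_ι : ∀ i j h, i + 1 = j → σ j i (ι j h) = 0
  π_σ : ∀ i j x, i + 1 = j → π i (σ j i x) = 0
  σ_σ : ∀ i j l x, i + 1 = j → j + 1 = l → σ j i (σ l j x) = 0
  htpy : ∀ i j l x, i + 1 = j → j + 1 = l →
    dFam C i j (σ j i x) + σ l j (dFam C j l x) = x - ι j (π j x)

/-- A section of the cohomology can be completed to a deformation retraction. -/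
theorem exists_isRetract (C : CochainComplex (ModuleCat.{0} k) ℤ)
    (ι : ∀ i, C.homology i →ₗ[k] C.X i) (hι : ∀ i h, Represents C i (ι i h) h) :
    ∃ π σ, IsRetract C ι π σ ∧ ∀ i x h, Represents C i x h → π i x = h := by
  choose ρ hρ hρ' using fun j i : ℤ => exists_pseudoInverse (dFam C i j)
  -- As `dρd = d`, the map `1 - ρd` is a projection onto the cocycles; `π` takes the class of its
  -- value.
  let q : ∀ i, C.X i →ₗ[k] C.X i := fun i => LinearMap.id - ρ (i + 1) i ∘ₗ dFam C i (i + 1)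
  have hdq : ∀ i, ModuleCat.ofHom (q i) ≫ C.d i (i + 1) = 0 := fun i => by
    ext x
    change dFam C i (i + 1) (x - ρ (i + 1) i (dFam C i (i + 1) x)) = 0
    rw [map_sub, hρ, sub_self]
  let π : ∀ i, C.X i →ₗ[k] C.homology i := fun i =>
    (C.liftCycles (ModuleCat.ofHom (q i)) (i + 1) (by simp) (hdq i) ≫ C.homologyπ i).hom
  have hπ : ∀ i x, Represents C i (q i x) (π i x) := fun i x =>
    ⟨(C.liftCycles (ModuleCat.ofHom (q i)) (i + 1) (by simp) (hdq i)).hom x,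
      hom_congr_apply (C.liftCycles_i (ModuleCat.ofHom (q i)) (i + 1) (by simp) (hdq i)) x, rfl⟩
  have hq : ∀ i x, dFam C i (i + 1) x = 0 → q i x = x := fun i x hx => by
    simp [q, hx]
  have hπ' : ∀ i x h, Represents C i x h → π i x = h := fun i x h hx => by
    have h1 := hπ i x
    rw [hq i x (hx.d_eq_zero _)] at h1
    exact h1.unique hx
  have hd : ∀ i j h, dFam C i j (ι i h) = 0 := fun i j h => (hι i h).d_eq_zero j
  have πι : ∀ i h, π i (ι i h) = h := fun i h => hπ' i _ _ (hι i h)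
  have πd : ∀ i j x, i + 1 = j → π j (dFam C i j x) = 0 := fun i j x _ =>
    hπ' j _ _ (represents_d x)
  have πρ : ∀ i y, π i (ρ (i + 1) i y) = 0 := fun i y => by
    have h1 := hπ i (ρ (i + 1) i y)
    have h2 : q i (ρ (i + 1) i y) = 0 := by simp [q, hρ']
    rw [h2] at h1
    exact h1.unique Represents.zero
  -- `q - ιπ` takes values in the coboundaries, where `ρ` is a right inverse of `d`. The side
  -- conditions follow from `ρdρ = ρ`, which gives `qρ = 0` and `πρ = 0`.
  refine ⟨π, fun j i => ρ j i ∘ₗ (q j - ι j ∘ₗ π j), ⟨πι, hd, πd, ?_, ?_, ?_, ?_⟩, hπ'⟩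
  · rintro i _ h rfl
    simp [hq _ _ (hd _ _ h), πι]
  · rintro i _ x rfl
    simp [πρ]
  · rintro i _ _ x rfl rfl
    set y := (q (i + 1 + 1) - ι (i + 1 + 1) ∘ₗ π (i + 1 + 1)) x with hy
    have h2 : q (i + 1) (ρ (i + 1 + 1) (i + 1) y) = 0 := by simp [q, hρ']
    simp [← hy, πρ, h2]
  · rintro i _ _ x rfl rfl
    have h0 : Represents C (i + 1) (q (i + 1) x - ι (i + 1) (π (i + 1) x)) 0 := by
      simpa using (hπ (i + 1) x).sub (hι (i + 1) (π (i + 1) x))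
    obtain ⟨b, hb⟩ := h0.exists_eq_d rfl
    have h1 : dFam C i (i + 1) (ρ (i + 1) i (q (i + 1) x - ι (i + 1) (π (i + 1) x))) =
        q (i + 1) x - ι (i + 1) (π (i + 1) x) := by
      rw [← hb]
      exact hρ _ _ b
    have h2 : dFam C (i + 1 + 1) (i + 1 + 1 + 1) (dFam C (i + 1) (i + 1 + 1) x) = 0 :=
      dFam_sq _ _ _ _ _
    simp only [LinearMap.comp_apply, LinearMap.sub_apply, h1]
    rw [hq _ _ h2, πd _ _ _ rfl, map_zero, sub_zero]
    simp only [q, LinearMap.sub_apply, LinearMap.comp_apply, LinearMap.id_apply]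
    abel

end Retract

/-! ### Transfer of a differential on the cohomology to the complex. -/

section Perturbation

variable {k : Type} [Field k] {C H : CochainComplex (ModuleCat.{0} k) ℤ}

/-- The differential `d + ι β π` on `C`. -/
def perturbedD (C : CochainComplex (ModuleCat.{0} k) ℤ) {H : ℤ → ModuleCat.{0} k}
    (ι : ∀ i, H i →ₗ[k] C.X i) (π : ∀ i, C.X i →ₗ[k] H i) (β : GHom H H) : GHom C.X C.X :=
  fun i j => dFam C i j + ι j ∘ₗ β i j ∘ₗ π i

theorem perturbedD_apply {H : ℤ → ModuleCat.{0} k}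
    (ι : ∀ i, H i →ₗ[k] C.X i) (π : ∀ i, C.X i →ₗ[k] H i) (β : GHom H H) (i j : ℤ) (x : C.X i) :
    perturbedD C ι π β i j x = dFam C i j x + ι j (β i j (π i x)) := rfl

theorem IsRetract.perturbedD_sq {H : ℤ → ModuleCat.{0} k}
    {ι : ∀ i, H i →ₗ[k] C.X i} {π : ∀ i, C.X i →ₗ[k] H i} {σ : GHom C.X C.X}
    (h : IsRetract C ι π σ) {β : GHom H H}
    (hβ : ∀ i j l : ℤ, i + 1 = j → j + 1 = l → ∀ x, β j l (β i j x) = 0)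
    (i j l : ℤ) (hij : i + 1 = j) (hjl : j + 1 = l) (x : C.X i) :
    perturbedD C ι π β j l (perturbedD C ι π β i j x) = 0 := by
  simp only [perturbedD_apply, map_add, dFam_sq, h.d_ι, h.π_d _ _ _ hij, h.π_ι,
    hβ _ _ _ hij hjl, map_zero, add_zero]

/-- The perturbed complex is the sum of `ι H`, with differential `β` contracted by `s`, and of the
kernel of `π`, with differential `d` contracted by `σ`. -/
theorem IsRetract.isContraction_perturbedD {H : ℤ → ModuleCat.{0} k}
    {ι : ∀ i, H i →ₗ[k] C.X i} {π : ∀ i, C.X i →ₗ[k] H i} {σ : GHom C.X C.X}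
    (h : IsRetract C ι π σ) {β s : GHom H H} (hβ : IsContraction β s) :
    IsContraction (perturbedD C ι π β) fun j i => σ j i + ι i ∘ₗ s j i ∘ₗ π j where
  sq := h.perturbedD_sq hβ.sq
  htpy i j l hij hjl x := by
    have h1 := h.htpy i j l x hij hjl
    have h2 := congrArg (ι j) (hβ.htpy i j l hij hjl (π j x))
    rw [map_add] at h2
    simp only [perturbedD_apply, LinearMap.add_apply, LinearMap.comp_apply, map_add, h.d_ι,
      h.π_σ _ _ _ hij, h.π_d _ _ _ hjl, h.π_ι, h.σ_ι _ _ _ hjl, map_zero, add_zero, zero_add]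
    rw [add_add_add_comm, h1, h2, sub_add_cancel]

theorem cone_apply_decomp {R : Type} [CommRing R] {C H : CochainComplex (ModuleCat.{0} R) ℤ}
    (f : H ⟶ C) (i j : ℤ) (hij : i + 1 = j) (y : (CochainComplex.mappingCone f).X i) :
    ∃ (v : C.X i) (h : H.X j), y = ((CochainComplex.mappingCone.inr f).f i).hom v +
      ((CochainComplex.mappingCone.inl f).v j i (by omega)).hom h := by
  subst hij
  exact ⟨_, _, ((isSplitExact_mappingCone f).decomp i y).symm⟩

/-- The differential of the cone of a section `f` of the cohomology can be perturbed so that it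
induces the differentials `d + f β π` and `β`, without changing a contraction of square zero. -/
theorem exists_cone_perturbation (f : H ⟶ C) (hH : ∀ i j, dFam H i j = 0)
    {π : ∀ i, C.X i →ₗ[k] H.X i} {σ : GHom C.X C.X}
    (h : IsRetract C (fun i => (f.f i).hom) π σ) {β : GHom H.X H.X}
    (hβ : ∀ i j l : ℤ, i + 1 = j → j + 1 = l → ∀ x, β j l (β i j x) = 0) :
    ∃ t δ : GHom (CochainComplex.mappingCone f).X (CochainComplex.mappingCone f).X,
      IsContraction (dFam (CochainComplex.mappingCone f)) t ∧ IsContraction δ t ∧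
      (∀ i j l : ℤ, i + 1 = j → j + 1 = l → ∀ y, t j i (t l j y) = 0) ∧
      (∀ i l : ℤ, i + 1 = l → ∀ x, δ i l (((CochainComplex.mappingCone.inr f).f i).hom x) =
        ((CochainComplex.mappingCone.inr f).f l).hom
          (perturbedD C (fun i => (f.f i).hom) π β i l x)) ∧
      ∀ i l : ℤ, i + 1 = l → ∀ y,
        shiftNeg β i l (((CochainComplex.mappingCone.fst f).1.v i (i + 1) rfl).hom y) =
          ((CochainComplex.mappingCone.fst f).1.v l (l + 1) rfl).hom (δ i l y) := by
  classical
  have H' := isSplitExact_mappingCone f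
  let dc := dFam (CochainComplex.mappingCone f)
  let inr : ∀ i, C.X i →ₗ[k] (CochainComplex.mappingCone f).X i := fun i =>
    ((CochainComplex.mappingCone.inr f).f i).hom
  let inl : ∀ i j (_ : i + 1 = j), H.X j →ₗ[k] (CochainComplex.mappingCone f).X i := fun i j hij =>
    ((CochainComplex.mappingCone.inl f).v j i (by omega)).hom
  let snd : ∀ i, (CochainComplex.mappingCone f).X i →ₗ[k] C.X i := fun i =>
    ((CochainComplex.mappingCone.snd f).v i i (add_zero i)).hom
  let fst : ∀ i j (_ : i + 1 = j), (CochainComplex.mappingCone f).X i →ₗ[k] H.X j := fun i j hij =>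
    ((CochainComplex.mappingCone.fst f).1.v i j hij).hom
  have snd_inr : ∀ i x, snd i (inr i x) = x := fun i x => H'.retr i x
  have fst_inr : ∀ i j hij x, fst i j hij (inr i x) = 0 := fun i j hij x =>
    hom_congr_apply (CochainComplex.mappingCone.inr_f_fst_v f i j hij) x
  have snd_inl : ∀ i j hij x, snd i (inl i j hij x) = 0 := fun i j hij x =>
    hom_congr_apply (CochainComplex.mappingCone.inl_v_snd_v f j i (by omega)) x
  have fst_inl : ∀ i j hij x, fst i j hij (inl i j hij x) = x := fun i j hij x =>
    hom_congr_apply (CochainComplex.mappingCone.inl_v_fst_v f j i hij) x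
  have d_inr : ∀ i j x, dc i j (inr i x) = inr j (dFam C i j x) :=
    fun i j x => dFam_mappingCone_inr f i j x
  have d_inl : ∀ i j hij x, dc i j (inl i j hij x) =
      inr j ((f.f j).hom x) := fun i j hij x => by
    have e1 := hom_congr_apply
      (CochainComplex.mappingCone.inl_v_d f j i (j + 1) (by omega) (by omega)) x
    have e2 : (H.d j (j + 1)).hom x = 0 := LinearMap.congr_fun (hH j (j + 1)) x
    refine e1.trans ?_
    change inr j ((f.f j).hom x) - inl j (j + 1) rfl ((H.d j (j + 1)).hom x) = _
    rw [e2, map_zero, sub_zero]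
  -- The perturbation is `fβπ` on `C` and `-β` on the shifted `H`, in accordance with `shiftNeg`.
  let n : GHom (CochainComplex.mappingCone f).X (CochainComplex.mappingCone f).X := fun i j =>
    inr j ∘ₗ (f.f j).hom ∘ₗ β i j ∘ₗ π i ∘ₗ snd i -
      inl j (j + 1) rfl ∘ₗ β (i + 1) (j + 1) ∘ₗ fst i (i + 1) rfl
  -- The contraction `t` returns from `C` to the shifted `H` by `π`, contracts the rest of `C` by
  -- `σ`, and vanishes on the shifted `H`.
  let t : GHom (CochainComplex.mappingCone f).X (CochainComplex.mappingCone f).X := fun j i =>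
    if hij : i + 1 = j then inl i j hij ∘ₗ π j ∘ₗ snd j + inr i ∘ₗ σ j i ∘ₗ snd j else 0
  have n_inr : ∀ i j x, n i j (inr i x) = inr j ((f.f j).hom (β i j (π i x))) := fun i j x => by
    simp [n, snd_inr, fst_inr]
  have n_inl : ∀ i j l hij hjl x, n i j (inl i j hij x) = -inl j l hjl (β j l x) := by
    rintro i _ _ rfl rfl x
    simp [n, snd_inl, fst_inl]
  have t_inr : ∀ i j hij x, t j i (inr j x) = inl i j hij (π j x) + inr i (σ j i x) := by
    rintro i _ rfl x
    simp [t, snd_inr]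
  have t_inl : ∀ i j l hjl x, i + 1 = j → t j i (inl j l hjl x) = 0 := by
    rintro i _ l hjl x rfl
    simp [t, snd_inl]
  have hτ : IsContraction (dc) t := by
    refine ⟨fun i j l _ _ x => dFam_sq _ _ _ _ _, fun i j l hij hjl y => ?_⟩
    obtain ⟨v, x, rfl⟩ := cone_apply_decomp f j l hjl y
    change dc i j (t j i (inr j v + inl j l hjl x)) + t l j (dc j l (inr j v + inl j l hjl x))
      = inr j v + inl j l hjl x
    have e := congrArg (inr j) (h.htpy i j l v hij hjl)
    rw [map_add, map_sub] at e
    simp only [map_add, t_inr _ _ hij, t_inr _ _ hjl, t_inl _ _ _ hjl _ hij, d_inr, d_inl, h.π_ι,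
      h.σ_ι _ _ _ hjl, h.π_d _ _ _ hjl, map_zero, add_zero, zero_add]
    rw [← sub_eq_zero, ← sub_eq_zero.2 e]
    abel
  -- In effect `nt + tn = 0`: on `C` the contributions `-βπ` and `πfβπ = βπ` cancel, and on the
  -- shifted `H` both terms vanish.
  have hτ' : IsContraction (fun i j => dc i j + n i j) t := by
    refine ⟨fun i j l hij hjl y => ?_, fun i j l hij hjl y => ?_⟩
    · obtain ⟨v, x, rfl⟩ := cone_apply_decomp f i j hij y
      change (dc j l + n j l) ((dc i j + n i j) (inr i v + inl i j hij x)) = 0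
      simp only [map_add, LinearMap.add_apply, d_inr, d_inl, n_inr, n_inl _ _ _ hij hjl,
        n_inl _ _ _ hjl rfl, map_neg, dFam_sq, h.d_ι, h.π_d _ _ _ hij, h.π_ι, hβ _ _ _ hij hjl,
        hβ _ _ _ hjl rfl, map_zero, add_zero, zero_add, neg_zero]
      abel
    · obtain ⟨v, x, rfl⟩ := cone_apply_decomp f j l hjl y
      change (dc i j + n i j) (t j i (inr j v + inl j l hjl x)) +
        t l j ((dc j l + n j l) (inr j v + inl j l hjl x)) = inr j v + inl j l hjl x
      have e := congrArg (inr j) (h.htpy i j l v hij hjl)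
      rw [map_add, map_sub] at e
      simp only [map_add, LinearMap.add_apply, t_inr _ _ hij, t_inr _ _ hjl, t_inl _ _ _ hjl _ hij,
        t_inl _ _ _ rfl _ hjl, n_inr, n_inl _ _ _ hij hjl, n_inl _ _ _ hjl rfl, d_inr, d_inl,
        h.π_ι, h.σ_ι _ _ _ hjl, h.π_d _ _ _ hjl, h.π_σ _ _ _ hij, map_zero, add_zero, zero_add,
        map_neg, neg_zero]
      rw [← sub_eq_zero, ← sub_eq_zero.2 e]
      abel
  have htsq : ∀ i j l : ℤ, i + 1 = j → j + 1 = l → ∀ y, t j i (t l j y) = 0 := by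
    intro i j l hij hjl y
    obtain ⟨v, x, rfl⟩ := cone_apply_decomp f l (l + 1) rfl y
    change t j i (t l j (inr l v + inl l (l + 1) rfl x)) = 0
    simp only [map_add, t_inr _ _ hjl, t_inl _ _ _ rfl _ hjl, t_inl _ _ _ hjl _ hij,
      t_inr _ _ hij, h.π_σ _ _ _ hjl, h.σ_σ _ _ _ _ hij hjl, map_zero, add_zero]
  refine ⟨t, fun i j => dc i j + n i j, hτ, hτ', htsq, ?_, ?_⟩
  · intro i l hil x
    change (dc i l + n i l) (inr i x) = inr l (perturbedD C (fun i => (f.f i).hom) π β i l x)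
    rw [LinearMap.add_apply, d_inr, n_inr, perturbedD_apply, map_add]
  · rintro i _ rfl y
    obtain ⟨v, x, rfl⟩ := cone_apply_decomp f i _ rfl y
    change -β (i + 1) (i + 1 + 1) (fst i (i + 1) rfl (inr i v + inl i (i + 1) rfl x)) =
      fst (i + 1) (i + 1 + 1) rfl ((dc i (i + 1) + n i (i + 1)) (inr i v + inl i (i + 1) rfl x))
    simp only [map_add, LinearMap.add_apply, d_inr, d_inl, n_inr, n_inl _ _ _ rfl rfl, fst_inr,
      fst_inl, map_neg, zero_add, add_zero]

/-- If `f` is a section of the cohomology and `bH` is the canonical trivialization of the acyclic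
complex `(H, β)`, then `d(f) ∘ bH` is the canonical trivialization of `(C, d + f β π)`. -/
theorem isVal_of_isDetComp (f : H ⟶ C) (hH : ∀ i j, dFam H i j = 0) (hC : IsFiniteFree C.X)
    (hHF : IsFiniteFree H.X) {π : ∀ i, C.X i →ₗ[k] H.X i} {σ : GHom C.X C.X}
    (h : IsRetract C (fun i => (f.f i).hom) π σ) {β : GHom H.X H.X} {bH : Triv H.X} {b : Triv C.X}
    (hb : IsDetComp f bH b) (hbH : IsVal β bH 1) :
    IsVal (perturbedD C (fun i => (f.f i).hom) π β) b 1 := by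
  obtain ⟨bc, hbc, hp⟩ := hb
  rw [isAcyclicTriv_iff] at hbc
  obtain ⟨s, -, hs, -, -⟩ := id hbH
  obtain ⟨F, hF⟩ := (h.isContraction_perturbedD hs).exists_isVal hC b
  have H' := isSplitExact_mappingCone f
  have hX := H'.isFiniteFree hC hHF.shift
  obtain ⟨t, δ, ht, ht', hsq, h1, h2⟩ := exists_cone_perturbation f hH h hs.sq
  -- The cone has value `1` by invariance under the perturbation, and value `F * 1⁻¹` by
  -- multiplicativity along `C → cone(f) → H[1]`.
  have h3 := (IsVal.perturb hX ht ht' hsq hbc).unique hX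
    (IsVal.product hX H' h1 h2 ht'.sq hp hF (hbH.inv hHF))
  rw [inv_one, mul_one] at h3
  rwa [← h3] at hF

end Perturbation

/-! ### Existence of the composite `d(f) ∘ a`. -/

section Existence

variable {R : Type} [CommRing R]

theorem IsSplitExact.exists_equiv {X' X X'' : ℤ → ModuleCat.{0} R}
    {f : ∀ i, X' i ⟶ X i} {g : ∀ i, X i ⟶ X'' i} {r : ∀ i, X i ⟶ X' i}
    {j : ∀ i, X'' i ⟶ X i} (h : IsSplitExact f g r j) (φ' : oddPart X' ≃ₗ[R] evenPart X')
    (φ'' : oddPart X'' ≃ₗ[R] evenPart X'') : ∃ φ : oddPart X ≃ₗ[R] evenPart X,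
      (∀ x, φ (oddMap f x) = evenMap f (φ' x)) ∧ ∀ x, evenMap g (φ x) = φ'' (oddMap g x) := by
  have rj : ∀ i x, (r i).hom ((j i).hom x) = 0 := by
    intro i x
    have h1 := congrArg (r i).hom (h.decomp i ((j i).hom x))
    rw [h.sect, map_add, h.retr, add_eq_right] at h1
    exact h1
  have o1 : ∀ x, oddMap r (oddMap f x) = x := fun x => by
    induction x using part_induction with
    | h0 => simp
    | h i hi x => rw [oddMap_inPart, oddMap_inPart, h.retr]
    | ha x y hx hy => simp only [map_add, hx, hy]
  have o2 : ∀ x, oddMap g (oddMap j x) = x := fun x => by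
    induction x using part_induction with
    | h0 => simp
    | h i hi x => rw [oddMap_inPart, oddMap_inPart, h.sect]
    | ha x y hx hy => simp only [map_add, hx, hy]
  have o3 : ∀ x, oddMap r (oddMap j x) = 0 := fun x => by
    induction x using part_induction with
    | h0 => simp
    | h i hi x => rw [oddMap_inPart, oddMap_inPart, rj, map_zero]
    | ha x y hx hy => simp only [map_add, hx, hy, add_zero]
  have e1 : ∀ x, evenMap r (evenMap f x) = x := fun x => by
    induction x using part_induction with
    | h0 => simp
    | h i hi x => rw [evenMap_inPart, evenMap_inPart, h.retr]
    | ha x y hx hy => simp only [map_add, hx, hy]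
  have e2 : ∀ x, evenMap g (evenMap j x) = x := fun x => by
    induction x using part_induction with
    | h0 => simp
    | h i hi x => rw [evenMap_inPart, evenMap_inPart, h.sect]
    | ha x y hx hy => simp only [map_add, hx, hy]
  have e3 : ∀ x, evenMap r (evenMap j x) = 0 := fun x => by
    induction x using part_induction with
    | h0 => simp
    | h i hi x => rw [evenMap_inPart, evenMap_inPart, rj, map_zero]
    | ha x y hx hy => simp only [map_add, hx, hy, add_zero]
  have e4 : ∀ x, evenMap g (evenMap f x) = 0 := fun x => by
    induction x using part_induction with
    | h0 => simp
    | h i hi x => rw [evenMap_inPart, evenMap_inPart, h.zero, map_zero]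
    | ha x y hx hy => simp only [map_add, hx, hy, add_zero]
  have e5 : ∀ x, evenMap f (evenMap r x) + evenMap j (evenMap g x) = x := fun x => by
    induction x using part_induction with
    | h0 => simp
    | h i hi x => rw [evenMap_inPart, evenMap_inPart, evenMap_inPart, evenMap_inPart, ← map_add,
        h.decomp]
    | ha x y hx hy =>
      simp only [map_add]
      rw [add_add_add_comm, hx, hy]
  refine ⟨LinearEquiv.ofLinearMap
    (evenMap f ∘ₗ φ'.toLinearMap ∘ₗ oddMap r + evenMap j ∘ₗ φ''.toLinearMap ∘ₗ oddMap g)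
    (oddMap f ∘ₗ φ'.symm.toLinearMap ∘ₗ evenMap r + oddMap j ∘ₗ φ''.symm.toLinearMap ∘ₗ evenMap g)
    (LinearMap.ext fun x => ?_) (LinearMap.ext fun x => ?_), fun x => ?_, fun x => ?_⟩
  · simp [o1, o2, o3, h.oddMap_zero, e5]
  · simp [e1, e2, e3, e4, h.oddMap_decomp]
  · simp [o1, h.oddMap_zero]
  · simp [e4, e2]

/-- The trivialization `a₀` only supplies some isomorphism between the parts of `C'`; the unit is
then adjusted so that the product with `a.inv` is the canonical trivialization of the cone. -/
theorem exists_isDetComp {C C' : CochainComplex (ModuleCat.{0} R) ℤ} (hC : IsFiniteFree C.X)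
    (hC' : IsFiniteFree C'.X) (f : C ⟶ C') {t} (ht : IsContraction
    (dFam (CochainComplex.mappingCone f)) t)
    (a : Triv C.X) (a₀ : Triv C'.X) : ∃ a', IsDetComp f a a' := by
  have H := isSplitExact_mappingCone f
  have hX := H.isFiniteFree hC' hC.shift
  obtain ⟨ψ, hψ⟩ := ht.exists_equiv hX
  obtain ⟨-, φ', -⟩ := a₀.exists_mk
  obtain ⟨u'', φ'', ha⟩ := a.inv.exists_mk
  obtain ⟨φ, h1, h2⟩ := H.exists_equiv φ' φ''
  obtain ⟨w, hw⟩ := (Triv.mk 1 ψ).exists_eq_smul (Triv.mk 1 φ)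
  refine ⟨Triv.mk (w * u''⁻¹) φ', Triv.mk 1 ψ, ?_, w * u''⁻¹, u'', φ', φ, φ'', rfl, ha, ?_, h1, h2⟩
  · rw [isAcyclicTriv_iff]
    exact ⟨t, ψ, ht, hψ, (Triv.one_smul _).symm⟩
  · rw [hw, inv_mul_cancel_right, Triv.smul_mk, mul_one]

end Existence

/-! ### Lifting along the reduction modulo `T`. -/

section Reduction

variable {R S k : Type} [CommRing R] [CommRing S] [Field k] {X : ℤ → ModuleCat.{0} R}

theorem exists_eq_smul_of_toBC_eq_zero (hX : IsFiniteFree X) {T : R} {f : R →+* S}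
    (hf : ∀ x, f x = 0 → T ∣ x) {i : ℤ} {x : X i} (hx : toBC f X i x = 0) : ∃ y, x = T • y := by
  have := hX.free i
  have := hX.finite i
  let b := Module.Free.chooseBasis R (X i)
  obtain ⟨b', hb'⟩ := exists_basis_toBC f X i b
  have h1 : ∑ l, f (b.repr x l) • b' l = 0 := by
    rw [← hx]
    conv_rhs => rw [← b.sum_repr x, map_sum]
    simp only [toBC_smul, hb']
  have h2 := Fintype.linearIndependent_iff.1 b'.linearIndependent _ h1
  choose c hc using fun l => hf _ (h2 l)
  refine ⟨∑ l, c l • b l, ?_⟩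
  conv_lhs => rw [← b.sum_repr x]
  rw [Finset.smul_sum]
  exact Finset.sum_congr rfl fun l _ => by rw [hc, mul_smul]

theorem toBC_surjective (hX : IsFiniteFree X) {f : R →+* S} (hf : Function.Surjective f) (i : ℤ) :
    Function.Surjective (toBC f X i) := by
  have := hX.free i
  obtain ⟨b', hb'⟩ := exists_basis_toBC f X i (Module.Free.chooseBasis R (X i))
  intro v
  induction b'.mem_span v using Submodule.span_induction with
  | mem x hx =>
    obtain ⟨l, rfl⟩ := hx
    exact ⟨_, (hb' l).symm⟩
  | zero => exact ⟨0, map_zero _⟩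
  | add x y _ _ hx hy =>
    obtain ⟨a, rfl⟩ := hx
    obtain ⟨b, rfl⟩ := hy
    exact ⟨a + b, map_add _ _ _⟩
  | smul c x _ hx =>
    obtain ⟨a, rfl⟩ := hx
    obtain ⟨r, rfl⟩ := hf c
    exact ⟨r • a, toBC_smul _ _ _ _ _⟩

variable {T : R} {ε : R →+* k}

/-- Since `ε` need not be onto `k`, vectors lift only up to a denominator not divisible by `T`. This
forces the denominators in `IsBockstein`. -/
theorem IsReduction.exists_smul_eq_toBC (h : IsReduction T ε) (hX : IsFiniteFree X) {i : ℤ}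
    (v : bcTerms ε X i) : ∃ (r : R) (x : X i), ε r ≠ 0 ∧ toBC ε X i x = ε r • v := by
  have := hX.free i
  obtain ⟨b', hb'⟩ := exists_basis_toBC ε X i (Module.Free.chooseBasis R (X i))
  induction b'.mem_span v using Submodule.span_induction with
  | mem x hx =>
    obtain ⟨l, rfl⟩ := hx
    exact ⟨1, _, by simp, by rw [ε.map_one, one_smul, hb']⟩
  | zero => exact ⟨1, 0, by simp, by simp⟩
  | add x y _ _ hx hy =>
    obtain ⟨r, a, hr, ha⟩ := hx
    obtain ⟨s, b, hs, hb⟩ := hy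
    refine ⟨r * s, s • a + r • b, by simp [hr, hs], ?_⟩
    rw [map_add, toBC_smul, toBC_smul, ha, hb, smul_smul, smul_smul, smul_add, map_mul,
      mul_comm (ε s)]
  | smul c x _ hx =>
    obtain ⟨r, a, hr, ha⟩ := hx
    obtain ⟨m, n, hn, hmn⟩ := h.frac c
    refine ⟨n * r, m • a, by simp [hr, hn], ?_⟩
    rw [toBC_smul, ha, smul_smul, smul_smul, ← hmn, map_mul]
    congr 1
    ring

theorem IsReduction.smul_eq_zero (h : IsReduction T ε) (hX : IsFiniteFree X) {i : ℤ} {x : X i}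
    (hx : T • x = 0) : x = 0 := by
  have := hX.free i
  let b := Module.Free.chooseBasis R (X i)
  apply b.repr.injective
  ext l
  rw [map_zero, Finsupp.zero_apply]
  apply h.nzd
  have := congrArg (fun y => b.repr y l) hx
  simpa using this

end Reduction

/-! ### Bockstein morphisms over `k`: existence, lifts and exactness. -/

section Bockstein

variable {R S k : Type} [CommRing R] [CommRing S] [Field k] {T : R} {ε : R →+* k}
  {A : CochainComplex (ModuleCat.{0} R) ℤ}

theorem baseChange_d (f : R →+* S) (i j : ℤ) (x : A.X i) :
    ((baseChange f A).d i j).hom (toBaseChange f A i x) =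
      toBaseChange f A j ((A.d i j).hom x) := bcHom_toBC f A.X (dFam A) i j x

theorem toBaseChange_smul (f : R →+* S) (i : ℤ) (r : R) (x : A.X i) :
    toBaseChange f A i (r • x) = f r • toBaseChange f A i x := toBC_smul f A.X i r x

theorem d_d (C : CochainComplex (ModuleCat.{0} R) ℤ) (i j l : ℤ) (x : C.X i) :
    (C.d j l).hom ((C.d i j).hom x) = 0 := dFam_sq C i j l x

theorem IsReduction.toBaseChange_smul (h : IsReduction T ε) (i : ℤ) (x : A.X i) :
    toBaseChange ε A i (T • x) = 0 := by
  rw [IwasawaLeadingTerm.toBaseChange_smul, h.map_T, zero_smul]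

theorem exists_d_add_smul (hA : IsFiniteFree A.X) {f : R →+* S}
    (hf : ∀ x, f x = 0 → T ∣ x) {i : ℤ} {x : A.X i}
    (hx : ((baseChange f A).d i (i + 1)).hom (toBaseChange f A i x) = 0) :
    ∃ y, (A.d i (i + 1)).hom x + T • y = 0 := by
  rw [baseChange_d] at hx
  obtain ⟨y, hy⟩ := exists_eq_smul_of_toBC_eq_zero hA hf hx
  exact ⟨-y, by rw [hy, smul_neg, add_neg_cancel]⟩

theorem IsReduction.d_eq_zero (h : IsReduction T ε) (hA : IsFiniteFree A.X) {i j l : ℤ}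
    {x : A.X i} {y : A.X j} (hxy : (A.d i j).hom x + T • y = 0) : (A.d j l).hom y = 0 := by
  apply h.smul_eq_zero hA
  have := congrArg (A.d j l).hom hxy
  rwa [map_add, d_d, zero_add, map_smul, map_zero] at this

/-- The classes `h` and `h'` correspond under the Bockstein morphism, up to a common denominator. -/
def IsBockstein (T : R) (ε : R →+* k) (A : CochainComplex (ModuleCat.{0} R) ℤ) (i : ℤ)
    (h : (baseChange ε A).homology i) (h' : (baseChange ε A).homology (i + 1)) : Prop :=
  ∃ (r : R) (x : A.X i) (y : A.X (i + 1)), ε r ≠ 0 ∧ (A.d i (i + 1)).hom x + T • y = 0 ∧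
    Represents (baseChange ε A) i (toBaseChange ε A i x) (ε r • h) ∧
    Represents (baseChange ε A) (i + 1) (toBaseChange ε A (i + 1) y) (ε r • h')

theorem IsReduction.exists_isBockstein (H : IsReduction T ε) (hA : IsFiniteFree A.X) {i : ℤ}
    (h : (baseChange ε A).homology i) : ∃ h', IsBockstein T ε A i h h' := by
  obtain ⟨v, hv⟩ := exists_represents h
  obtain ⟨r, x, hr, hx⟩ := H.exists_smul_eq_toBC hA v
  have hx' : Represents (baseChange ε A) i (toBaseChange ε A i x) (ε r • h) := by
    have hx : toBaseChange ε A i x = ε r • v := hx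
    rw [hx]
    exact hv.smul (ε r)
  obtain ⟨y, hy⟩ := exists_d_add_smul hA H.dvd (hx'.d_eq_zero _)
  have hdy : ((baseChange ε A).d (i + 1) (i + 1 + 1)).hom (toBaseChange ε A (i + 1) y) = 0 := by
    rw [baseChange_d, H.d_eq_zero hA hy, map_zero]
  obtain ⟨h'', hh⟩ := exists_represents_of_d_eq_zero hdy
  refine ⟨(ε r)⁻¹ • h'', r, x, y, hr, hy, hx', ?_⟩
  rwa [smul_inv_smul₀ hr]

/-- If `x` reduces to a coboundary, then `s x = dw + T q` with `ε s ≠ 0`. Inserting this in `dx + T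
y = 0` and cancelling `T` gives `s y = -dq`. -/
theorem IsBockstein.unique_zero (H : IsReduction T ε) (hA : IsFiniteFree A.X) {i : ℤ}
    {h' : (baseChange ε A).homology (i + 1)} (hB : IsBockstein T ε A i 0 h') : h' = 0 := by
  obtain ⟨r, x, y, hr, hxy, hx, hy⟩ := hB
  rw [smul_zero] at hx
  obtain ⟨v, hv⟩ := hx.exists_eq_d (i := i - 1) (by ring)
  obtain ⟨s, w, hs, hw⟩ := H.exists_smul_eq_toBC hA v
  have hw : toBaseChange ε A (i - 1) w = ε s • v := hw
  have h0 : toBaseChange ε A i (s • x - (A.d (i - 1) i).hom w) = 0 := by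
    rw [map_sub, toBaseChange_smul, ← baseChange_d, hw, map_smul, hv, sub_self]
  obtain ⟨q, hq⟩ := exists_eq_smul_of_toBC_eq_zero hA H.dvd h0
  have h1 : s • y + (A.d i (i + 1)).hom q = 0 := by
    apply H.smul_eq_zero hA
    have h2 := congrArg (A.d i (i + 1)).hom hq
    rw [map_sub, map_smul, d_d, sub_zero, map_smul] at h2
    rw [smul_add, ← h2, smul_comm T s, ← smul_add, add_comm (T • y), hxy, smul_zero]
  have h3 : Represents (baseChange ε A) (i + 1) (toBaseChange ε A (i + 1) (s • y)) 0 := by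
    rw [eq_neg_of_add_eq_zero_left h1, map_neg, ← baseChange_d]
    simpa using (represents_d (j := i + 1) (toBaseChange ε A i q)).neg
  rw [toBaseChange_smul] at h3
  have h4 := h3.unique (hy.smul (ε s))
  rw [smul_smul, eq_comm, smul_eq_zero] at h4
  exact h4.resolve_left (mul_ne_zero hs hr)

theorem IsBockstein.add {i : ℤ} {h₁ h₂ : (baseChange ε A).homology i}
    {h₁' h₂' : (baseChange ε A).homology (i + 1)} (hB : IsBockstein T ε A i h₁ h₁')
    (hB' : IsBockstein T ε A i h₂ h₂') : IsBockstein T ε A i (h₁ + h₂) (h₁' + h₂') := by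
  obtain ⟨r, x, y, hr, hxy, hx, hy⟩ := hB
  obtain ⟨s, x', y', hs, hxy', hx', hy'⟩ := hB'
  refine ⟨r * s, s • x + r • x', s • y + r • y', by simp [hr, hs], ?_, ?_, ?_⟩
  · rw [map_add, map_smul, map_smul, smul_add, smul_comm T, smul_comm T, add_add_add_comm,
      ← smul_add, ← smul_add, hxy, hxy', smul_zero, smul_zero, add_zero]
  · have := (hx.smul (ε s)).add (hx'.smul (ε r))
    rw [smul_smul, smul_smul, mul_comm (ε s), ← smul_add, ← map_mul] at this
    rwa [map_add, toBaseChange_smul, toBaseChange_smul]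
  · have := (hy.smul (ε s)).add (hy'.smul (ε r))
    rw [smul_smul, smul_smul, mul_comm (ε s), ← smul_add, ← map_mul] at this
    rwa [map_add, toBaseChange_smul, toBaseChange_smul]

theorem IsBockstein.smul (H : IsReduction T ε) {i : ℤ} {h : (baseChange ε A).homology i}
    {h' : (baseChange ε A).homology (i + 1)} (hB : IsBockstein T ε A i h h') (c : k) :
    IsBockstein T ε A i (c • h) (c • h') := by
  obtain ⟨r, x, y, hr, hxy, hx, hy⟩ := hB
  obtain ⟨m, n, hn, hmn⟩ := H.frac c
  have e : ε (n * r) * c = ε m * ε r := by rw [← hmn, map_mul]; ring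
  refine ⟨n * r, m • x, m • y, by simp [hr, hn], ?_, ?_, ?_⟩
  · rw [map_smul, smul_comm T, ← smul_add, hxy, smul_zero]
  · have := hx.smul (ε m)
    rwa [smul_smul, ← e, ← smul_smul, ← toBaseChange_smul] at this
  · have := hy.smul (ε m)
    rwa [smul_smul, ← e, ← smul_smul, ← toBaseChange_smul] at this

theorem IsBockstein.unique (H : IsReduction T ε) (hA : IsFiniteFree A.X) {i : ℤ}
    {h : (baseChange ε A).homology i} {h₁ h₂ : (baseChange ε A).homology (i + 1)}
    (hB : IsBockstein T ε A i h h₁) (hB' : IsBockstein T ε A i h h₂) : h₁ = h₂ := by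
  have := hB.add (hB'.smul H (-1))
  rw [neg_one_smul, neg_one_smul, add_neg_cancel] at this
  exact eq_of_add_neg_eq_zero (this.unique_zero H hA)

/-- The lift `y` is already a cocycle of `A`, because `T` is regular; so the Bockstein morphisms
have square zero. -/
theorem IsBockstein.next {i : ℤ} (H : IsReduction T ε) (hA : IsFiniteFree A.X)
    {h : (baseChange ε A).homology i} {h' : (baseChange ε A).homology (i + 1)}
    (hB : IsBockstein T ε A i h h') : IsBockstein T ε A (i + 1) h' 0 := by
  obtain ⟨r, x, y, hr, hxy, hx, hy⟩ := hB
  refine ⟨r, y, 0, hr, by rw [H.d_eq_zero hA hxy, smul_zero, add_zero], hy, ?_⟩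
  rw [map_zero, smul_zero]
  exact Represents.zero

/-- The Bockstein morphisms exist. -/
theorem IsReduction.nonempty_bockstein (H : IsReduction T ε) (hA : IsFiniteFree A.X) :
    Nonempty (Bockstein ε T A) := by
  choose β hβ using fun i => H.exists_isBockstein hA (i := i)
  let B : ∀ i, (baseChange ε A).homology i →ₗ[k] (baseChange ε A).homology (i + 1) := fun i =>
    { toFun := β i
      map_add' := fun h h' => (hβ i _).unique H hA ((hβ i h).add (hβ i h'))
      map_smul' := fun c h => (hβ i _).unique H hA ((hβ i h).smul H c) }
  refine ⟨⟨fun i => ModuleCat.ofHom (B i), fun i => ?_, fun i x y hxy _ h h' hh hh' => ?_⟩⟩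
  · ext h
    exact (hβ (i + 1) (β i h)).unique H hA ((hβ i h).next H hA)
  · exact (hβ i h).unique H hA ⟨1, x, y, by simp, hxy, by simpa using hh, by simpa using hh'⟩

/-- A class and its image under the Bockstein morphism can be represented, up to a common
denominator, by reductions of elements `u`, `y` with `d u + T y = 0`. -/
theorem Bockstein.exists_lift (H : IsReduction T ε) (hA : IsFiniteFree A.X) (B : Bockstein ε T A)
    {i : ℤ} {h : (baseChange ε A).homology i} {v : (baseChange ε A).X i}
    {v' : (baseChange ε A).X (i + 1)} (hv : Represents (baseChange ε A) i v h)
    (hv' : Represents (baseChange ε A) (i + 1) v' ((B.map i).hom h)) :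
    ∃ (r : R) (u : A.X i) (y : A.X (i + 1)), ε r ≠ 0 ∧ (A.d i (i + 1)).hom u + T • y = 0 ∧
      toBaseChange ε A i u = ε r • v ∧ toBaseChange ε A (i + 1) y = ε r • v' := by
  obtain ⟨r, x, hr, hx⟩ := H.exists_smul_eq_toBC hA v
  have hx : toBaseChange ε A i x = ε r • v := hx
  have hx' := hv.smul (ε r)
  rw [← hx] at hx'
  obtain ⟨y, hy⟩ := exists_d_add_smul hA H.dvd (hx'.d_eq_zero _)
  have hdy : ((baseChange ε A).d (i + 1) (i + 1 + 1)).hom (toBaseChange ε A (i + 1) y) = 0 := by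
    rw [baseChange_d, H.d_eq_zero hA hy, map_zero]
  obtain ⟨h'', hh⟩ := exists_represents_of_d_eq_zero hdy
  have e := B.spec i x y hy (H.d_eq_zero hA hy) _ _ hx' hh
  rw [map_smul] at e
  subst e
  have hz := hh.sub (hv'.smul (ε r))
  rw [sub_self] at hz
  obtain ⟨b, hb⟩ := hz.exists_eq_d rfl
  obtain ⟨s, w, hs, hw⟩ := H.exists_smul_eq_toBC hA b
  have hw : toBaseChange ε A i w = ε s • b := hw
  -- Adding `T • w` to `x` does not change its reduction, but changes `y` by `-dw`, which corrects
  -- the representative of the image class.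
  refine ⟨s * r, s • x + T • w, s • y - (A.d i (i + 1)).hom w, by simp [hs, hr], ?_, ?_, ?_⟩
  · rw [map_add, map_smul, map_smul, smul_sub, smul_comm T s, eq_neg_of_add_eq_zero_left hy]
    simp
  · rw [map_add, toBaseChange_smul, H.toBaseChange_smul, add_zero, hx, smul_smul, map_mul]
  · rw [map_sub, toBaseChange_smul, ← baseChange_d, hw, map_smul, hb, smul_sub, smul_smul, map_mul]
    abel

/-- If the Bockstein complex has torsion cohomology over `R / T`, then it is exact over the field of
fractions. -/
theorem Bockstein.exact_of_torsion {f : R →+* S} {g : S →+* k} (hf : Function.Surjective f)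
    (hg : Function.Injective g) (H : IsReduction T (g.comp f)) (hA : IsFiniteFree A.X)
    (B₀ : Bockstein f T A)
    (hB₀ : ∀ (i : ℤ) (h : (baseChange f A).homology (i + 1)), (B₀.map (i + 1)).hom h = 0 →
        ∃ c : S, c ≠ 0 ∧ ∃ g, (B₀.map i).hom g = c • h)
    (B : Bockstein (g.comp f) T A) (i : ℤ) (h : (baseChange (g.comp f) A).homology (i + 1))
    (hh : (B.map (i + 1)).hom h = 0) : ∃ h', (B.map i).hom h' = h := by
  have hf0 : ∀ x, f x = 0 → T ∣ x := fun x hx => H.dvd x (by simp [hx])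
  have hfT : f T = 0 := hg (by simpa using H.map_T)
  obtain ⟨v, hv⟩ := exists_represents h
  obtain ⟨r, x, z, hr, hxz, hx, hz⟩ := B.exists_lift H hA hv (v' := 0)
    (by rw [hh]; exact Represents.zero)
  rw [smul_zero] at hz
  obtain ⟨z', rfl⟩ := exists_eq_smul_of_toBC_eq_zero hA H.dvd hz
  have hx' := hv.smul (g.comp f r)
  rw [← hx] at hx'
  have hz0 : toBaseChange f A (i + 1 + 1) (T • z') = 0 := by
    rw [toBaseChange_smul, hfT, zero_smul]
  have hdx : ((baseChange f A).d (i + 1) (i + 1 + 1)).hom (toBaseChange f A (i + 1) x) = 0 := by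
    rw [baseChange_d, eq_neg_of_add_eq_zero_left hxz, map_neg, toBaseChange_smul, hz0, smul_zero,
      neg_zero]
  obtain ⟨h₀, hh₀⟩ := exists_represents_of_d_eq_zero hdx
  have e0 := B₀.spec (i + 1) x _ hxz (H.d_eq_zero hA hxz) h₀ 0 hh₀
    (by rw [hz0]; exact Represents.zero)
  obtain ⟨c, hc, h₁, hh₁⟩ := hB₀ i h₀ e0
  obtain ⟨v₁, hv₁⟩ := exists_represents h₁
  obtain ⟨a, ha⟩ := toBC_surjective hA hf i v₁
  have ha : toBaseChange f A i a = v₁ := ha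
  subst ha
  obtain ⟨b, hb⟩ := exists_d_add_smul hA hf0 (hv₁.d_eq_zero _)
  have hdb : ((baseChange f A).d (i + 1) (i + 1 + 1)).hom (toBaseChange f A (i + 1) b) = 0 := by
    rw [baseChange_d, H.d_eq_zero hA hb, map_zero]
  obtain ⟨h₂, hh₂⟩ := exists_represents_of_d_eq_zero hdb
  have e1 := B₀.spec i a b hb (H.d_eq_zero hA hb) _ _ hv₁ hh₂
  rw [hh₁] at e1
  subst e1
  have hz := hh₂.sub (hh₀.smul c)
  rw [sub_self] at hz
  obtain ⟨w, hw⟩ := hz.exists_eq_d rfl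
  obtain ⟨q, hq⟩ := toBC_surjective hA hf i w
  have hq : toBaseChange f A i q = w := hq
  obtain ⟨c, rfl⟩ := hf c
  have h0 : toBaseChange f A (i + 1) (b - c • x - (A.d i (i + 1)).hom q) = 0 := by
    rw [map_sub, map_sub, ← baseChange_d, hq, hw, toBaseChange_smul, sub_self]
  obtain ⟨y, hy⟩ := exists_eq_smul_of_toBC_eq_zero hA hf0 h0
  -- The torsion relation over `S` is now an equation in `A`; reduced to `k` it says that the class
  -- of `a` has as Bockstein image a nonzero multiple of `h`.
  have hbe : b = c • x + (A.d i (i + 1)).hom q + T • y := by rw [← hy]; abel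
  have hda : ((baseChange (g.comp f) A).d i (i + 1)).hom (toBaseChange (g.comp f) A i a) = 0 := by
    rw [baseChange_d, eq_neg_of_add_eq_zero_left hb, map_neg, H.toBaseChange_smul, neg_zero]
  obtain ⟨h₃, hh₃⟩ := exists_represents_of_d_eq_zero hda
  have hb' : Represents (baseChange (g.comp f) A) (i + 1) (toBaseChange (g.comp f) A (i + 1) b)
      (g.comp f c • g.comp f r • h) := by
    rw [hbe, map_add, map_add, H.toBaseChange_smul, add_zero, toBaseChange_smul, ← baseChange_d]
    simpa only [add_zero] using (hx'.smul (g.comp f c)).add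
      (represents_d (j := i + 1) (toBaseChange (g.comp f) A i q))
  have e2 := B.spec i a b hb (H.d_eq_zero hA hb) _ _ hh₃ hb'
  have hc' : g.comp f c * g.comp f r ≠ 0 :=
    mul_ne_zero (fun h => hc (hg (by simpa using h))) hr
  refine ⟨(g.comp f c * g.comp f r)⁻¹ • h₃, ?_⟩
  rw [map_smul, e2, smul_smul (g.comp f c), smul_smul, inv_mul_cancel₀ hc', one_smul]

end Bockstein

/-! ### Elements of `A` in which the differential is diagonal. -/

section AdaptedFamily

/-- Used for `D` in consecutive degrees: the vectors `z` coming from the degree below span the image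
of `f`, and the vectors `x` lift a basis of the image of `g`. -/
theorem exists_basis_of_exact {k U V W ι κ : Type} [Field k] [AddCommGroup U] [Module k U]
    [AddCommGroup V] [Module k V] [AddCommGroup W] [Module k W] (f : U →ₗ[k] V) (g : V →ₗ[k] W)
    (hgf : ∀ u, g (f u) = 0) (hex : ∀ v, g v = 0 → ∃ u, f u = v) {x : ι → V} {z : κ → V}
    (hx : LinearIndependent k fun i => g (x i))
    (hx' : LinearMap.range g ≤ Submodule.span k (Set.range fun i => g (x i)))
    (hz : LinearIndependent k z) (hzf : ∀ i, ∃ u, f u = z i)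
    (hz' : LinearMap.range f ≤ Submodule.span k (Set.range z)) :
    ∃ b : Module.Basis (ι ⊕ κ) k V, ⇑b = Sum.elim x z := by
  have hker : Submodule.span k (Set.range z) ≤ LinearMap.ker g := by
    rw [Submodule.span_le]
    rintro _ ⟨i, rfl⟩
    obtain ⟨u, hu⟩ := hzf i
    rw [SetLike.mem_coe, LinearMap.mem_ker, ← hu, hgf]
  have hli : LinearIndependent k (Sum.elim x z) := by
    refine (LinearIndependent.of_comp g hx).sum_type hz ?_
    rw [Submodule.disjoint_def]
    intro v hv hv'
    have h1 : g v = 0 := hker hv'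
    have h2 := (Submodule.range_ker_disjoint hx)
    exact Submodule.disjoint_def.1 h2 v hv h1
  refine ⟨Module.Basis.mk hli ?_, Module.Basis.coe_mk _ _⟩
  rintro v -
  rw [Set.Sum.elim_range, Submodule.span_union]
  have h1 : g v ∈ (Submodule.span k (Set.range x)).map g := by
    rw [Submodule.map_span, ← Set.range_comp]
    exact hx' ⟨v, rfl⟩
  obtain ⟨y, hy, hyv⟩ := h1
  obtain ⟨u, hu⟩ := hex (v - y) (by rw [map_sub, hyv, sub_self])
  have : v = y + f u := by rw [hu]; abel
  rw [this]
  exact Submodule.add_mem_sup hy (hz' ⟨u, rfl⟩)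

theorem exists_linearIndependent_range {k M N : Type} [Field k] [AddCommGroup M] [Module k M]
    [AddCommGroup N] [Module k N] [Module.Finite k N] (f : M →ₗ[k] N) :
    ∃ (n : ℕ) (w : Fin n → M), LinearIndependent k (fun a => f (w a)) ∧
      ∀ v, f v ∈ Submodule.span k (Set.range fun a => f (w a)) := by
  let b := Module.finBasis k (LinearMap.range f)
  choose w hw using fun a => (b a).2
  have hw : (fun a => f (w a)) = (LinearMap.range f).subtype ∘ b := funext hw
  refine ⟨_, w, ?_, fun v => ?_⟩
  · rw [hw]
    exact b.linearIndependent.map' _ (Submodule.ker_subtype _)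
  · rw [hw, Set.range_comp, ← Submodule.map_span, b.span_eq]
    exact ⟨⟨f v, v, rfl⟩, trivial, rfl⟩

variable {R k : Type} [CommRing R] [Field k] {T : R} {ε : R →+* k}
  {A : CochainComplex (ModuleCat.{0} R) ℤ}

/-- Elements of `A` adapted to the decomposition of the range of the differential `d + ι B π` of
`k ⊗ A`. -/
theorem exists_adapted (H : IsReduction T ε) (hA : IsFiniteFree A.X) (B : Bockstein ε T A)
    {ι : ∀ i, (baseChange ε A).homology i →ₗ[k] (baseChange ε A).X i}
    (hι : ∀ i h, Represents (baseChange ε A) i (ι i h) h)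
    {π : ∀ i, (baseChange ε A).X i →ₗ[k] (baseChange ε A).homology i}
    (hπ : ∀ i x h, Represents (baseChange ε A) i x h → π i x = h)
    {D : GHom (baseChange ε A).X (baseChange ε A).X}
    (hD : ∀ i x, D i (i + 1) x = ((baseChange ε A).d i (i + 1)).hom x +
      ι (i + 1) ((B.map i).hom (π i x))) (i : ℤ) :
    ∃ (m n : ℕ) (x : Fin m ⊕ Fin n → A.X i) (z : Fin m ⊕ Fin n → A.X (i + 1)),
      (∀ s, (A.d i (i + 1)).hom (x s) = (if s.isRight then -T else 1) • z s) ∧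
      (∀ s, D i (i + 1) (toBaseChange ε A i (x s)) = toBaseChange ε A (i + 1) (z s)) ∧
      LinearIndependent k (fun s => toBaseChange ε A (i + 1) (z s)) ∧
      LinearMap.range (D i (i + 1)) ≤
        Submodule.span k (Set.range fun s => toBaseChange ε A (i + 1) (z s)) := by
  have hfin : ∀ i, Module.Finite k ((baseChange ε A).X i) := (hA.baseChange ε).finite
  have πι : ∀ i h, π i (ι i h) = h := fun i h => hπ i _ _ (hι i h)
  have πd : ∀ i j x, π j (((baseChange ε A).d i j).hom x) = 0 := fun i j x =>
    hπ j _ _ (represents_d x)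
  have dι : ∀ i j h, ((baseChange ε A).d i j).hom (ι i h) = 0 := fun i j h =>
    (hι i h).d_eq_zero j
  have hfinH : Module.Finite k ((baseChange ε A).homology (i + 1)) :=
    Module.Finite.of_surjective (π (i + 1)) fun h => ⟨_, πι _ h⟩
  obtain ⟨m, w, hw, hw'⟩ := exists_linearIndependent_range ((baseChange ε A).d i (i + 1)).hom
  obtain ⟨n, h, hh, hh'⟩ := exists_linearIndependent_range (B.map i).hom
  -- Subtracting `ιπ` from `w a` does not change its differential, and makes `D` agree with `d` on
  -- the lift.
  choose r x hr hx using fun a => H.exists_smul_eq_toBC hA (w a - ι i (π i (w a)))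
  have hx : ∀ a, toBaseChange ε A i (x a) = ε (r a) • (w a - ι i (π i (w a))) := hx
  have hz : ∀ a, toBaseChange ε A (i + 1) ((A.d i (i + 1)).hom (x a)) =
      ε (r a) • ((baseChange ε A).d i (i + 1)).hom (w a) := fun a => by
    rw [← baseChange_d, hx, map_smul, map_sub, dι, sub_zero]
  -- These pairs satisfy `du = -T y` and reduce to the same multiple of `ι h` and of `ιβh`, so that
  -- `D` carries the reduction of `u` to that of `y`.
  choose q u y hq huy hu hy using fun a => B.exists_lift H hA (hι i (h a))
    (hι (i + 1) ((B.map i).hom (h a)))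
  refine ⟨_, _, Sum.elim x u, Sum.elim (fun a => (A.d i (i + 1)).hom (x a)) y, ?_, ?_, ?_, ?_⟩
  · rintro (a | a)
    · simp
    · simpa using eq_neg_of_add_eq_zero_left (huy a)
  · rintro (a | a)
    · rw [hD, Sum.elim_inl, Sum.elim_inl, baseChange_d, add_eq_left, hx, map_smul, map_sub, πι,
        sub_self, smul_zero, map_zero, map_zero]
    · rw [hD, Sum.elim_inr, Sum.elim_inr, hu, hy, map_smul, dι, smul_zero, zero_add, map_smul,
        πι, map_smul, map_smul]
  · rw [Fintype.linearIndependent_iff]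
    intro g hg
    rw [Fintype.sum_sum_type] at hg
    simp only [Sum.elim_inl, Sum.elim_inr, hz, hy] at hg
    -- `π` kills the coboundaries and isolates the coefficients of the Bockstein part.
    have h1 := congrArg (π (i + 1)) hg
    simp only [map_add, map_sum, map_smul, πι, map_zero] at h1
    simp only [πd, smul_zero, Finset.sum_const_zero, zero_add] at h1
    have h3 : ∀ a, g (Sum.inr a) = 0 := fun a => by
      have h5 := Fintype.linearIndependent_iff.1 hh (fun a => g (Sum.inr a) * ε (q a))
        (by simpa [mul_smul] using h1) a
      exact (mul_eq_zero.1 h5).resolve_right (hq a)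
    simp only [h3, zero_smul, Finset.sum_const_zero, add_zero] at hg
    rintro (a | a)
    · have h5 := Fintype.linearIndependent_iff.1 hw (fun a => g (Sum.inl a) * ε (r a))
        (by simpa [mul_smul] using hg) a
      exact (mul_eq_zero.1 h5).resolve_right (hr a)
    · exact h3 a
  · rintro _ ⟨v, rfl⟩
    rw [hD]
    set P := Submodule.span k (Set.range fun s => toBaseChange ε A (i + 1)
      (Sum.elim (fun a => (A.d i (i + 1)).hom (x a)) y s)) with hP
    refine P.add_mem ((Submodule.span_le.2 ?_ : _ ≤ P) (hw' v))
      ((Submodule.span_le.2 ?_ : _ ≤ P.comap (ι (i + 1))) (hh' (π i v)))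
    · rintro _ ⟨a, rfl⟩
      have : toBaseChange ε A (i + 1) ((A.d i (i + 1)).hom (x a)) ∈ P :=
        Submodule.subset_span ⟨Sum.inl a, rfl⟩
      rw [hz] at this
      exact (Submodule.smul_mem_iff _ (hr a)).1 this
    · rintro _ ⟨a, rfl⟩
      have : toBaseChange ε A (i + 1) (y a) ∈ P := Submodule.subset_span ⟨Sum.inr a, rfl⟩
      rw [hy] at this
      exact (Submodule.smul_mem_iff P (hq a)).1 this

/-- The indices of degree `i` in a family of index types. -/
def sigmaFiberEquiv (I : ℤ → Type) (i : ℤ) : {j : Σ i, I i // j.1 = i} ≃ I i where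
  toFun j := j.2 ▸ j.1.2
  invFun a := ⟨⟨i, a⟩, rfl⟩
  left_inv := by rintro ⟨⟨_, a⟩, rfl⟩; rfl
  right_inv _ := rfl

/-- Elements of `A` which are diagonal for the differential, with eigenvalues `1` and `-T`, and
reduce to bases of the components of `k ⊗ A`. -/
theorem exists_adapted_family (H : IsReduction T ε) (hA : IsFiniteFree A.X) (B : Bockstein ε T A)
    (hB : ∀ i h, (B.map (i + 1)).hom h = 0 → ∃ h', (B.map i).hom h' = h)
    {ι : ∀ i, (baseChange ε A).homology i →ₗ[k] (baseChange ε A).X i}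
    (hι : ∀ i h, Represents (baseChange ε A) i (ι i h) h)
    {π : ∀ i, (baseChange ε A).X i →ₗ[k] (baseChange ε A).homology i}
    (hπ : ∀ i x h, Represents (baseChange ε A) i x h → π i x = h)
    {D : GHom (baseChange ε A).X (baseChange ε A).X}
    (hD : ∀ i x, D i (i + 1) x = ((baseChange ε A).d i (i + 1)).hom x +
      ι (i + 1) ((B.map i).hom (π i x))) :
    ∃ (J : Type) (_ : Finite J) (deg : J → ℤ) (bock : J → Bool) (x : ∀ j, A.X (deg j))
      (z : ∀ j, A.X (deg j + 1)) (b : ∀ i, Module.Basis (FamIndex deg i) k (bcTerms ε A.X i)),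
      (∀ j, dFam A (deg j) (deg j + 1) (x j) = (if bock j then -T else 1) • z j) ∧
      (∀ j, D (deg j) (deg j + 1) (toBC ε A.X _ (x j)) = toBC ε A.X _ (z j)) ∧
      ∀ i s, b i s = toBC ε A.X i (fam x z i s) := by
  choose m n x z hxz hDx hli hspan using exists_adapted H hA B hι hπ hD
  have πι : ∀ i h, π i (ι i h) = h := fun i h => hπ i _ _ (hι i h)
  have πd : ∀ i j x, π j (((baseChange ε A).d i j).hom x) = 0 := fun i j x =>
    hπ j _ _ (represents_d x)
  have dι : ∀ i j h, ((baseChange ε A).d i j).hom (ι i h) = 0 := fun i j h =>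
    (hι i h).d_eq_zero j
  have hBB : ∀ i h, (B.map (i + 1)).hom ((B.map i).hom h) = 0 := fun i h =>
    hom_congr_apply (B.map_comp_map i) h
  have hDD : ∀ i v, D (i + 1) (i + 1 + 1) (D i (i + 1) v) = 0 := fun i v => by
    rw [hD, hD, map_add, map_add, d_d, dι, πd, πι, map_add, map_zero, hBB]
    simp
  -- If `D v = 0`, applying `π` gives `βπv = 0` and then `dv = 0`. So `πv = βh` by exactness of `β`,
  -- and `v - ιπv = dw`; a preimage is `ιh + (w - ιπw)`.
  have hDex : ∀ i v, D (i + 1) (i + 1 + 1) v = 0 → ∃ u, D i (i + 1) u = v := fun i v hv => by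
    rw [hD] at hv
    have h1 := congrArg (π (i + 1 + 1)) hv
    rw [map_add, πd, πι, map_zero, zero_add] at h1
    rw [h1, map_zero, add_zero] at hv
    obtain ⟨h, hh⟩ := hB i _ h1
    obtain ⟨g, hg⟩ := exists_represents_of_d_eq_zero hv
    obtain rfl := hπ _ _ _ hg
    have h2 := hg.sub (hι _ (π (i + 1) v))
    rw [sub_self] at h2
    obtain ⟨w, hw⟩ := h2.exists_eq_d rfl
    refine ⟨ι i h + (w - ι i (π i w)), ?_⟩
    rw [hD, map_add, map_sub, dι, dι, hw, map_add, map_sub, πι, πι, sub_self, add_zero, hh]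
    abel
  have hbas : ∀ i, ∃ b : Module.Basis ((Fin (m (i + 1)) ⊕ Fin (n (i + 1))) ⊕
    (Fin (m i) ⊕ Fin (n i)))
      k ((baseChange ε A).X (i + 1)), ⇑b = Sum.elim
        (fun s => toBaseChange ε A (i + 1) (x (i + 1) s))
        (fun s => toBaseChange ε A (i + 1) (z i s)) := fun i => by
    refine exists_basis_of_exact (D i (i + 1)) (D (i + 1) (i + 1 + 1)) (hDD i) (hDex i)
      ?_ ?_ (hli i) (fun s => ⟨_, hDx i s⟩) (hspan i)
    · simpa only [hDx] using hli (i + 1)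
    · simpa only [hDx] using hspan (i + 1)
  let I : ℤ → Type := fun i => Fin (m i) ⊕ Fin (n i)
  have hfin : Finite (Σ i, I i) := by
    obtain ⟨lo, hi, hb⟩ := (hA.baseChange ε).bounded
    have hmem : ∀ j : Σ i, I i, j.1 + 1 ∈ Set.Icc lo hi := by
      rintro ⟨i, s⟩
      by_contra hcon
      have : Subsingleton ((baseChange ε A).X (i + 1)) := hb _ (by
        rw [Set.mem_Icc] at hcon
        change ¬ (lo ≤ i + 1 ∧ i + 1 ≤ hi) at hcon
        omega)
      exact (hli i).ne_zero s (Subsingleton.elim _ _)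
    let g : (Σ i, I i) → Σ i : Set.Icc (lo - 1) (hi - 1), I i := fun j =>
      ⟨⟨j.1, by have := hmem j; rw [Set.mem_Icc] at this ⊢; omega⟩, j.2⟩
    have : ∀ i, Finite (I i) := fun i => inferInstanceAs (Finite (Fin (m i) ⊕ Fin (n i)))
    refine Finite.of_injective g ?_
    rintro ⟨i, s⟩ ⟨i', s'⟩ h
    simp only [g, Sigma.mk.injEq, Subtype.mk.injEq] at h
    exact Sigma.ext h.1 h.2
  have hbas' : ∀ i, ∃ b : Module.Basis (FamIndex (Sigma.fst : (Σ i, I i) → ℤ) i) k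
      (bcTerms ε A.X i), ∀ s, b s = toBC ε A.X i
        (fam (deg := Sigma.fst) (fun j : Σ i, I i => x j.1 j.2) (fun j => z j.1 j.2) i s) := by
    intro i
    obtain ⟨i, rfl⟩ : ∃ i', i = i' + 1 := ⟨i - 1, by ring⟩
    obtain ⟨b, hb⟩ := hbas i
    let e : FamIndex (Sigma.fst : (Σ i, I i) → ℤ) (i + 1) ≃ I (i + 1) ⊕ I i :=
      Equiv.sumCongr (sigmaFiberEquiv I (i + 1))
        ((Equiv.subtypeEquivRight fun j => add_left_inj 1).trans (sigmaFiberEquiv I i))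
    refine ⟨b.reindex e.symm, ?_⟩
    rintro (⟨⟨l, s⟩, h⟩ | ⟨⟨l, s⟩, h⟩)
    · change l = i + 1 at h
      subst h
      exact (b.reindex_apply _ _).trans (congrFun hb (Sum.inl s))
    · obtain rfl : l = i := add_left_injective 1 h
      exact (b.reindex_apply _ _).trans (congrFun hb (Sum.inr s))
  choose b hb using hbas'
  exact ⟨Σ i, I i, hfin, Sigma.fst, fun j => j.2.isRight, fun j => x j.1 j.2, fun j => z j.1 j.2,
    b, fun j => hxz j.1 j.2, fun j => hDx j.1 j.2, hb⟩

end AdaptedFamily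

/-! ### The leading term of the characteristic element. -/

section LeadingValue

variable {R k : Type} [CommRing R] [Field k] {T : R} {ε : R →+* k}

theorem IsFiniteFree.isFreeBaseChange_toBC {S : Type} [CommRing S] {X : ℤ → ModuleCat.{0} R}
    (hX : IsFiniteFree X) (f : R →+* S) [Nontrivial R] (i : ℤ) :
    IsFreeBaseChange f (toBC f X i) where
  smul := toBC_smul f X i
  exists_basis := by
    have := hX.free i
    have := hX.finite i
    obtain ⟨b', hb'⟩ := exists_basis_toBC f X i (Module.Free.chooseBasis R (X i))
    exact ⟨_, inferInstance, _, b', hb'⟩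

/-- Elements of a free module which form a basis after one base change form a basis after any
injective base change to a field. -/
theorem exists_basis_of_basis {K M N N' I : Type} [Field K] [AddCommGroup M] [Module R M]
    [AddCommGroup N] [Module k N] [AddCommGroup N'] [Module K N'] {f : R →+* K}
    (hf : Function.Injective f) {l : M →+ N} {l' : M →+ N'} (hl : IsFreeBaseChange ε l)
    (hl' : IsFreeBaseChange f l') [Finite I] (v : I → M) (b : Module.Basis I k N)
    (hb : ∀ s, b s = l (v s)) : ∃ b' : Module.Basis I K N', ∀ s, b' s = l' (v s) := by
  classical
  have := Fintype.ofFinite I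
  have : Nontrivial R := ε.domain_nontrivial
  obtain ⟨e⟩ := hl.exists_basis_index b
  obtain ⟨e₁, he₁⟩ := hl.exists_basis_map e
  obtain ⟨e₂, he₂⟩ := hl'.exists_basis_map e
  -- One determinant in `R` decides both questions: it is nonzero because its reduction is, and it
  -- remains nonzero in `K` by injectivity.
  have h1 : ε (e.det v) ≠ 0 := by
    rw [← det_baseChange hl.smul e e₁ he₁, ← funext hb]
    exact (e₁.isUnit_det b).ne_zero
  have h2 : e₂.det (fun s => l' (v s)) ≠ 0 := by
    rw [det_baseChange hl'.smul e e₂ he₂]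
    intro h
    rw [(map_eq_zero_iff f hf).1 h, map_zero] at h1
    exact h1 rfl
  obtain ⟨h3, h4⟩ := e₂.is_basis_iff_det.2 h2.isUnit
  exact ⟨Module.Basis.mk h3 h4.ge, fun s => Module.Basis.mk_apply _ _ s⟩

variable {A : CochainComplex (ModuleCat.{0} R) ℤ}

theorem prod_ite_odd {K J : Type} [Field K] [Fintype J] (deg : J → ℤ) (bock : J → Bool) (t : K) :
    (∏ j, if Odd (deg j) then (if bock j then t else 1) else (if bock j then t else 1)⁻¹) =
      t ^ (Finset.univ.filter fun j => bock j ∧ Odd (deg j)).card *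
        (t ^ (Finset.univ.filter fun j => bock j ∧ ¬ Odd (deg j)).card)⁻¹ := by
  have : ∀ j, (if Odd (deg j) then (if bock j then t else 1) else (if bock j then t else 1)⁻¹) =
      (if bock j ∧ Odd (deg j) then t else 1) * (if bock j ∧ ¬ Odd (deg j) then t else 1)⁻¹ := by
    intro j
    by_cases h : Odd (deg j) <;> cases bock j <;> simp [h]
  rw [Finset.prod_congr rfl fun j _ => this j, Finset.prod_mul_distrib, Finset.prod_inv_distrib,
    Finset.prod_ite, Finset.prod_ite, Finset.prod_const_one, Finset.prod_const_one, mul_one,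
    mul_one, Finset.prod_const, Finset.prod_const]

/-- The characteristic element of `A`, its order at `T = 0`, and its leading coefficient in terms of
the complex `k ⊗ A` with a perturbed differential. -/
theorem IsReduction.exists_values [IsDomain R] (H : IsReduction T ε) (hA : IsFiniteFree A.X)
    {J : Type} [Fintype J] {deg : J → ℤ} {bock : J → Bool} {x : ∀ j, A.X (deg j)}
    {z : ∀ j, A.X (deg j + 1)} (b : ∀ i, Module.Basis (FamIndex deg i) k (bcTerms ε A.X i))
    (hxz : ∀ j, dFam A (deg j) (deg j + 1) (x j) = (if bock j then -T else 1) • z j)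
    {D : GHom (bcTerms ε A.X) (bcTerms ε A.X)}
    (hsq : ∀ i j k : ℤ, i + 1 = j → j + 1 = k → ∀ x, D j k (D i j x) = 0)
    (hD : ∀ j, D (deg j) (deg j + 1) (toBC ε A.X _ (x j)) = toBC ε A.X _ (z j))
    (hb : ∀ i s, b i s = toBC ε A.X i (fam x z i s)) (a : Triv A.X) {a' : Triv (bcTerms ε A.X)}
    (ha : IsBCTriv ε a a') :
    ∃ (F : (FractionRing R)ˣ) (y : kˣ), IsCharElt (algebraMap R (FractionRing R)) A a F ∧
      IsVal D a' y ∧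
      ∀ r : ℤ, r = (Finset.univ.filter fun j => bock j ∧ ¬ Odd (deg j)).card -
          (Finset.univ.filter fun j => bock j ∧ Odd (deg j)).card →
        HasLeading T ε F r ((-1) ^ r * y) := by
  classical
  set f := algebraMap R (FractionRing R) with hf
  have hfinj : Function.Injective f := IsFractionRing.injective R (FractionRing R)
  have hT : T ≠ 0 := fun h => one_ne_zero (H.nzd 1 (by rw [h, zero_mul]))
  obtain ⟨u, φ, rfl⟩ := a.exists_mk
  have hbas : ∀ i, ∃ b' : Module.Basis (FamIndex deg i) (FractionRing R) (bcTerms f A.X i),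
      ∀ s, b' s = toBC f A.X i (fam x z i s) := fun i =>
    exists_basis_of_basis hfinj (hA.isFreeBaseChange_toBC ε i) (hA.isFreeBaseChange_toBC f i) _
      (b i) (hb i)
  choose b' hb' using hbas
  have hbfam : ∀ i, ⇑(b i) = fam (X := bcTerms ε A.X) (fun j => toBC ε A.X _ (x j))
      (fun j => toBC ε A.X _ (z j)) i := fun i => funext fun s => by rw [hb, toBC_fam]
  obtain ⟨eO, -⟩ := exists_oddBasis _ _ b hbfam
  obtain ⟨e⟩ := (hA.isFreeBaseChange ε Odd).exists_basis_index eO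
  obtain ⟨a₁, ha₁⟩ := exists_isBCTriv hA f (Triv.mk u φ)
  -- Over the field of fractions the eigenvalues are `-T` and `1`; over `k`, for `D`, the same
  -- vectors have all eigenvalues `1`.
  obtain ⟨F, hF, -, -, hFe⟩ := exists_isVal_of_fam hA b' hb' (δ := bcHom f (dFam A))
    (fun i j k _ _ x => bcHom_sq (fun x => dFam_sq A i j k x) x)
    (c := fun j => if bock j then f (-T) else 1)
    (fun j => by
      cases bock j
      · simp
      · simpa using (map_ne_zero_iff f hfinj).2 hT)
    (fun j => by
      rw [bcHom_toBC, hxz, toBC_smul]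
      congr 1
      cases bock j <;> simp)
    e u φ ha₁
  obtain ⟨y, hy, hO, hE, hye⟩ := exists_isVal_of_fam hA b hb (δ := D) hsq (c := fun _ => 1)
    (fun _ => one_ne_zero) (fun j => by rw [hD, one_smul]) e u φ ha
  refine ⟨F, y, ⟨a₁, ha₁, hF⟩, hy, ?_⟩
  rintro r rfl
  rw [prod_ite_odd] at hFe
  set n := (Finset.univ.filter fun j => bock j ∧ Odd (deg j)).card
  set m := (Finset.univ.filter fun j => bock j ∧ ¬ Odd (deg j)).card
  have hu : ε u ≠ 0 := (u.isUnit.map ε).ne_zero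
  have hm1 : ∀ l : ℕ, ε ((-1) ^ l) ≠ 0 := fun l => by simp
  -- `F` is `(-T)^(m - n)` times the quotient of determinants; even degrees enter the numerator
  -- because their diagonal factor is inverted. The signs of the powers of `-T` are moved into
  -- numerator and denominator and produce `(-1) ^ r`.
  refine ⟨m, n, (-1) ^ m * (u * e.det (oddVec x z)), (-1) ^ n * (e.map φ).det (evenVec x z), rfl,
    ?_, ?_, ?_, ?_⟩
  · rw [map_mul, map_mul]
    exact mul_ne_zero (hm1 m) (mul_ne_zero hu hO)
  · rw [map_mul]
    exact mul_ne_zero (hm1 n) hE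
  · have hTm : f (-T) ^ m ≠ 0 := pow_ne_zero _ ((map_ne_zero_iff f hfinj).2 (neg_ne_zero.2 hT))
    have e1 : T ^ n * ((-1) ^ n * (e.map φ).det (evenVec x z)) =
        (-T) ^ n * (e.map φ).det (evenVec x z) := by rw [neg_pow T]; ring
    have e2 : T ^ m * ((-1) ^ m * (u * e.det (oddVec x z))) =
        (-T) ^ m * (u * e.det (oddVec x z)) := by rw [neg_pow T]; ring
    rw [← hf, e1, e2, map_mul, map_mul, map_pow, map_pow, map_mul f (u : R), ← hFe]
    field_simp
  · have hy' : (y : k) = ε u * ε (e.det (oddVec x z)) / ε ((e.map φ).det (evenVec x z)) := by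
      rw [eq_div_iff hE, ← hye]
      simp
    rw [Units.val_mul, hy', Units.val_zpow_eq_zpow_val, Units.val_neg, Units.val_one,
      zpow_sub₀ (by simp), zpow_natCast, zpow_natCast]
    simp only [map_mul, map_pow, map_neg, map_one]
    field_simp

end LeadingValue

/-! ### The rank of the `T`-torsion in cohomology. -/

section Rank

theorem finrank_tensorProduct_eq_card {O K N I : Type} [CommRing O] [IsDomain O] [Field K]
    [Algebra O K] [IsFractionRing O K] [AddCommMonoid N] [Module O N] [Fintype I] (v : I → N)
    (hv : ∀ g : I → O, ∑ i, g i • v i = 0 → ∀ i, g i = 0)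
    (hv' : ∀ n, ∃ c : O, c ≠ 0 ∧ c • n ∈ Submodule.span O (Set.range v)) :
    Module.finrank K (K ⊗[O] N) = Fintype.card I := by
  let _ : AddCommGroup N := Module.addCommMonoidToAddCommGroup O
  have hv : LinearIndependent O v := Fintype.linearIndependent_iff.2 hv
  have hloc : IsLocalizedModule (nonZeroDivisors O) (TensorProduct.mk O K N 1) :=
    (isLocalizedModule_iff_isBaseChange (nonZeroDivisors O) K _).2
      (TensorProduct.isBaseChange O N K)
  have h1 := hv.of_isLocalizedModule K (nonZeroDivisors O) (TensorProduct.mk O K N 1)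
  have h2 : ⊤ ≤ Submodule.span K (Set.range (TensorProduct.mk O K N 1 ∘ v)) := by
    rintro x -
    induction x with
    | zero => exact zero_mem _
    | add x y hx hy => exact add_mem hx hy
    | tmul c n =>
      obtain ⟨d, hd, hdn⟩ := hv' n
      have hd' : algebraMap O K d ≠ 0 := by
        rwa [ne_eq, map_eq_zero_iff _ (IsFractionRing.injective O K)]
      have h3 : ∀ m ∈ Submodule.span O (Set.range v), TensorProduct.mk O K N 1 m ∈
          Submodule.span K (Set.range (TensorProduct.mk O K N 1 ∘ v)) := by
        intro m hm
        induction hm using Submodule.span_induction with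
        | mem x hx =>
          obtain ⟨i, rfl⟩ := hx
          exact Submodule.subset_span ⟨i, rfl⟩
        | zero => rw [map_zero]; exact zero_mem _
        | add x y _ _ hx hy => rw [map_add]; exact add_mem hx hy
        | smul r x _ hx =>
          rw [map_smul, ← algebraMap_smul K r]
          exact Submodule.smul_mem _ _ hx
      have h4 : c ⊗ₜ[O] n = (c * (algebraMap O K d)⁻¹) • TensorProduct.mk O K N 1 (d • n) := by
        rw [TensorProduct.mk_apply, TensorProduct.smul_tmul', ← TensorProduct.smul_tmul,
          smul_eq_mul, mul_one, Algebra.smul_def]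
        congr 1
        field_simp
      rw [h4]
      exact Submodule.smul_mem _ _ (h3 _ hdn)
  rw [Module.finrank_eq_card_basis (Module.Basis.mk h1 h2)]

/-- Cramer's rule; it expresses elements in vectors that form a basis only after base change, with a
controlled denominator. -/
theorem exists_det_smul_eq_sum {R M I : Type} [CommRing R] [AddCommGroup M] [Module R M] [Fintype I]
    [DecidableEq I] (e : Module.Basis I R M) (v : I → M) (m : M) :
    ∃ r : I → R, e.det v • m = ∑ i, r i • v i := by
  refine ⟨Matrix.cramer (e.toMatrix v) (e.repr m), e.repr.injective (Finsupp.ext fun i => ?_)⟩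
  have h := congrFun (Matrix.mulVec_cramer (e.toMatrix v) (e.repr m)) i
  rw [Matrix.mulVec, dotProduct] at h
  simp only [map_smul, map_sum, Finsupp.smul_apply, Finsupp.finsetSum_apply, smul_eq_mul]
  rw [Module.Basis.det_apply]
  refine (h.trans rfl).symm.trans (Finset.sum_congr rfl fun j _ => ?_)
  rw [Module.Basis.toMatrix_apply, mul_comm]

theorem Represents.sum {R : Type} [CommRing R] {C : CochainComplex (ModuleCat.{0} R) ℤ} {i : ℤ}
    {I : Type} {c : I → C.X i} {h : I → C.homology i} (hc : ∀ j, Represents C i (c j) (h j))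
    (s : Finset I) (r : I → R) :
    Represents C i (∑ j ∈ s, r j • c j) (∑ j ∈ s, r j • h j) := by
  classical
  induction s using Finset.induction_on with
  | empty => simpa using Represents.zero
  | insert j s hj ih =>
    rw [Finset.sum_insert hj, Finset.sum_insert hj]
    exact ((hc j).smul _).add ih

variable {R O K : Type} [CommRing R] [CommRing O] [IsDomain O] [Field K] [Algebra O K]
  [IsFractionRing O K] [Algebra O R] {aug : R →+* O} {ε : R →+* K} {T : R}
  {A : CochainComplex (ModuleCat.{0} R) ℤ}

/-- The rank of the `T`-torsion in the cohomology of a complex with a family of elements adapted to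
the differential. -/
theorem finrank_torsionBy_homology (haug : ∀ c, aug (algebraMap O R c) = c)
    (hε : ∀ r, ε r = algebraMap O K (aug r)) (H : IsReduction T ε) (hA : IsFiniteFree A.X)
    {m : ℤ} {κ κ' : Type} [Fintype κ] [Finite κ'] {x : κ → A.X m} {y : κ' → A.X m}
    {z : κ → A.X (m + 1)}
    {bock : κ → Bool} (hx : ∀ j, (A.d m (m + 1)).hom (x j) = (if bock j then -T else 1) • z j)
    (hy : ∀ j, (A.d m (m + 1)).hom (y j) = 0)
    (b : Module.Basis (κ ⊕ κ') K (bcTerms ε A.X m))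
    (hb : ∀ s, b s = toBC ε A.X m (Sum.elim x y s))
    (hz : LinearIndependent K fun j => toBC ε A.X (m + 1) (z j)) :
    Module.finrank K (K ⊗[O] RestrictScalars O R (Submodule.torsionBy R (A.homology (m + 1)) T)) =
      Fintype.card {j // bock j} := by
  classical
  have := Fintype.ofFinite κ'
  have : Nontrivial R := H.nontrivial
  have hεO : ∀ c, ε (algebraMap O R c) = algebraMap O K c := fun c => by
    rw [hε, haug]
  have hzT : ∀ j, bock j → (A.d m (m + 1)).hom (x j) + T • z j = 0 := fun j hj => by
    rw [hx, if_pos hj, neg_smul, neg_add_cancel]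
  have hz1 : ∀ j, ¬ bock j → (A.d m (m + 1)).hom (x j) = z j := fun j hj => by
    rw [hx, if_neg hj, one_smul]
  have hdz : ∀ j, (A.d (m + 1) (m + 1 + 1)).hom (z j) = 0 := fun j => by
    by_cases hj : bock j
    · exact H.d_eq_zero hA (hzT j hj)
    · rw [← hz1 j hj, d_d]
  choose ζ hζ using fun j => exists_represents_of_d_eq_zero (hdz j)
  have hζ0 : ∀ j, ¬ bock j → ζ j = 0 := fun j hj => by
    have h1 := hζ j
    rw [← hz1 j hj] at h1
    exact h1.unique (represents_d _)
  have hTζ : ∀ j, T • ζ j = 0 := fun j => by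
    by_cases hj : bock j
    · have h1 := (hζ j).smul T
      rw [eq_neg_of_add_eq_zero_right (hzT j hj)] at h1
      exact (h1.unique (represents_d _).neg).trans neg_zero
    · rw [hζ0 j hj, smul_zero]
  let E := RestrictScalars.addEquiv O R (Submodule.torsionBy R (A.homology (m + 1)) T)
  let v : κ → RestrictScalars O R (Submodule.torsionBy R (A.homology (m + 1)) T) := fun j =>
    E.symm ⟨ζ j, hTζ j⟩
  have hEv : ∀ (s : Finset κ) (g : κ → O), (E (∑ j ∈ s, g j • v j)).1 =
      ∑ j ∈ s, algebraMap O R (g j) • ζ j := fun s g => by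
    rw [map_sum, AddSubmonoidClass.coe_finsetSum]
    rfl
  -- On `T`-torsion `R` acts through `aug`, which reduces the count to `O`-modules.
  have hact : ∀ (r : R) (h : A.homology (m + 1)), T • h = 0 →
      algebraMap O R (aug r) • h = r • h := fun r h hh => by
    obtain ⟨t, ht⟩ := H.dvd (r - algebraMap O R (aug r)) (by
      rw [map_sub, hεO, hε, sub_self])
    rw [← sub_eq_zero, ← sub_smul, ← neg_sub, ht, neg_smul, mul_comm, mul_smul, hh, smul_zero,
      neg_zero]
  refine finrank_tensorProduct_eq_card (fun j : {j // bock j} => v j)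
    (fun g hg => ?_) fun n => ?_
  · let G : κ → O := fun j => if h : bock j then g ⟨j, h⟩ else 0
    have hG : ∑ j, G j • v j = 0 := by
      rw [← hg, ← Fintype.sum_subtype_add_sum_subtype (fun j => (bock j : Prop))]
      have e1 : ∑ j : {j // ¬ (bock j : Prop)}, G j • v j = 0 :=
        Finset.sum_eq_zero fun j _ => by simp only [G, dif_neg j.2, zero_smul]
      rw [e1, add_zero]
      exact Finset.sum_congr rfl fun j _ => by simp only [G, dif_pos j.2]
    have h1 := Represents.sum hζ Finset.univ fun j => algebraMap O R (G j)
    rw [← hEv, hG, map_zero] at h1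
    -- A relation between the classes means that the combination of the `z j` is some `dw`. After
    -- reduction, `dw` has no component along the `z j` with `bock j`, since `ε T = 0`; so their
    -- coefficients vanish.
    obtain ⟨w, hw⟩ := Represents.exists_eq_d rfl h1
    have h2 := congrArg (toBC ε A.X (m + 1)) hw
    rw [map_sum] at h2
    simp only [toBC_smul, hεO] at h2
    have h3 : toBC ε A.X (m + 1) ((A.d m (m + 1)).hom w) = ∑ j, (b.repr (toBC ε A.X m w)
        (Sum.inl j) * ε (if bock j then -T else 1)) • toBC ε A.X (m + 1) (z j) := by
      have h4 := congrArg (bcHom ε (dFam A) m (m + 1)) (b.sum_repr (toBC ε A.X m w))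
      rw [bcHom_toBC] at h4
      refine h4.symm.trans ?_
      rw [Fintype.sum_sum_type, map_add, map_sum, map_sum]
      have e1 : ∑ j, bcHom ε (dFam A) m (m + 1)
          (b.repr (toBC ε A.X m w) (Sum.inr j) • b (Sum.inr j)) = 0 :=
        Finset.sum_eq_zero fun j _ => by
          rw [map_smul, hb, bcHom_toBC, Sum.elim_inr, hy, map_zero, smul_zero]
      rw [e1, add_zero]
      refine Finset.sum_congr rfl fun j _ => ?_
      rw [map_smul, hb, bcHom_toBC, Sum.elim_inl, hx, toBC_smul, smul_smul]
    rw [h3] at h2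
    rw [← sub_eq_zero, ← Finset.sum_sub_distrib] at h2
    simp only [← sub_smul] at h2
    intro j
    have h5 := Fintype.linearIndependent_iff.1 hz _ h2 j.1
    rw [if_pos j.2, map_neg, H.map_T, neg_zero, mul_zero, zero_sub, neg_eq_zero,
      map_eq_zero_iff _ (IsFractionRing.injective O K)] at h5
    simpa only [G, dif_pos j.2] using h5
  · obtain ⟨c, hc⟩ := exists_represents (E n).1
    have hTn : T • (E n).1 = 0 := (E n).2
    have h1 := hc.smul T
    rw [hTn] at h1
    obtain ⟨w, hw⟩ := h1.exists_eq_d rfl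
    have hm := hA.isFreeBaseChange_toBC ε m
    obtain ⟨e⟩ := hm.exists_basis_index b
    obtain ⟨e', he'⟩ := hm.exists_basis_map e
    have hdet : ε (e.det (Sum.elim x y)) ≠ 0 := by
      rw [← det_baseChange hm.smul e e' he', ← funext hb]
      exact (e'.isUnit_det b).ne_zero
    -- With `T c = dw`, the element `Δ • T • c` is a combination of the `z j`. Its coefficients
    -- reduce to `0`, hence are divisible by `T`; cancelling `T` writes `Δ • c` in terms of the `z
    -- j`, with `aug Δ ≠ 0`.
    obtain ⟨r, hr⟩ := exists_det_smul_eq_sum e (Sum.elim x y) w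
    set Δ := e.det (Sum.elim x y) with hΔ
    have h2 : Δ • T • c = ∑ j, (r (Sum.inl j) * (if bock j then -T else 1)) • z j := by
      have h3 := congrArg (A.d m (m + 1)).hom hr
      rw [map_smul, hw] at h3
      rw [h3, Fintype.sum_sum_type, map_add, map_sum, map_sum]
      have e1 : ∑ j, (A.d m (m + 1)).hom (r (Sum.inr j) • Sum.elim x y (Sum.inr j)) = 0 :=
        Finset.sum_eq_zero fun j _ => by rw [map_smul, Sum.elim_inr, hy, smul_zero]
      rw [e1, add_zero]
      refine Finset.sum_congr rfl fun j _ => ?_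
      rw [map_smul, Sum.elim_inl, hx, smul_smul]
    have h3 := congrArg (toBC ε A.X (m + 1)) h2
    rw [toBC_smul, toBC_smul, H.map_T, zero_smul, smul_zero, map_sum] at h3
    simp only [toBC_smul] at h3
    choose q hq using fun j => H.dvd _ (Fintype.linearIndependent_iff.1 hz _ h3.symm j)
    have h4 : Δ • c = ∑ j, q j • z j := by
      rw [← sub_eq_zero]
      apply H.smul_eq_zero hA
      rw [smul_sub, smul_comm T, h2, Finset.smul_sum, sub_eq_zero]
      exact Finset.sum_congr rfl fun j _ => by rw [hq, mul_smul]
    have h5 := hc.smul Δ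
    rw [h4] at h5
    have h6 := h5.unique (Represents.sum hζ Finset.univ q)
    refine ⟨aug Δ, fun h0 => hdet (by rw [hε, h0, map_zero]), ?_⟩
    have h7 : aug Δ • n = ∑ j, aug (q j) • v j := by
      apply E.injective
      apply Subtype.ext
      rw [hEv]
      change algebraMap O R (aug Δ) • (E n).1 = _
      rw [hact _ _ hTn, h6]
      exact Finset.sum_congr rfl fun j _ => (hact _ _ (hTζ j)).symm
    rw [h7]
    refine Submodule.sum_mem _ fun j _ => Submodule.smul_mem _ _ ?_
    by_cases hj : bock j
    · exact Submodule.subset_span ⟨⟨j, hj⟩, rfl⟩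
    · have : v j = 0 := by
        apply E.injective
        apply Subtype.ext
        rw [map_zero]
        exact hζ0 j hj
      rw [this]
      exact zero_mem _

end Rank

/-! ### The canonical trivialization and its comparison with the characteristic element. -/

section CanonicalTrivialization

variable {R k : Type} [CommRing R] [Field k] {T : R} {ε : R →+* k}
  {A : CochainComplex (ModuleCat.{0} R) ℤ}

theorem Bockstein.dFam_complex (B : Bockstein ε T A) (i : ℤ) :
    dFam B.complex i (i + 1) = (B.map i).hom :=
  congrArg ModuleCat.Hom.hom (CochainComplex.of_d (fun i => (baseChange ε A).homology i) B.map i)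

theorem dFam_cohomologyComplex (C : CochainComplex (ModuleCat.{0} k) ℤ) (i j : ℤ) :
    dFam (cohomologyComplex C) i j = 0 := by
  by_cases h : i + 1 = j
  · subst h
    exact congrArg ModuleCat.Hom.hom (CochainComplex.of_d (fun i => C.homology i) (fun _ => 0) i)
  · exact congrArg ModuleCat.Hom.hom ((cohomologyComplex C).shape i j h)

/-- Over a field there is a morphism from the cohomology to the complex which is the identity on
cohomology. -/
theorem exists_section_cohomology (C : CochainComplex (ModuleCat.{0} k) ℤ) :
    ∃ ι : cohomologyComplex C ⟶ C, ∀ i (h : C.homology i), Represents C i ((ι.f i).hom h) h := by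
  choose s hs using fun i => exists_pseudoInverse (C.homologyπ i).hom
  have hs' : ∀ i h, (C.homologyπ i).hom (s i h) = h := fun i h => by
    obtain ⟨z, rfl⟩ := (ModuleCat.epi_iff_surjective (C.homologyπ i)).1 inferInstance h
    exact (hs i).1 z
  refine ⟨{ f := fun i => ModuleCat.ofHom ((C.iCycles i).hom ∘ₗ s i)
            comm' := fun i j _ => ModuleCat.hom_ext (LinearMap.ext fun h => ?_) },
    fun i h => ⟨s i h, rfl, hs' i h⟩⟩
  have h1 : dFam (cohomologyComplex C) i j h = 0 :=
    LinearMap.congr_fun (dFam_cohomologyComplex C i j) h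
  have h2 : (C.iCycles j).hom (s j (dFam (cohomologyComplex C) i j h)) = 0 := by
    rw [h1]
    exact (congrArg _ (map_zero (s j))).trans (map_zero _)
  exact (hom_congr_apply (C.iCycles_d i j) (s i h)).trans h2.symm

theorem IsFiniteFree.homology {C : CochainComplex (ModuleCat.{0} k) ℤ} (hC : IsFiniteFree C.X)
    {π : ∀ i, C.X i →ₗ[k] C.homology i} (hπ : ∀ i, Function.Surjective (π i)) :
    IsFiniteFree fun i => C.homology i where
  finite i := by
    have := hC.finite i
    exact Module.Finite.of_surjective (π i) (hπ i)
  free i := Module.Free.of_divisionRing k _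
  bounded := by
    obtain ⟨m, n, h⟩ := hC.bounded
    refine ⟨m, n, fun i hi => ?_⟩
    have := h i hi
    exact (hπ i).subsingleton

/-- Compressing by `π` and `ι` turns a contraction of `D` into one of `β`; this yields the
trivialization of the Bockstein complex, without which no leading term would exist. -/
theorem IsRetract.isContraction_of_perturbedD {C : CochainComplex (ModuleCat.{0} k) ℤ}
    {H : ℤ → ModuleCat.{0} k} {ι : ∀ i, H i →ₗ[k] C.X i} {π : ∀ i, C.X i →ₗ[k] H i}
    {σ : GHom C.X C.X} (h : IsRetract C ι π σ) {β : GHom H H}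
    (hβ : ∀ i j l : ℤ, i + 1 = j → j + 1 = l → ∀ x, β j l (β i j x) = 0) {τ : GHom C.X C.X}
    (hτ : IsContraction (perturbedD C ι π β) τ) :
    IsContraction β fun j i => π i ∘ₗ τ j i ∘ₗ ι j where
  sq := hβ
  htpy i j l hij hjl x := by
    have h1 := congrArg (π j) (hτ.htpy i j l hij hjl (ι j x))
    simp only [perturbedD_apply, map_add, h.d_ι, h.π_ι, h.π_d _ _ _ hij, zero_add] at h1
    exact h1

/-- The value of a trivialization of `A` over `Q` and over `k`. -/
theorem Bockstein.exists_value [IsDomain R] (H : IsReduction T ε) (hA : IsFiniteFree A.X)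
    (B : Bockstein ε T A) (hB : ∀ i h, (B.map (i + 1)).hom h = 0 → ∃ h', (B.map i).hom h' = h)
    (ι : cohomologyComplex (baseChange ε A) ⟶ baseChange ε A)
    (hι : ∀ i (h : (baseChange ε A).homology i),
      Represents (baseChange ε A) i ((ι.f i).hom h) h)
    {r : ℤ} (hr : ∀ (J : Type) [Fintype J] (deg : J → ℤ) (bock : J → Bool) (x : ∀ j, A.X (deg j))
      (z : ∀ j, A.X (deg j + 1)) (b : ∀ i, Module.Basis (FamIndex deg i) k (bcTerms ε A.X i)),
      (∀ j, dFam A (deg j) (deg j + 1) (x j) = (if bock j then -T else 1) • z j) →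
      (∀ i s, b i s = toBC ε A.X i (fam x z i s)) →
      r = (Finset.univ.filter fun j => bock j ∧ ¬ Odd (deg j)).card -
          (Finset.univ.filter fun j => bock j ∧ Odd (deg j)).card)
    (a : Triv A.X) {a' : Triv (bcTerms ε A.X)} (ha : IsBCTriv ε a a') :
    ∃ (F : (FractionRing R)ˣ) (y : kˣ), IsCharElt (algebraMap R (FractionRing R)) A a F ∧
      HasLeading T ε F r ((-1) ^ r * y) ∧
      (∀ bH b, IsAcyclicTriv B.complex bH → IsDetComp ι bH b → a' = y • b) ∧
      ∃ bH b, IsAcyclicTriv B.complex bH ∧ IsDetComp ι bH b := by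
  obtain ⟨π, σ, hret, hπ⟩ := exists_isRetract (baseChange ε A) (fun i => (ι.f i).hom) hι
  let β : GHom (fun i => (baseChange ε A).homology i) (fun i => (baseChange ε A).homology i) :=
    dFam B.complex
  have hβ : ∀ i j l : ℤ, i + 1 = j → j + 1 = l → ∀ x, β j l (β i j x) = 0 := fun i j l _ _ x =>
    dFam_sq B.complex i j l x
  let D := perturbedD (baseChange ε A) (fun i => (ι.f i).hom) π β
  have hsq := hret.perturbedD_sq hβ
  obtain ⟨J, hJ, deg, bock, x, z, b, hxz, hDx, hb⟩ := exists_adapted_family H hA B hB hι hπ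
    (D := D) (fun i x => by
      rw [← B.dFam_complex]
      rfl)
  have := Fintype.ofFinite J
  obtain ⟨F, y, hF, hy, hlead⟩ := H.exists_values hA b hxz hsq hDx hb a ha
  have hV : IsFiniteFree (baseChange ε A).X := hA.baseChange ε
  have hHF : IsFiniteFree (cohomologyComplex (baseChange ε A)).X :=
    hV.homology (π := π) fun i h => ⟨_, hret.π_ι i h⟩
  refine ⟨F, y, hF, hlead r (hr J deg bock x z b hxz hb), fun bH b hbH hdet => ?_, ?_⟩
  -- The transferred trivialization `b` has value `1` for `D`, so the factor between `a'` and `b` is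
  -- the value `y` of `a'`.
  · rw [isAcyclicTriv_iff] at hbH
    have h1 : IsVal D b 1 := isVal_of_isDetComp ι (dFam_cohomologyComplex _) hV hHF hret hdet hbH
    obtain ⟨w, hw⟩ := a'.exists_eq_smul b
    have h2 := h1.smul w
    rw [mul_one] at h2
    have h3 : IsVal D a' w := by
      rw [hw]
      exact h2
    rw [hy.unique hV h3]
    exact hw
  · obtain ⟨τ, -, hτ, -, -⟩ := hy
    have hs := hret.isContraction_of_perturbedD hβ hτ
    obtain ⟨ψ, hψ⟩ := hs.exists_equiv hHF
    obtain ⟨t, -, ht, -⟩ := exists_cone_perturbation ι (dFam_cohomologyComplex _) hret hβ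
    obtain ⟨b, hb⟩ := exists_isDetComp hHF hV ι ht (Triv.mk 1 ψ) a'
    refine ⟨Triv.mk 1 ψ, b, ?_, hb⟩
    rw [isAcyclicTriv_iff]
    exact ⟨_, ψ, hs, hψ, (Triv.one_smul _).symm⟩

end CanonicalTrivialization

/-! ### Assembly for the Iwasawa algebra. -/

section Main

variable {p : ℕ} [Fact p.Prime] {Γ : Type} [CommGroup Γ] [TopologicalSpace Γ]

theorem augmentation_algebraMap (c : ℤ_[p]) :
    augmentation p Γ (algebraMap ℤ_[p] (IwasawaAlgebra p Γ) c) = c :=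
  (MonoidAlgebra.lift ℤ_[p] ℤ_[p] (Γ ⧸ ((⊤ : OpenSubgroup Γ) : Subgroup Γ)) 1).commutes c

theorem finrank_torsionBy_eq_card {γ : Γ}
    (H : IsReduction (varT p γ) (augmentationQ p Γ))
    {A : CochainComplex (ModuleCat.{0} (IwasawaAlgebra p Γ)) ℤ} (hA : IsFiniteFree A.X)
    {J : Type} [Fintype J] {deg : J → ℤ} {bock : J → Bool} {x : ∀ j, A.X (deg j)}
    {z : ∀ j, A.X (deg j + 1)}
    (b : ∀ i, Module.Basis (FamIndex deg i) ℚ_[p] (bcTerms (augmentationQ p Γ) A.X i))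
    (hxz : ∀ j, dFam A (deg j) (deg j + 1) (x j) = (if bock j then -varT p γ else 1) • z j)
    (hb : ∀ i s, b i s = toBC (augmentationQ p Γ) A.X i (fam x z i s)) (i : ℤ) :
    Module.finrank ℚ_[p] (ℚ_[p] ⊗[ℤ_[p]] RestrictScalars ℤ_[p] (IwasawaAlgebra p Γ)
      (Submodule.torsionBy (IwasawaAlgebra p Γ) (A.homology i) (varT p γ))) =
      (Finset.univ.filter fun j => bock j ∧ deg j + 1 = i).card := by
  classical
  obtain ⟨m, rfl⟩ : ∃ m, i = m + 1 := ⟨i - 1, by ring⟩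
  have hdz : ∀ j, dFam A (deg j + 1) (deg j + 1 + 1) (z j) = 0 := fun j => by
    have h1 := hxz j
    cases hj : bock j
    · rw [hj] at h1
      have h2 : z j = dFam A (deg j) (deg j + 1) (x j) := by simpa using h1.symm
      rw [h2, dFam_sq]
    · rw [hj] at h1
      refine H.d_eq_zero hA (x := x j) ?_
      have h2 : dFam A (deg j) (deg j + 1) (x j) = -(varT p γ • z j) := by simpa using h1
      exact eq_neg_iff_add_eq_zero.1 h2
  rw [finrank_torsionBy_homology (aug := augmentation p Γ) (ε := augmentationQ p Γ)
    (κ := {j // deg j = m}) (κ' := {j // deg j + 1 = m}) (bock := fun j => bock j.1)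
    augmentation_algebraMap (fun _ => rfl) H hA
    (x := fun j => fam x z m (Sum.inl j)) (y := fun j => fam x z m (Sum.inr j))
    (z := fun j => fam x z (m + 1) (Sum.inr ⟨j.1, by rw [j.2]⟩)) ?_ ?_ (b m) ?_ ?_]
  · rw [← Fintype.card_coe, Fintype.card_eq]
    refine ⟨{ toFun := fun j => ⟨j.1.1, by simpa using ⟨j.2, j.1.2⟩⟩
              invFun := fun j => ⟨⟨j.1, by
                have := j.2
                simp only [Finset.mem_filter, Finset.mem_univ, true_and] at this
                exact add_left_injective 1 this.2⟩, by
                have := j.2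
                simp only [Finset.mem_filter, Finset.mem_univ, true_and] at this
                exact this.1⟩
              left_inv := fun _ => rfl
              right_inv := fun _ => rfl }⟩
  · rintro ⟨j, rfl⟩
    exact hxz j
  · rintro ⟨j, rfl⟩
    exact hdz j
  · rintro (s | s) <;> exact hb m _
  · have h1 := (b (m + 1)).linearIndependent.comp
      (fun j : {j // deg j = m} => (Sum.inr ⟨j.1, by rw [j.2]⟩ : FamIndex deg (m + 1)))
      (fun j j' h => Subtype.ext (by simpa using h))
    have h2 : ⇑(b (m + 1)) = fun s => toBC (augmentationQ p Γ) A.X (m + 1) (fam x z (m + 1) s) :=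
      funext (hb (m + 1))
    rwa [h2] at h1

/-- A pair with `bock j` contributes to the cohomology in degree `deg j + 1`, with sign `(-1) ^ (deg
j + 2)`, that is, `+` for even and `-` for odd `deg j`. -/
theorem rGamma_eq {γ : Γ} (H : IsReduction (varT p γ) (augmentationQ p Γ))
    {A : CochainComplex (ModuleCat.{0} (IwasawaAlgebra p Γ)) ℤ} (hA : IsFiniteFree A.X)
    {J : Type} [Fintype J] {deg : J → ℤ} {bock : J → Bool} {x : ∀ j, A.X (deg j)}
    {z : ∀ j, A.X (deg j + 1)}
    (b : ∀ i, Module.Basis (FamIndex deg i) ℚ_[p] (bcTerms (augmentationQ p Γ) A.X i))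
    (hxz : ∀ j, dFam A (deg j) (deg j + 1) (x j) = (if bock j then -varT p γ else 1) • z j)
    (hb : ∀ i s, b i s = toBC (augmentationQ p Γ) A.X i (fam x z i s)) :
    rGamma p γ A = (Finset.univ.filter fun j => bock j ∧ ¬ Odd (deg j)).card -
      (Finset.univ.filter fun j => bock j ∧ Odd (deg j)).card := by
  classical
  rw [rGamma, finsum_congr fun i => by rw [finrank_torsionBy_eq_card H hA b hxz hb i]]
  rw [finsum_eq_sum_of_support_subset (s := Finset.univ.image fun j => deg j + 1)]
  · simp only [Finset.card_filter, Nat.cast_sum, Finset.mul_sum]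
    rw [Finset.sum_comm, ← Finset.sum_sub_distrib]
    refine Finset.sum_congr rfl fun j _ => ?_
    rw [Finset.sum_eq_single (deg j + 1)]
    · by_cases h : Odd (deg j)
      · have h2 : Odd (deg j + 1 + 1) := even_add_one' _ (odd_add_one _ h)
        rw [Int.negOnePow_odd _ h2]
        cases bock j <;> simp [h]
      · have h2 : Even (deg j + 1 + 1) := odd_add_one _ (even_add_one' _ (Int.not_odd_iff_even.1 h))
        rw [Int.negOnePow_even _ h2]
        cases bock j <;> simp [h]
    · intro i _ hi
      simp [Ne.symm hi]
    · intro hj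
      exact absurd (Finset.mem_image_of_mem _ (Finset.mem_univ j)) hj
  · intro i hi
    rw [Function.mem_support] at hi
    have hne : (Finset.univ.filter fun j => bock j ∧ deg j + 1 = i).card ≠ 0 := fun h0 =>
      hi (by rw [h0]; simp)
    obtain ⟨j, hj⟩ := Finset.card_ne_zero.1 hne
    simp only [Finset.mem_filter, Finset.mem_univ, true_and] at hj
    rw [Finset.mem_coe, Finset.mem_image]
    exact ⟨j, Finset.mem_univ j, hj.2⟩

theorem isCharElt_iff {R K : Type} [CommRing R] [Field K] (f : R →+* K)
    (A : CochainComplex (ModuleCat.{0} R) ℤ) (a : Triv A.X) (F : Kˣ) :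
    IsCharElt f A a F ↔ ∃ a' b : Triv (baseChange f A).X, IsBaseChangeTriv f A a a' ∧
      IsAcyclicTriv (baseChange f A) b ∧ a' = F • b := by
  constructor
  · rintro ⟨a', h1, σ, ψ, hσ, hψ, rfl⟩
    refine ⟨_, Triv.mk 1 ψ, h1, ?_, rfl⟩
    rw [isAcyclicTriv_iff]
    exact ⟨σ, ψ, hσ, hψ, (Triv.one_smul _).symm⟩
  · rintro ⟨a', b, h1, h2, rfl⟩
    rw [isAcyclicTriv_iff] at h2
    have h3 := h2.smul F
    rw [mul_one] at h3
    exact ⟨_, h1, h3⟩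

theorem Triv.smul_left_injective {R : Type} [CommRing R] {X : ℤ → ModuleCat.{0} R} (b : Triv X) :
    Function.Injective fun u : Rˣ => u • b := by
  intro u v h
  obtain ⟨w, φ, rfl⟩ := b.exists_mk
  have h1 : ∀ u : Rˣ, u • Triv.mk w φ = (u * w) • Triv.mk 1 φ := fun u => by
    rw [Triv.smul_mk, Triv.smul_mk, mul_one]
  have h2 : u • Triv.mk w φ = v • Triv.mk w φ := h
  rw [h1, h1] at h2
  exact mul_right_cancel (Triv.smul_mk_one_inj h2)

/-- The characteristic element of a semisimple complex has order `rGamma`, and its leading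
coefficient is the only leading term. -/
theorem IsSemisimple.exists_leadingTerm [IsLocalRing (IwasawaAlgebra p Γ)]
    [IsDomain (IwasawaAlgebra p Γ)] {γ : Γ} (H : IsReduction (varT p γ) (augmentationQ p Γ))
    {A : CochainComplex (ModuleCat.{0} (IwasawaAlgebra p Γ)) ℤ} (hA : IsSemisimple p γ A)
    (a : Triv A.X) :
    ∃ (F : (QΓ p Γ)ˣ) (c : ℚ_[p]ˣ), IsCharElt (algebraMap (IwasawaAlgebra p Γ) (QΓ p Γ)) A a F ∧
      HasLeadingTerm p γ F (rGamma p γ A) c ∧ ∀ x, IsLeadingTerm p γ A a x ↔ x = c := by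
  have hFF := hA.perfect.isFiniteFree
  obtain ⟨B₀, hB₀⟩ := hA.torsion
  have hex : ∀ (B : Bockstein (augmentationQ p Γ) (varT p γ) A) i h,
      (B.map (i + 1)).hom h = 0 → ∃ h', (B.map i).hom h' = h := fun B =>
    Bockstein.exact_of_torsion (f := augmentation p Γ) (g := algebraMap ℤ_[p] ℚ_[p])
      (fun c => ⟨_, augmentation_algebraMap c⟩) (IsFractionRing.injective ℤ_[p] ℚ_[p]) H hFF B₀ hB₀ B
  obtain ⟨a', ha'⟩ := exists_isBCTriv hFF (augmentationQ p Γ) a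
  have hval := fun (B : Bockstein (augmentationQ p Γ) (varT p γ) A) ι hι =>
    B.exists_value H hFF (hex B) ι hι (r := rGamma p γ A)
      (fun J _ deg bock x z b hxz hb => rGamma_eq H hFF b hxz hb) a ha'
  obtain ⟨B⟩ := H.nonempty_bockstein hFF
  obtain ⟨ι, hι⟩ := exists_section_cohomology (baseChange (augmentationQ p Γ) A)
  obtain ⟨F, y, hF, hlead, hy, bH, b, hbH, hdet⟩ := hval B ι hι
  refine ⟨F, _, hF, hlead, fun x => ⟨?_, ?_⟩⟩
  · rintro ⟨a'', b', y', hbc, ⟨B', bH', ι', hbH', hι', hdet'⟩, hay, rfl⟩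
    obtain rfl := IsBCTriv.unique hFF ha' hbc
    -- Another choice of Bockstein morphisms and of `ι` gives the same characteristic element, and
    -- uniqueness of its leading coefficient makes the value independent of the choices.
    obtain ⟨F', y₂, hF', hlead', hy', -⟩ := hval B' ι' hι'
    obtain rfl := hF.unique hFF hF'
    rw [← (hlead.unique H hlead').2.symm, Triv.smul_left_injective b'
      (hay.symm.trans (hy' _ _ hbH' hdet'))]
  · rintro rfl
    exact ⟨a', b, y, ha', ⟨B, bH, ι, hbH, hι, hdet⟩, hy _ _ hbH hdet, rfl⟩

end Main

end IwasawaLeadingTerm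
end

open IwasawaLeadingTerm in
theorem mainTheorem6 (p : ℕ) [Fact p.Prime] (Γ : Type) [CommGroup Γ] [TopologicalSpace Γ]
    [IsTopologicalGroup Γ] (hΓ : Nonempty (Γ ≃ₜ* Multiplicative ℤ_[p]))
    (γ : Γ) (hγ : Dense (Subgroup.zpowers γ : Set Γ)) :
    ∃ (ch : K1 (IsSemisimple p γ) →* (QΓ p Γ)ˣ) (lt : K1 (IsSemisimple p γ) →* ℚ_[p]ˣ)
      (ord : (QΓ p Γ)ˣ → ℤ) (lead : (QΓ p Γ)ˣ →* ℚ_[p]ˣ),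
      (∀ A (hA : IsSemisimple p γ A) (a : Triv A.X) (F : (QΓ p Γ)ˣ),
        ch (K1.mk A hA a) = F ↔ IsTheta p A a F) ∧
      (∀ A (hA : IsSemisimple p γ A) (a : Triv A.X) (x : ℚ_[p]ˣ),
        lt (K1.mk A hA a) = x ↔ IsLeadingTerm p γ A a x) ∧
      (∀ (F : (QΓ p Γ)ˣ) (r : ℤ) (c : ℚ_[p]ˣ),
        HasLeadingTerm p γ F r c ↔ ord F = r ∧ lead F = c) ∧
      (∀ A (hA : IsSemisimple p γ A) (a : Triv A.X),
        ord (ch (K1.mk A hA a)) = rGamma p γ A) ∧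
      lead.comp ch = lt := by
  have := isLocalRing_iwasawaAlgebra hΓ hγ
  have H := isReduction_augmentationQ hΓ hγ
  have := H.isDomain
  obtain ⟨ord, lead, hlead⟩ := H.exists_leadHom
  obtain ⟨ch, hch⟩ := exists_charHom (algebraMap (IwasawaAlgebra p Γ) (QΓ p Γ)) (IsSemisimple p γ)
    (fun A hA => hA.perfect.isFiniteFree) fun A hA a => by
      obtain ⟨F, c, hF, -⟩ := hA.exists_leadingTerm H a
      exact ⟨F, hF⟩
  -- Taking `lead.comp ch` as the leading term homomorphism makes the relations of `K1` automatic;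
  -- what has to be checked is that it computes `IsLeadingTerm` on generators.
  refine ⟨ch, lead.comp ch, ord, lead, fun A hA a F => ?_, fun A hA a x => ?_, hlead,
    fun A hA a => ?_, rfl⟩
  · exact (hch A hA a F).trans (isCharElt_iff _ A a F)
  · obtain ⟨F, c, hF, hc, hx⟩ := hA.exists_leadingTerm H a
    have h1 : ch (K1.mk A hA a) = F := (hch A hA a F).2 hF
    rw [hx, MonoidHom.comp_apply, h1, ((hlead F _ c).1 hc).2, eq_comm]
  · obtain ⟨F, c, hF, hc, -⟩ := hA.exists_leadingTerm H a
    have h1 : ch (K1.mk A hA a) = F := (hch A hA a F).2 hF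
    rw [h1, ((hlead F _ c).1 hc).1]
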